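/- Let $F$ be a number field with ring of integers $\mathcal O$, real places $\sigma_1,\dots,\sigma_r$ and complex places $\sigma_{r+1},\dots,\sigma_{r+s}$. Put $G=\prod_{j=1}^r \mathrm{SL}_2(\mathbb R)\times\prod_{j=r+1}^{r+s}\mathrm{SL}_2(\mathbb C)$, let $\Gamma=\mathrm{SL}_2(\mathcal O)$ be embedded in $G$ by $\gamma\mapsto(\sigma_1(\gamma),\dots,\sigma_{r+s}(\gamma))$, and let $X=\Gamma\backslash G$. Let $a\in G$ be a diagonal element, with component $\mathrm{diag}(t_j,t_j^{-1})$ at the $j$-th place, write $|t_j|=e^{a_j/2}$ with $a_j\in\mathbb R$, and let $T(x)=xa$ on $X$. Put $$h_{\max}(T)=\sum_{j\le r}|a_j|+2\sum_{j>r}|a_j|,\qquad a_*=\max_j|a_j| .$$ Assume $h_{\max}(T)>0$, and assume that at each complex place with $a_j=0$ the component of $a$ is central in $\mathrm{SL}_2(\mathbb C)$, that is, equal to $\pm1$. Let $$U^{+}=\{g: a^{-n}ga^{n}\to1,\ n\to-\infty\},\quad U^{-}=\{g: a^{-n}ga^{n}\to1,\ n\to+\infty\},\quad L=\{g: ga=ag\},$$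 and let $D=\dim U^+$ be the dimension of $U^+$ as a real Lie group. For $H=U^+$ or $H=U^-L$ let $B^H_\epsilon$ be the set of $h\in H$ all of whose matrix entries, at all places, are at distance less than $\epsilon$ from those of the identity. Let $d\in[0,D]$ and let $\nu$ be a Borel probability measure on $X$ of dimension at least $d$ in the unstable direction, meaning: for every $\delta>0$ there are $\epsilon'>0$ and $c>0$ such that $$\nu\bigl(xB^{U^+}_{\epsilon}B^{U^-L}_{\eta}\bigr)\le c\,\epsilon^{d-\delta}\qquad\text{for all } 0<\epsilon<\epsilon',\ \eta\in(0,1),\ x\in X .$$ Let $\mu_n=\frac1n\sum_{j=0}^{n-1}T^j_*\nu$ for $n\ge1$. Then every weak$^*$ limit $\mu_\infty$ of $(\mu_n)$, that is, every Borel measure on $X$, finite on compact sets, for which $\int f\,d\mu_{n_k}\to\int f\,d\mu_\infty$ for all $f\in C_c(X)$ along some subsequence $(n_k)$, satisfies $$\mu_\infty(X)\ \ge\ 1-\frac{2a_*(D-d)}{h_{\max}(T)} .$$ -/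

import Mathlib

open NumberField MeasureTheory Filter Topology
open scoped Pointwise MatrixGroups CompactlySupported

noncomputable section

namespace HilbertModular

variable (F : Type*) [Field F] [NumberField F]

/-- The real places of `F`. -/
abbrev RealPlace : Type _ := {w : InfinitePlace F // w.IsReal}

/-- The complex places of `F`. -/
abbrev ComplexPlace : Type _ := {w : InfinitePlace F // w.IsComplex}

/-- `G = ∏_{w real} SL₂(ℝ) × ∏_{w complex} SL₂(ℂ)`, with its product topology. -/
abbrev G : Type _ := (RealPlace F → SL(2, ℝ)) × (ComplexPlace F → SL(2, ℂ))

/-- The diagonal embedding `γ ↦ (σ_w(γ))_w` of `SL₂(𝓞 F)` into `G`. -/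
def Δ : SL(2, 𝓞 F) →* G F :=
  MonoidHom.prod
    (MonoidHom.pi fun w : RealPlace F =>
      Matrix.SpecialLinearGroup.map
        ((InfinitePlace.embedding_of_isReal w.2).comp (algebraMap (𝓞 F) F)))
    (MonoidHom.pi fun w : ComplexPlace F =>
      Matrix.SpecialLinearGroup.map (w.1.embedding.comp (algebraMap (𝓞 F) F)))

/-- The lattice `Γ = SL₂(𝓞 F)`, as a subgroup of `G`. -/
def Γ : Subgroup (G F) := (Δ F).range

/-- The space `X = Γ \ G` of cosets `Γ g`. -/
def X : Type _ := Quotient (QuotientGroup.rightRel (Γ F))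

instance : TopologicalSpace (X F) :=
  inferInstanceAs (TopologicalSpace (Quotient (QuotientGroup.rightRel (Γ F))))

instance : MeasurableSpace (X F) := borel (X F)

instance : BorelSpace (X F) := ⟨rfl⟩

variable {F}

/-- The right action of `G` on `X`: `(Γ h) · g = Γ (h g)`. -/
def act (x : X F) (g : G F) : X F :=
  Quotient.map' (s₁ := QuotientGroup.rightRel (Γ F)) (s₂ := QuotientGroup.rightRel (Γ F))
    (fun h => h * g)
    (fun h k hk => by
      rw [QuotientGroup.rightRel_apply] at hk ⊢
      simpa [mul_assoc] using hk) x

/-- The map `T(x) = x · a`. -/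
def T (a : G F) (x : X F) : X F := act x a

/-- `a` is a diagonal element of `G`. -/
def IsDiagonal (a : G F) : Prop :=
  (∀ w, (a.1 w : Matrix (Fin 2) (Fin 2) ℝ).IsDiag) ∧
    (∀ w, (a.2 w : Matrix (Fin 2) (Fin 2) ℂ).IsDiag)

open Classical in
/-- The real number `a_w` for which the component at `w` of the diagonal element `a` is
`diag(t, t⁻¹)` with `|t| = exp(a_w / 2)`. -/
def expo (a : G F) (w : InfinitePlace F) : ℝ :=
  if h : w.IsReal then 2 * Real.log ‖a.1 ⟨w, h⟩ 0 0‖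
  else 2 * Real.log ‖a.2 ⟨w, InfinitePlace.not_isReal_iff_isComplex.1 h⟩ 0 0‖

open Classical in
/-- `h_max(T) = h_r + 2 h_s`, where `h_r` is the sum of `|a_w|` over the real places and `h_s` is
the sum of `|a_w|` over the complex places. -/
def hMax (a : G F) : ℝ := ∑ w : RealPlace F, |expo a w.1| + 2 * ∑ w : ComplexPlace F, |expo a w.1|

/-- `a_* = max_w |a_w|`. -/
def aStar (a : G F) : ℝ :=
  (Finset.univ : Finset (InfinitePlace F)).sup' Finset.univ_nonempty fun w => |expo a w|

/-- The unstable subgroup `U⁺ = {g : a⁻ⁿ g aⁿ → 1 as n → -∞}`. -/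
def UPlus (a : G F) : Subgroup (G F) where
  carrier := {g | Tendsto (fun n : ℤ => a ^ (-n) * g * a ^ n) atBot (𝓝 1)}
  one_mem' := by simp
  mul_mem' := by
    intro g h hg hh
    have := Tendsto.mul hg hh
    simp only [mul_one] at this
    refine this.congr fun n => ?_
    simp only [zpow_neg]
    group
  inv_mem' := by
    intro g hg
    have := Tendsto.inv hg
    simp only [inv_one] at this
    refine this.congr fun n => ?_
    simp only [zpow_neg]
    group

/-- The stable subgroup `U⁻ = {g : a⁻ⁿ g aⁿ → 1 as n → +∞}`. -/
def UMinus (a : G F) : Subgroup (G F) where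
  carrier := {g | Tendsto (fun n : ℤ => a ^ (-n) * g * a ^ n) atTop (𝓝 1)}
  one_mem' := by simp
  mul_mem' := by
    intro g h hg hh
    have := Tendsto.mul hg hh
    simp only [mul_one] at this
    refine this.congr fun n => ?_
    simp only [zpow_neg]
    group
  inv_mem' := by
    intro g hg
    have := Tendsto.inv hg
    simp only [inv_one] at this
    refine this.congr fun n => ?_
    simp only [zpow_neg]
    group

/-- The centralizer `L = {g : g a = a g}`. -/
def L (a : G F) : Subgroup (G F) := Subgroup.centralizer {a}

variable (F) in
/-- The real algebra `∏_{w real} M₂(ℝ) × ∏_{w complex} M₂(ℂ)` in which `G` lies. -/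
abbrev Mat : Type _ :=
  (RealPlace F → Matrix (Fin 2) (Fin 2) ℝ) × (ComplexPlace F → Matrix (Fin 2) (Fin 2) ℂ)

/-- The inclusion of `G` in the matrix algebra. -/
def toMat (g : G F) : Mat F := (fun w => (g.1 w).1, fun w => (g.2 w).1)

/-- The dimension of a closed subgroup `H` of `G` as a real Lie group, that is, the real dimension
of its Lie algebra `{A : exp(tA) ∈ H for all real t}`. -/
def lieDim (H : Subgroup (G F)) : ℕ :=
  Module.finrank ℝ
    (Submodule.span ℝ {A : Mat F | ∀ t : ℝ, ∃ h ∈ H, toMat h = NormedSpace.exp (t • A)})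

/-- The open ball of radius `ε` about `1` in a subgroup `H` of `G`, for the distance
`max |g_{ij} - h_{ij}|` (maximum over all places and all matrix entries). -/
def ball (H : Set (G F)) (ε : ℝ) : Set (G F) :=
  {h | h ∈ H ∧
    (∀ w i j, ‖(h.1 w) i j - (1 : Matrix (Fin 2) (Fin 2) ℝ) i j‖ < ε) ∧
    (∀ w i j, ‖(h.2 w) i j - (1 : Matrix (Fin 2) (Fin 2) ℂ) i j‖ < ε)}

/-- `ν` has dimension at least `d` in the unstable direction with respect to `a`: for every
`δ > 0`, `ν(x B_ε^{U⁺} B_η^{U⁻L}) ≪ ε^{d-δ}` for all small `ε`, all `η ∈ (0,1)` and all `x`. -/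
def UnstableDimGE (a : G F) (ν : Measure (X F)) (d : ℝ) : Prop :=
  ∀ δ : ℝ, 0 < δ → ∃ ε' : ℝ, 0 < ε' ∧ ∃ c : ℝ, 0 < c ∧
    ∀ ε : ℝ, 0 < ε → ε < ε' → ∀ η : ℝ, 0 < η → η < 1 → ∀ x : X F,
      ν (act x '' (ball (UPlus a : Set (G F)) ε *
          ball ((UMinus a : Set (G F)) * (L a : Set (G F))) η)) ≤
        ENNReal.ofReal (c * ε ^ (d - δ))

/-- The averages `μ_n = (1/n) ∑_{j<n} T^j_* ν` (used for `n ≥ 1`). -/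
def average (a : G F) (ν : Measure (X F)) (n : ℕ) : Measure (X F) :=
  (n : ENNReal)⁻¹ • ∑ j ∈ Finset.range n, ν.map ((T a)^[j])

/-- `μ` is a weak* limit of `(μ_n)`: along some subsequence, `∫ f dμ_{n_k} → ∫ f dμ` for all
continuous compactly supported `f`. -/
def IsWeakStarLimit (μs : ℕ → Measure (X F)) (μ : Measure (X F)) : Prop :=
  ∃ φ : ℕ → ℕ, StrictMono φ ∧ ∀ f : C_c(X F, ℝ),
    Tendsto (fun k => ∫ x, f x ∂(μs (φ k))) atTop (𝓝 (∫ x, f x ∂μ))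

end HilbertModular

end

set_option linter.unusedSectionVars false


/-! ### Integral row vectors at the infinite places and the systole. -/

noncomputable section

namespace HilbertModular

variable {F : Type*} [Field F] [NumberField F]

/-! ### Complexified components -/

/-! The proof bounds the time that orbits spend in the cusp by means of a Margulis function. For a
nonzero integral row vector v, `Nm v g` is the product over all places of the normalized norms of v
g, and `sys g` is its infimum over v. The function `sys` is invariant under Γ, and its superlevel
sets {sys ≥ c}, c > 0, are compact in X (`isCompact_le_sysX`). It therefore suffices to show that
the averages give {sys < τ} little mass.

Average expansion (`exists_lintegral_Nm_le`): for 0 < β < 1, the integral of Nm(v, g u a^m)^(-β)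
over u in a ball of U⁺ is at most C exp(-β m h_max / 2) Nm(v, g)^(-β), with C independent of m.
Indeed, at each non-neutral place one coordinate of the vector is stretched by exp(m|a_w|/2). Before
stretching, that coordinate is an affine function of the unstable parameter, and the powers |z|^(-β)
on ℝ and |z|^(-2β) on ℂ are locally integrable.

If τ is small in terms of m, all vectors that become short near g lie on a single line, and one of
them is shortest everywhere on G (`exists_shortest`). Hence each visit to the cusp at a time m, 2m,
... can be given the weight exp(β m h_max / 2) at the cost of a factor K per step, where K does not
depend on m (`lintegral_alpha_step`, `lintegral_weight_le`). By Markov's inequality, the unstable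
parameters with at least n visits in k steps have volume O(K^k exp(-n β m h_max / 2)).

To pass from volume to ν, note that two points differing by an unstable displacement of size exp(-N
a_*) and a bounded stable or central one have comparable systoles up to time N (`sys_transfer`). A
Vitali covering (`measure_inter_chart_le`) then shows that the points of a chart spending a
proportion κ of the time N in the cusp have ν-measure O(exp(N a_*(D-d+δ)) K^(N/m) exp(-N β κ h_max /
2)). Taking δ small, m large and β close to 1, this tends to 0 as soon as κ > 2 a_*(D-d)/h_max
(`exists_tendsto_measure_cuspTime`). A compactly supported cutoff carries the resulting tightness
bound to the weak* limit. -/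

/-- The embedding of the ring of integers at an infinite place. -/
def emb (w : InfinitePlace F) : 𝓞 F →+* ℂ := w.embedding.comp (algebraMap (𝓞 F) F)

open Classical in
/-- The component of an element of `G` at an infinite place, in `SL₂(ℂ)`. -/
def comp (w : InfinitePlace F) : G F →* SL(2, ℂ) :=
  if h : w.IsReal then
    (Matrix.SpecialLinearGroup.map Complex.ofRealHom).comp
      ((Pi.evalMonoidHom _ (⟨w, h⟩ : RealPlace F)).comp (MonoidHom.fst _ _))
  else
    (Pi.evalMonoidHom _ (⟨w, InfinitePlace.not_isReal_iff_isComplex.1 h⟩ : ComplexPlace F)).comp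
      (MonoidHom.snd _ _)

lemma comp_real (w : RealPlace F) (g : G F) :
    comp w.1 g = Matrix.SpecialLinearGroup.map Complex.ofRealHom (g.1 w) := by
  simp [comp, w.2]

lemma comp_complex (w : ComplexPlace F) (g : G F) : comp w.1 g = g.2 w := by
  simp [comp, InfinitePlace.not_isReal_iff_isComplex.2 w.2]

lemma comp_real_apply (w : RealPlace F) (g : G F) (i j : Fin 2) :
    comp w.1 g i j = ((g.1 w i j : ℝ) : ℂ) := by
  rw [comp_real]; rfl

lemma place_cases {P : InfinitePlace F → Prop} (hr : ∀ w : RealPlace F, P w.1)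
    (hc : ∀ w : ComplexPlace F, P w.1) (w : InfinitePlace F) : P w := by
  by_cases h : w.IsReal
  · exact hr ⟨w, h⟩
  · exact hc ⟨w, InfinitePlace.not_isReal_iff_isComplex.1 h⟩

lemma ext_comp {g h : G F} (H : ∀ w, comp w g = comp w h) : g = h := by
  refine Prod.ext (funext fun w => ?_) (funext fun w => ?_)
  · ext i j
    have := congrArg (fun m : SL(2, ℂ) => m i j) (H w.1)
    simpa [comp_real_apply] using this
  · simpa [comp_complex] using H w.1

lemma continuous_comp (w : InfinitePlace F) : Continuous (comp w : G F → SL(2, ℂ)) := by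
  refine place_cases (P := fun w => Continuous (comp w : G F → SL(2, ℂ))) (fun w => ?_)
    (fun w => ?_) w
  · simp_rw [funext (comp_real w)]
    refine Continuous.subtype_mk (continuous_matrix fun i j => ?_) _
    simp only [RingHom.mapMatrix_apply, Matrix.map_apply, Complex.ofRealHom_eq_coe]
    have : Continuous fun g : G F => (g.1 w : Matrix (Fin 2) (Fin 2) ℝ) :=
      continuous_subtype_val.comp (by fun_prop)
    exact Complex.continuous_ofReal.comp (this.matrix_elem i j)
  · simp_rw [funext (comp_complex w)]
    fun_prop

lemma continuous_comp_apply (w : InfinitePlace F) (i j : Fin 2) :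
    Continuous fun g : G F => comp w g i j :=
  Continuous.matrix_elem (continuous_subtype_val.comp (continuous_comp w)) i j

lemma comp_Δ (w : InfinitePlace F) (γ : SL(2, 𝓞 F)) :
    comp w (Δ F γ) = Matrix.SpecialLinearGroup.map (emb w) γ := by
  refine place_cases (P := fun w => comp w (Δ F γ) = Matrix.SpecialLinearGroup.map (emb w) γ)
    (fun w => ?_) (fun w => ?_) w
  · rw [comp_real]
    ext i j
    simp [Δ, emb, InfinitePlace.embedding_of_isReal_apply]
  · rw [comp_complex]
    rfl

/-! ### Row vectors and their norms -/

/-- The row vector `σ_w(v) g_w`. -/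
def vec (v : Fin 2 → 𝓞 F) (g : G F) (w : InfinitePlace F) : Fin 2 → ℂ :=
  Matrix.vecMul (fun i => emb w (v i)) (comp w g).1

/-- The product over all places of the normalized norms of the components of `v g`. -/
def Nm (v : Fin 2 → 𝓞 F) (g : G F) : ℝ := ∏ w, ‖vec v g w‖ ^ w.mult

lemma vec_mul (v : Fin 2 → 𝓞 F) (g h : G F) (w : InfinitePlace F) :
    vec v (g * h) w = Matrix.vecMul (vec v g w) (comp w h).1 := by
  simp [vec, map_mul]

lemma vec_Δ_mul (v : Fin 2 → 𝓞 F) (γ : SL(2, 𝓞 F)) (g : G F) (w : InfinitePlace F) :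
    vec v (Δ F γ * g) w = vec (Matrix.vecMul v γ.1) g w := by
  rw [vec_mul]
  unfold vec
  rw [comp_Δ]
  congr 1
  ext j
  simp [Matrix.vecMul, dotProduct, Fin.sum_univ_two]

lemma Nm_Δ_mul (v : Fin 2 → 𝓞 F) (γ : SL(2, 𝓞 F)) (g : G F) :
    Nm v (Δ F γ * g) = Nm (Matrix.vecMul v γ.1) g := by
  simp only [Nm, vec_Δ_mul]

lemma Nm_nonneg (v : Fin 2 → 𝓞 F) (g : G F) : 0 ≤ Nm v g := by
  unfold Nm; positivity

lemma vec_smul (c : 𝓞 F) (v : Fin 2 → 𝓞 F) (g : G F) (w : InfinitePlace F) :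
    vec (c • v) g w = emb w c • vec v g w := by
  rw [vec, vec, ← Matrix.smul_vecMul]
  congr 1
  ext i
  simp

/-- The absolute value of the norm of an algebraic integer. -/
def nrm (x : 𝓞 F) : ℕ := (Algebra.norm ℤ x).natAbs

lemma nrm_eq_zero {x : 𝓞 F} : nrm x = 0 ↔ x = 0 := by
  simp [nrm, Algebra.norm_eq_zero_iff]

lemma prod_emb (x : 𝓞 F) : ∏ w : InfinitePlace F, ‖emb w x‖ ^ w.mult = nrm x := by
  have := InfinitePlace.prod_eq_abs_norm (x : F)
  simp only [emb, RingHom.comp_apply, InfinitePlace.norm_embedding_eq]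
  rw [this, ← Algebra.coe_norm_int, nrm]
  simp [Nat.cast_natAbs]

lemma one_le_nrm {x : 𝓞 F} (hx : x ≠ 0) : (1 : ℝ) ≤ nrm x := by
  exact_mod_cast Nat.one_le_iff_ne_zero.2 (mt nrm_eq_zero.1 hx)

lemma Nm_smul (c : 𝓞 F) (v : Fin 2 → 𝓞 F) (g : G F) : Nm (c • v) g = nrm c * Nm v g := by
  simp only [Nm, vec_smul, norm_smul, mul_pow, Finset.prod_mul_distrib, prod_emb]

/-- The operator norm for the action of a matrix on row vectors with the supremum norm. -/
def colNorm (M : Matrix (Fin 2) (Fin 2) ℂ) : ℝ :=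
  max (‖M 0 0‖ + ‖M 1 0‖) (‖M 0 1‖ + ‖M 1 1‖)

lemma colNorm_nonneg (M : Matrix (Fin 2) (Fin 2) ℂ) : 0 ≤ colNorm M :=
  le_max_of_le_left (by positivity)

lemma colNorm_one : colNorm 1 = 1 := by simp [colNorm]

lemma norm_vecMul_le (x : Fin 2 → ℂ) (M : Matrix (Fin 2) (Fin 2) ℂ) :
    ‖Matrix.vecMul x M‖ ≤ colNorm M * ‖x‖ := by
  rw [pi_norm_le_iff_of_nonneg (mul_nonneg (colNorm_nonneg M) (norm_nonneg _))]
  intro j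
  have h : ‖Matrix.vecMul x M j‖ ≤ (‖M 0 j‖ + ‖M 1 j‖) * ‖x‖ := by
    simp only [Matrix.vecMul, dotProduct, Fin.sum_univ_two]
    refine (norm_add_le _ _).trans ?_
    rw [norm_mul, norm_mul]
    nlinarith [norm_le_pi_norm x 0, norm_le_pi_norm x 1, norm_nonneg (M 0 j), norm_nonneg (M 1 j)]
  refine h.trans (mul_le_mul_of_nonneg_right ?_ (norm_nonneg _))
  fin_cases j
  · exact le_max_left _ _
  · exact le_max_right _ _

/-- The factor by which right multiplication by `h` can enlarge `Nm`. -/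
def distort (h : G F) : ℝ := ∏ w, colNorm (comp w h).1 ^ w.mult

lemma distort_nonneg (h : G F) : 0 ≤ distort h :=
  Finset.prod_nonneg fun _ _ => pow_nonneg (colNorm_nonneg _) _

lemma distort_one : distort (1 : G F) = 1 := by
  simp [distort, colNorm_one]

lemma continuous_distort : Continuous (distort : G F → ℝ) := by
  unfold distort colNorm
  refine continuous_finsetProd _ fun w _ => Continuous.pow ?_ _
  have := continuous_comp_apply (F := F) w
  exact (((this 0 0).norm.add (this 1 0).norm)).max ((this 0 1).norm.add (this 1 1).norm)

lemma Nm_mul_le (v : Fin 2 → 𝓞 F) (g h : G F) : Nm v (g * h) ≤ distort h * Nm v g := by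
  unfold Nm distort
  rw [← Finset.prod_mul_distrib]
  refine Finset.prod_le_prod (fun _ _ => by positivity) fun w _ => ?_
  rw [← mul_pow, vec_mul]
  exact pow_le_pow_left₀ (norm_nonneg _) (norm_vecMul_le _ _) _

lemma Nm_le_mul (v : Fin 2 → 𝓞 F) (g h : G F) : Nm v g ≤ distort h⁻¹ * Nm v (g * h) := by
  simpa using Nm_mul_le v (g * h) h⁻¹

/-- The sup norm at each place dominates a fixed nonzero coordinate, and the product of the absolute
values of that coordinate is the norm of a nonzero algebraic integer. -/
lemma one_le_Nm_one {v : Fin 2 → 𝓞 F} (hv : v ≠ 0) : 1 ≤ Nm v (1 : G F) := by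
  obtain ⟨i, hi⟩ := Function.ne_iff.1 hv
  refine (one_le_nrm hi).trans ?_
  rw [← prod_emb]
  refine Finset.prod_le_prod (fun _ _ => by positivity) fun w _ => ?_
  refine pow_le_pow_left₀ (norm_nonneg _) ?_ _
  have := norm_le_pi_norm (vec v (1 : G F) w) i
  simpa [vec] using this

lemma distort_pos (g : G F) : 0 < distort g := by
  have h := Nm_mul_le (![1, 0] : Fin 2 → 𝓞 F) g⁻¹ g
  have h1 : (![1, 0] : Fin 2 → 𝓞 F) ≠ 0 := fun h => by simpa using congrFun h 0
  have := one_le_Nm_one h1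
  rw [inv_mul_cancel] at h
  rcases (distort_nonneg g).lt_or_eq with h2 | h2
  · exact h2
  · rw [← h2, zero_mul] at h
    linarith

/-- Moving from g back to the identity enlarges `Nm` by at most `distort g⁻¹`. The bound does not
depend on v, which is what makes the systole positive. -/
lemma inv_distort_le_Nm {v : Fin 2 → 𝓞 F} (hv : v ≠ 0) (g : G F) : (distort g⁻¹)⁻¹ ≤ Nm v g := by
  have h := Nm_le_mul v 1 g
  rw [one_mul] at h
  rw [inv_le_iff_one_le_mul₀ (distort_pos _), mul_comm]
  exact (one_le_Nm_one hv).trans h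

lemma Nm_pos {v : Fin 2 → 𝓞 F} (hv : v ≠ 0) (g : G F) : 0 < Nm v g :=
  (inv_pos.2 (distort_pos _)).trans_le (inv_distort_le_Nm hv g)

/-! ### Linear dependence -/

lemma norm_det_le (x y : Fin 2 → ℂ) : ‖x 0 * y 1 - x 1 * y 0‖ ≤ 2 * (‖x‖ * ‖y‖) := by
  refine (norm_sub_le _ _).trans ?_
  rw [norm_mul, norm_mul, two_mul]
  gcongr <;> exact norm_le_pi_norm _ _

/-- Right multiplication by a matrix of determinant 1 preserves the area form on row vectors. -/
lemma emb_det (v v' : Fin 2 → 𝓞 F) (g : G F) (w : InfinitePlace F) :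
    emb w (v 0 * v' 1 - v 1 * v' 0) = vec v g w 0 * vec v' g w 1 - vec v g w 1 * vec v' g w 0 := by
  have h := (comp w g).2
  rw [Matrix.det_fin_two] at h
  simp only [vec, Matrix.vecMul, dotProduct, Fin.sum_univ_two, map_sub, map_mul]
  linear_combination (-(emb w (v 0) * emb w (v' 1) - emb w (v 1) * emb w (v' 0))) * h

/-- The determinant of two independent integral vectors has norm at least 1, while at each place it
is at most twice the product of their lengths. So two independent vectors cannot both be short at
the same point. -/
lemma one_le_Nm_mul_Nm {v v' : Fin 2 → 𝓞 F} (h : v 0 * v' 1 - v 1 * v' 0 ≠ 0) (g : G F) :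
    1 ≤ (∏ w : InfinitePlace F, (2 : ℝ) ^ w.mult) * (Nm v g * Nm v' g) := by
  refine (one_le_nrm h).trans ?_
  rw [← prod_emb]
  unfold Nm
  rw [← Finset.prod_mul_distrib, ← Finset.prod_mul_distrib]
  refine Finset.prod_le_prod (fun _ _ => by positivity) fun w _ => ?_
  rw [← mul_pow, ← mul_pow]
  refine pow_le_pow_left₀ (norm_nonneg _) ?_ _
  rw [emb_det v v' g]
  exact norm_det_le _ _

/-- A measure of the size of an integral vector which is proportional to `Nm` on lines. -/
def vnrm (v : Fin 2 → 𝓞 F) : ℕ := nrm (v 0) + nrm (v 1)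

lemma vnrm_pos {v : Fin 2 → 𝓞 F} (hv : v ≠ 0) : 0 < vnrm v := by
  by_contra h
  refine hv (funext fun i => ?_)
  have h0 : nrm (v 0) = 0 ∧ nrm (v 1) = 0 := by unfold vnrm at h; omega
  fin_cases i
  · exact nrm_eq_zero.1 h0.1
  · exact nrm_eq_zero.1 h0.2

/-- Dependence gives v_i v' = v'_i v for both i; take `Nm` of these identities and add. The ratio
Nm(v)/Nm(v') on a line is thus independent of g and is computed by a natural number attached to each
vector. This replaces primitive vectors, which need not exist when the class number exceeds 1. -/
lemma vnrm_mul_Nm {v v' : Fin 2 → 𝓞 F} (h : v 0 * v' 1 - v 1 * v' 0 = 0) (g : G F) :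
    vnrm v * Nm v' g = vnrm v' * Nm v g := by
  have key : ∀ i, v i • v' = v' i • v := by
    simp only [Fin.forall_fin_two, funext_iff, Pi.smul_apply, smul_eq_mul]
    exact ⟨⟨by ring, by linear_combination h⟩, by linear_combination -h, by ring⟩
  have h0 := Nm_smul (v 0) v' g
  have h1 := Nm_smul (v 1) v' g
  rw [key, Nm_smul] at h0 h1
  simp only [vnrm, Nat.cast_add]
  linarith

/-! ### The systole -/

/-- The smallest value of `Nm v g` for nonzero integral vectors `v`. -/
def sys (g : G F) : ℝ := ⨅ v : {v : Fin 2 → 𝓞 F // v ≠ 0}, Nm v.1 g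

instance : Nonempty {v : Fin 2 → 𝓞 F // v ≠ 0} :=
  ⟨⟨![1, 0], fun h => by simpa using congrFun h 0⟩⟩

lemma bddBelow_Nm (g : G F) :
    BddBelow (Set.range fun v : {v : Fin 2 → 𝓞 F // v ≠ 0} => Nm v.1 g) :=
  ⟨0, by rintro _ ⟨v, rfl⟩; exact Nm_nonneg _ _⟩

lemma sys_le {v : Fin 2 → 𝓞 F} (hv : v ≠ 0) (g : G F) : sys g ≤ Nm v g :=
  ciInf_le (bddBelow_Nm g) ⟨v, hv⟩

lemma sys_lt_iff {g : G F} {c : ℝ} : sys g < c ↔ ∃ v : Fin 2 → 𝓞 F, v ≠ 0 ∧ Nm v g < c := by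
  rw [sys, ciInf_lt_iff (bddBelow_Nm g)]
  simp

lemma sys_pos (g : G F) : 0 < sys g :=
  (inv_pos.2 (distort_pos _)).trans_le (le_ciInf fun v => inv_distort_le_Nm v.2 g)

lemma sys_mul_le (g h : G F) : sys (g * h) ≤ distort h * sys g := by
  unfold sys
  rw [Real.mul_iInf_of_nonneg (distort_nonneg h)]
  exact ciInf_mono (bddBelow_Nm _) fun v => Nm_mul_le _ _ _

/-- The ratio sys(h)/sys(g) lies between 1/distort(h⁻¹g) and distort(g⁻¹h), and both tend to 1 as h
→ g. -/
lemma continuous_sys : Continuous (sys : G F → ℝ) := by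
  rw [continuous_iff_continuousAt]
  intro g
  have hu : Tendsto (fun h : G F => distort (g⁻¹ * h) * sys g) (𝓝 g) (𝓝 (sys g)) := by
    have : Continuous fun h : G F => distort (g⁻¹ * h) * sys g :=
      (continuous_distort.comp (by fun_prop)).mul continuous_const
    simpa [distort_one] using this.tendsto g
  have hl : Tendsto (fun h : G F => (distort (h⁻¹ * g))⁻¹ * sys g) (𝓝 g) (𝓝 (sys g)) := by
    have : Continuous fun h : G F => (distort (h⁻¹ * g))⁻¹ * sys g :=
      ((continuous_distort.comp (by fun_prop)).inv₀ fun h => (distort_pos _).ne').mul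
        continuous_const
    simpa [distort_one] using this.tendsto g
  refine tendsto_of_tendsto_of_tendsto_of_le_of_le hl hu (fun h => ?_) fun h => ?_
  · have := sys_mul_le h (h⁻¹ * g)
    rw [mul_inv_cancel_left] at this
    exact (inv_mul_le_iff₀ (distort_pos _)).2 this
  · simpa using sys_mul_le g (g⁻¹ * h)

lemma vecMul_ne_zero {v : Fin 2 → 𝓞 F} (hv : v ≠ 0) (γ : SL(2, 𝓞 F)) :
    Matrix.vecMul v γ.1 ≠ 0 := by
  intro h
  apply hv
  have := congrArg (fun x => Matrix.vecMul x (γ⁻¹).1) h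
  simp only [Matrix.vecMul_vecMul, Matrix.zero_vecMul] at this
  rw [← Matrix.SpecialLinearGroup.coe_mul, mul_inv_cancel] at this
  simpa using this

lemma sys_Δ_mul (γ : SL(2, 𝓞 F)) (g : G F) : sys (Δ F γ * g) = sys g := by
  have key : ∀ (γ : SL(2, 𝓞 F)) (g : G F), sys g ≤ sys (Δ F γ * g) := fun γ g =>
    le_ciInf fun v => by
      rw [Nm_Δ_mul]
      exact sys_le (vecMul_ne_zero v.2 γ) g
  refine le_antisymm ?_ (key γ g)
  simpa [← mul_assoc, ← map_mul] using key γ⁻¹ (Δ F γ * g)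

end HilbertModular

end

/-! ### Reduction theory and Mahler's compactness criterion. -/

noncomputable section

namespace HilbertModular

variable {F : Type*} [Field F] [NumberField F]

/-! ### Short vectors -/

open NumberField.mixedEmbedding in
/-- An element of `G` as a matrix over the mixed space. -/
def mixedMatrix (g : G F) : Matrix (Fin 2) (Fin 2) (mixedSpace F) :=
  Matrix.of fun i j => (fun w => g.1 w i j, fun w => g.2 w i j)

lemma det_mixedMatrix (g : G F) : (mixedMatrix g).det = 1 := by
  rw [Matrix.det_fin_two]
  refine Prod.ext (funext fun w => ?_) (funext fun w => ?_)
  · have := (g.1 w).2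
    rw [Matrix.det_fin_two] at this
    simpa [mixedMatrix] using this
  · have := (g.2 w).2
    rw [Matrix.det_fin_two] at this
    simpa [mixedMatrix] using this

open NumberField.mixedEmbedding in
open scoped Classical in
lemma norm_vec_le_norm_mixed (v : Fin 2 → 𝓞 F) (g : G F) (w : InfinitePlace F) :
    ‖vec v g w‖ ≤
      ‖Matrix.toLin' (mixedMatrix g).transpose (fun i => mixedEmbedding F (v i))‖ := by
  rw [Matrix.toLin'_apply, Matrix.mulVec_transpose, pi_norm_le_iff_of_nonneg (norm_nonneg _)]
  intro j
  refine le_trans ?_ (norm_le_pi_norm _ j)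
  refine place_cases (P := fun w => ‖vec v g w j‖ ≤ _) (fun w => ?_) (fun w => ?_) w
  · refine le_trans ?_ ((norm_le_pi_norm _ w).trans (norm_fst_le _))
    rw [← Complex.norm_real]
    refine le_of_eq (congrArg _ ?_)
    simp [vec, Matrix.vecMul, dotProduct, mixedMatrix, comp_real_apply, emb,
      mixedEmbedding_apply_isReal, InfinitePlace.embedding_of_isReal_apply]
  · refine le_trans ?_ ((norm_le_pi_norm _ w).trans (norm_snd_le _))
    refine le_of_eq (congrArg _ ?_)
    simp [vec, Matrix.vecMul, dotProduct, mixedMatrix, comp_complex, emb,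
      mixedEmbedding_apply_isComplex]

open NumberField.mixedEmbedding in
/-- Minkowski's theorem for the lattices `𝓞² g`, with a bound uniform in `g`. -/
theorem exists_short_vector (F : Type*) [Field F] [NumberField F] :
    ∃ R : ℝ, 0 < R ∧ ∀ g : G F, ∃ v : Fin 2 → 𝓞 F, v ≠ 0 ∧ ∀ w, ‖vec v g w‖ ≤ R := by
  classical
  let E := Fin 2 → mixedSpace F
  let _ : MeasurableSpace E := borel E
  have : BorelSpace E := ⟨rfl⟩
  let μ : Measure E := Measure.addHaar
  let b := Pi.basis fun _ : Fin 2 => latticeBasis F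
  -- The radius is chosen once so that the volume of the ball beats Minkowski's bound. It serves
  -- every g because g acts with determinant 1.
  have hfin : μ (ZSpan.fundamentalDomain b) * 2 ^ Module.finrank ℝ E < ⊤ :=
    ENNReal.mul_lt_top (ZSpan.fundamentalDomain_isBounded b).measure_lt_top
      (ENNReal.pow_lt_top (by simp))
  have hlim : Tendsto (fun n : ℕ => μ (Metric.ball (0 : E) n)) atTop (𝓝 ⊤) := by
    have h := tendsto_measure_iUnion_atTop (μ := μ)
      (s := fun n : ℕ => Metric.ball (0 : E) n)
      (fun m n hmn => Metric.ball_subset_ball (by exact_mod_cast hmn))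
    rw [Metric.iUnion_ball_nat] at h
    have : μ Set.univ = ⊤ := measure_univ_of_isAddLeftInvariant μ
    rwa [this] at h
  obtain ⟨n, hn, hn0⟩ := ((hlim.eventually (lt_mem_nhds hfin)).and (eventually_gt_atTop 0)).exists
  refine ⟨n, by exact_mod_cast hn0, fun g => ?_⟩
  let e : E →ₗ[ℝ] E := (Matrix.toLin' (mixedMatrix g).transpose).restrictScalars ℝ
  -- The real determinant is the norm, from the mixed space to ℝ, of the determinant over the mixed
  -- space, which is 1.
  have he : LinearMap.det e = 1 := by
    rw [LinearMap.det_restrictScalars, LinearMap.det_toLin', Matrix.det_transpose,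
      det_mixedMatrix, map_one]
  have hvol : μ (e ⁻¹' Metric.ball 0 n) = μ (Metric.ball 0 n) := by
    rw [Measure.addHaar_preimage_linearMap μ (by rw [he]; exact one_ne_zero), he]
    simp
  have hc : Countable (Submodule.span ℤ (Set.range b)).toAddSubgroup := by
    change Countable (Submodule.span ℤ (Set.range b))
    infer_instance
  obtain ⟨⟨x, hx⟩, hx0, hxm⟩ := exists_ne_zero_mem_lattice_of_measure_mul_two_pow_lt_measure
    (ZSpan.isAddFundamentalDomain' b μ) (s := e ⁻¹' Metric.ball 0 n)
    (fun x hx => by simpa using hx) ((convex_ball _ _).linear_preimage e) (by rwa [hvol])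
  have hx' : ∀ i, x i ∈ mixedEmbedding.integerLattice F := by
    intro i
    rw [Submodule.mem_toAddSubgroup] at hx
    rw [← mem_span_latticeBasis]
    refine Submodule.span_induction 
      (p := fun x _ => x i ∈ Submodule.span ℤ (Set.range (latticeBasis F))) ?_ ?_ ?_ ?_ hx
    · rintro _ ⟨⟨j, k⟩, rfl⟩
      rw [Pi.basis_apply]
      by_cases h : i = j
      · subst h
        rw [Pi.single_eq_same]
        exact Submodule.subset_span (Set.mem_range_self k)
      · simp [Pi.single_eq_of_ne h]
    · exact Submodule.zero_mem _
    · intro x y _ _ hx hy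
      exact Submodule.add_mem _ hx hy
    · intro c x _ hx
      exact Submodule.smul_mem _ c hx
  choose v hv using hx'
  have hv' : (fun i => mixedEmbedding F (v i)) = x := funext hv
  refine ⟨v, fun h => hx0 ?_, fun w => ?_⟩
  · have : x = 0 := by
      rw [← hv', h]
      funext i
      simp only [Pi.zero_apply, map_zero]
      rfl
    exact Subtype.ext this
  · refine (norm_vec_le_norm_mixed v g w).trans ?_
    rw [hv']
    exact (mem_ball_zero_iff.1 hxm).le

/-! ### Reduction theory -/

/-- For y ≠ 0, normalize the matrix with rows (ȳ₀, -y₁) and (ȳ₁, y₀) by the Euclidean length of y.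
It is unitary and turns y onto the first axis. -/
lemma exists_rotation {𝕜 : Type*} [RCLike 𝕜] (y : Fin 2 → 𝕜) :
    ∃ k : SL(2, 𝕜), Matrix.vecMul y k.1 1 = 0 ∧ ∀ i j, ‖k i j‖ ≤ 1 := by
  by_cases hy : y = 0
  · refine ⟨1, by simp [hy], fun i j => ?_⟩
    fin_cases i <;> fin_cases j <;> simp
  set r : ℝ := ‖y 0‖ ^ 2 + ‖y 1‖ ^ 2 with hr
  have hr0 : 0 < r := by
    obtain ⟨i, hi⟩ := Function.ne_iff.1 hy
    have := norm_pos_iff.2 hi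
    have h0 := norm_nonneg (y 0)
    have h1 := norm_nonneg (y 1)
    fin_cases i
    · simp only [Fin.zero_eta] at this; positivity
    · simp only [Fin.mk_one] at this; positivity
  have hs : (Real.sqrt r) ≠ 0 := (Real.sqrt_pos.2 hr0).ne'
  have hs2 : ((Real.sqrt r : ℝ) : 𝕜) * (Real.sqrt r : ℝ) = (r : 𝕜) := by
    rw [← RCLike.ofReal_mul, Real.mul_self_sqrt hr0.le]
  have hs' : ((Real.sqrt r : ℝ) : 𝕜) ≠ 0 := by exact_mod_cast hs
  have hr' : (r : 𝕜) ≠ 0 := by exact_mod_cast hr0.ne'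
  have hdet : y 0 * star (y 0) + y 1 * star (y 1) = (r : 𝕜) := by
    simp only [RCLike.star_def, RCLike.mul_conj, hr]
    push_cast
    ring
  refine ⟨⟨(((Real.sqrt r)⁻¹ : ℝ) : 𝕜) • !![star (y 0), -y 1; star (y 1), y 0], ?_⟩, ?_, ?_⟩
  · rw [Matrix.det_smul, Matrix.det_fin_two_of, Fintype.card_fin]
    push_cast
    field_simp
    rw [sq, hs2]
    linear_combination hdet
  · simp [Matrix.vecMul, dotProduct, Fin.sum_univ_two]
    ring
  · have hle : ∀ i, (Real.sqrt r)⁻¹ * ‖y i‖ ≤ 1 := by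
      intro i
      rw [inv_mul_le_iff₀ (Real.sqrt_pos.2 hr0), mul_one]
      apply Real.le_sqrt_of_sq_le
      fin_cases i <;> simp only [hr, Fin.zero_eta, Fin.mk_one] <;> nlinarith [sq_nonneg ‖y 0‖, sq_nonneg ‖y 1‖]
    have h0 := hle 0
    have h1 := hle 1
    intro i j
    fin_cases i <;> fin_cases j <;>
      simpa [abs_of_pos (Real.sqrt_pos.2 hr0), norm_mul, RCLike.norm_ofReal] using by assumption

lemma colNorm_le {M : Matrix (Fin 2) (Fin 2) ℂ} {B : ℝ} (h : ∀ i j, ‖M i j‖ ≤ B) :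
    colNorm M ≤ 2 * B := by
  have := h 0 0; have := h 0 1; have := h 1 0; have := h 1 1
  exact max_le (by linarith) (by linarith)

lemma norm_inv_apply_le {M : SL(2, ℂ)} {B : ℝ} (h : ∀ i j, ‖M i j‖ ≤ B) (i j : Fin 2) :
    ‖M⁻¹ i j‖ ≤ B := by
  rw [Matrix.SpecialLinearGroup.coe_inv, Matrix.adjugate_fin_two]
  fin_cases i <;> fin_cases j <;> simp [h]

lemma colNorm_inv_le {M : SL(2, ℂ)} {B : ℝ} (h : ∀ i j, ‖M i j‖ ≤ B) :
    colNorm (M⁻¹ : SL(2, ℂ)).1 ≤ 2 * B := colNorm_le (norm_inv_apply_le h)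

lemma exists_rotation_vec (v : Fin 2 → 𝓞 F) (g : G F) :
    ∃ k : G F, (∀ w, vec v (g * k) w 1 = 0) ∧ ∀ w i j, ‖comp w k i j‖ ≤ 1 := by
  choose kr hr hr' using fun w : RealPlace F => exists_rotation
    (Matrix.vecMul (fun i => InfinitePlace.embedding_of_isReal w.2 (v i : F)) (g.1 w).1)
  choose kc hc hc' using fun w : ComplexPlace F => exists_rotation (vec v g w.1)
  refine ⟨(kr, kc), fun w => ?_, fun w => ?_⟩
  · refine place_cases (P := fun w => vec v (g * (kr, kc)) w 1 = 0) (fun w => ?_) (fun w => ?_) w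
    · have := congrArg (fun x : ℝ => (x : ℂ)) (hr w)
      rw [vec_mul]
      simpa [vec, Matrix.vecMul, dotProduct, comp_real_apply, emb, Fin.sum_univ_two,
        InfinitePlace.embedding_of_isReal_apply] using this
    · rw [vec_mul, comp_complex]
      exact hc w
  · refine place_cases (P := fun w => ∀ i j, ‖comp w (kr, kc) i j‖ ≤ 1) (fun w i j => ?_)
      (fun w i j => ?_) w
    · rw [comp_real_apply, Complex.norm_real]
      exact hr' w i j
    · rw [comp_complex]
      exact hc' w i j

/-- The element of `G` with all components equal to `diag(s, s⁻¹)`. -/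
def scal (s : ℝ) (hs : s ≠ 0) : G F :=
  (fun _ => ⟨!![s, 0; 0, s⁻¹], by simp [hs]⟩, fun _ => ⟨!![(s : ℂ), 0; 0, (s : ℂ)⁻¹], by simp [hs]⟩)

lemma comp_scal (s : ℝ) (hs : s ≠ 0) (w : InfinitePlace F) :
    (comp w (scal s hs)).1 = !![(s : ℂ), 0; 0, (s : ℂ)⁻¹] := by
  refine place_cases (P := fun w => (comp w (scal s hs)).1 = !![(s : ℂ), 0; 0, (s : ℂ)⁻¹])
    (fun w => ?_) (fun w => ?_) w
  · ext i j
    have := comp_real_apply w (scal s hs) i j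
    rw [this]
    fin_cases i <;> fin_cases j <;> simp [scal]
  · rw [comp_complex]
    rfl

lemma vec_ne_zero {v : Fin 2 → 𝓞 F} (hv : v ≠ 0) (g : G F) (w : InfinitePlace F) :
    vec v g w ≠ 0 := by
  intro h
  have := Nm_pos hv g
  rw [Nm, Finset.prod_eq_zero (Finset.mem_univ w)] at this
  · exact lt_irrefl _ this
  · rw [h, norm_zero, zero_pow w.mult_ne_zero]

lemma prod_pow_mult_le {r : ℝ} (h0 : 0 ≤ r) (h1 : r ≤ 1) :
    ∏ w : InfinitePlace F, r ^ w.mult ≤ r := by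
  classical
  obtain ⟨w⟩ := (inferInstance : Nonempty (InfinitePlace F))
  rw [← Finset.mul_prod_erase _ _ (Finset.mem_univ w)]
  have : r ^ w.mult ≤ r := pow_le_of_le_one h0 h1 w.mult_ne_zero
  refine (mul_le_mul this (Finset.prod_le_one (fun _ _ => by positivity)
    fun _ _ => pow_le_one₀ h0 h1) (Finset.prod_nonneg fun _ _ => by positivity) h0).trans
    (mul_one r).le

/-- If `sys g ≥ c` then `𝓞² g` has two independent vectors of bounded length. -/
theorem exists_two_short_vectors (F : Type*) [Field F] [NumberField F] {c : ℝ} (hc : 0 < c) :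
    ∃ B : ℝ, 0 < B ∧ ∀ g : G F, c ≤ sys g → ∃ v v' : Fin 2 → 𝓞 F,
      v 0 * v' 1 - v 1 * v' 0 ≠ 0 ∧ (∀ w, ‖vec v g w‖ ≤ B) ∧ ∀ w, ‖vec v' g w‖ ≤ B := by
  obtain ⟨R, hR, hshort⟩ := exists_short_vector F
  -- A first Minkowski vector v is rotated onto the first axis and the second axis is contracted by
  -- s before Minkowski is applied again. Were the new vector v' on the line of v, its length at g
  -- would be at most 2R/s at every place. The bound below c contradicts c ≤ `sys g`; the bound
  -- below 1 makes the product over places no larger than 2R/s.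
  obtain ⟨s, hs1, hs2⟩ : ∃ s : ℝ, 1 ≤ s ∧ 2 * R / s < min 1 c := by
    have : Tendsto (fun s : ℝ => 2 * R / s) atTop (𝓝 0) := tendsto_const_nhds.div_atTop tendsto_id
    obtain ⟨s, h1, h2⟩ := ((eventually_ge_atTop 1).and
      (this.eventually (gt_mem_nhds (lt_min one_pos hc)))).exists
    exact ⟨s, h1, h2⟩
  have hs0 : s ≠ 0 := by positivity
  refine ⟨max R (2 * (2 * s) * R), lt_max_of_lt_left hR, fun g hg => ?_⟩
  obtain ⟨v, hv0, hv⟩ := hshort g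
  obtain ⟨k, hk, hk1⟩ := exists_rotation_vec v g
  obtain ⟨v', hv'0, hv'⟩ := hshort (g * k * scal s hs0)
  have hkinv : ∀ w, colNorm (comp w k⁻¹).1 ≤ 2 := fun w => by
    rw [map_inv]
    simpa using colNorm_inv_le (hk1 w)
  have hsinv : ∀ w, colNorm (comp w (scal s hs0 : G F)⁻¹).1 ≤ 2 * s := fun w => by
    rw [map_inv]
    refine colNorm_inv_le fun i j => ?_
    rw [comp_scal]
    have : s⁻¹ ≤ s := (inv_le_one_of_one_le₀ hs1).trans hs1
    fin_cases i <;> fin_cases j <;> simp [abs_of_nonneg (zero_le_one.trans hs1), this] <;> linarith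
  refine ⟨v, v', fun hdet => ?_, fun w => (hv w).trans (le_max_left _ _),
    fun w => le_trans ?_ (le_max_right _ _)⟩
  · have h1 : ∀ w, vec v' (g * k) w 1 = 0 := fun w => by
      have h := emb_det v v' (g * k) w
      rw [hdet, map_zero, hk w, zero_mul, sub_zero] at h
      refine (mul_eq_zero.1 h.symm).resolve_left fun h0 => vec_ne_zero hv0 (g * k) w ?_
      ext i
      fin_cases i
      · exact h0
      · exact hk w
    have h2 : ∀ w, ‖vec v' (g * k) w‖ ≤ R / s := fun w => by
      have h := (norm_le_pi_norm _ 0).trans (hv' w)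
      rw [vec_mul, comp_scal] at h
      simp only [Matrix.vecMul, dotProduct, Fin.sum_univ_two, h1 w] at h
      simp [abs_of_nonneg (zero_le_one.trans hs1)] at h
      rw [pi_norm_le_iff_of_nonneg (by positivity)]
      intro i
      fin_cases i
      · rw [le_div_iff₀ (by positivity)]
        exact h
      · simp only [Fin.mk_one, h1 w, norm_zero]
        positivity
    have h3 : Nm v' g ≤ ∏ w : InfinitePlace F, (2 * R / s) ^ w.mult := by
      refine Finset.prod_le_prod (fun _ _ => by positivity) fun w _ => ?_
      refine pow_le_pow_left₀ (norm_nonneg _) ?_ _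
      have : vec v' g w = vec v' (g * k * k⁻¹) w := by rw [mul_inv_cancel_right]
      rw [this, vec_mul, mul_div_assoc]
      refine (norm_vecMul_le _ _).trans (mul_le_mul (hkinv w) (h2 w) (norm_nonneg _) (by norm_num))
    have h4 := prod_pow_mult_le (F := F) (r := 2 * R / s) (by positivity)
      (hs2.le.trans (min_le_left _ _))
    have := hs2.trans_le (min_le_right _ _)
    have := sys_le hv'0 g
    linarith
  · have : vec v' g w = vec v' (g * k * scal s hs0 * (scal s hs0)⁻¹ * k⁻¹) w := by
      rw [mul_inv_cancel_right, mul_inv_cancel_right]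
    rw [this, vec_mul]
    refine (norm_vecMul_le _ _).trans ?_
    rw [show 2 * (2 * s) * R = 2 * (2 * s * R) by ring]
    refine mul_le_mul (hkinv w) ?_ (norm_nonneg _) (by norm_num)
    rw [vec_mul]
    exact (norm_vecMul_le _ _).trans
      (mul_le_mul (hsinv w) (hv' w) (norm_nonneg _) (by linarith))

open Matrix in
/-- Integral matrices with the same determinant `δ` which agree modulo `δ` lie in the same left
coset modulo `SL₂(𝓞 F)`. -/
lemma exists_eq_mul_of_sub {δ : 𝓞 F} (hδ : δ ≠ 0) {A A₀ : Matrix (Fin 2) (Fin 2) (𝓞 F)}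
    (hA : A.det = δ) (hA₀ : A₀.det = δ) (h : ∀ i j, δ ∣ A i j - A₀ i j) :
    ∃ γ : SL(2, 𝓞 F), δ • γ.1 = A₀.adjugate * A := by
  choose D hD using h
  have hAD : A = A₀ + δ • Matrix.of D := by
    funext i j
    have := hD i j
    simp only [Matrix.add_apply, Matrix.smul_apply, Matrix.of_apply, smul_eq_mul]
    linear_combination this
  have key : δ • (1 + A₀.adjugate * Matrix.of D) = A₀.adjugate * A := by
    rw [hAD, Matrix.mul_add, Matrix.adjugate_mul, hA₀, smul_add, Matrix.mul_smul]
  refine ⟨⟨1 + A₀.adjugate * Matrix.of D, ?_⟩, key⟩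
  have h2 := congrArg Matrix.det key
  rw [Matrix.det_smul, Matrix.det_mul, Matrix.det_adjugate, hA, hA₀, Fintype.card_fin] at h2
  -- For 2 × 2 matrices the determinant of the adjugate is δ again, so both sides equal δ².
  have h3 : δ ^ 2 * (1 + A₀.adjugate * Matrix.of D).det = δ ^ 2 * 1 := by
    rw [h2]; ring
  exact mul_left_cancel₀ (pow_ne_zero 2 hδ) h3

/-- There are finitely many residue classes of matrices modulo δ. Fixing a representative A₀ in each
class that occurs, γ = A₀⁻¹ A is integral and γ g = δ⁻¹ adj(A₀)(A g), where the rows of A g are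
bounded. -/
lemma exists_reduction_of_det {δ : 𝓞 F} (hδ : δ ≠ 0) (B : ℝ) :
    ∃ C : ℝ, ∀ (A : Matrix (Fin 2) (Fin 2) (𝓞 F)) (g : G F), A.det = δ →
      (∀ i w, ‖vec (A i) g w‖ ≤ B) → ∃ γ : SL(2, 𝓞 F), ∀ w i j, ‖comp w (Δ F γ * g) i j‖ ≤ C := by
  classical
  have hfin : Finite (𝓞 F ⧸ Ideal.span {δ}) :=
    Ideal.finiteQuotientOfFreeOfNeBot _ (by simpa using hδ)
  let red : Matrix (Fin 2) (Fin 2) (𝓞 F) → Fin 2 → Fin 2 → 𝓞 F ⧸ Ideal.span {δ} :=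
    fun A i j => Ideal.Quotient.mk _ (A i j)
  have step : ∀ q : Fin 2 → Fin 2 → 𝓞 F ⧸ Ideal.span {δ}, ∃ C : ℝ,
      ∀ (A : Matrix (Fin 2) (Fin 2) (𝓞 F)) (g : G F), red A = q → A.det = δ →
      (∀ i w, ‖vec (A i) g w‖ ≤ B) →
        ∃ γ : SL(2, 𝓞 F), ∀ w i j, ‖comp w (Δ F γ * g) i j‖ ≤ C := by
    intro q
    by_cases hq : ∃ A₀, red A₀ = q ∧ A₀.det = δ
    swap
    · exact ⟨0, fun A g h1 h2 => absurd ⟨A, h1, h2⟩ hq⟩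
    obtain ⟨A₀, hA₀q, hA₀⟩ := hq
    let f : InfinitePlace F → ℝ := fun w =>
      ‖emb w δ‖⁻¹ * ((∑ i, ∑ k, ‖emb w (A₀.adjugate i k)‖) * B)
    obtain ⟨C, hC⟩ := (Set.finite_range f).bddAbove
    refine ⟨C, fun A g hAq hA hB => ?_⟩
    obtain ⟨γ, hγ⟩ := exists_eq_mul_of_sub hδ hA hA₀ fun i j => by
      have := congrFun (congrFun (hAq.trans hA₀q.symm) i) j
      rwa [Ideal.Quotient.eq, Ideal.mem_span_singleton] at this
    refine ⟨γ, fun w i j => le_trans ?_ (hC ⟨w, rfl⟩)⟩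
    have hδw : 0 < ‖emb w δ‖ := norm_pos_iff.2 fun h => hδ <|
      (map_eq_zero_iff (emb w) (w.embedding.injective.comp
        (FaithfulSMul.algebraMap_injective (𝓞 F) F))).1 h
    have hid : emb w δ * comp w (Δ F γ * g) i j
        = ∑ k, emb w (A₀.adjugate i k) * vec (A k) g w j := by
      have hγi : ∀ l, emb w δ * emb w (γ i l) = ∑ k, emb w (A₀.adjugate i k) * emb w (A k l) := by
        intro l
        have := congrArg (emb w) (congrFun (congrFun hγ i) l)
        simpa [Matrix.mul_apply] using this
      rw [map_mul, comp_Δ]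
      simp only [Matrix.SpecialLinearGroup.coe_mul, Matrix.mul_apply, vec, Matrix.vecMul,
        dotProduct, Fin.sum_univ_two, Matrix.SpecialLinearGroup.map_apply_coe,
        RingHom.mapMatrix_apply, Matrix.map_apply] at hγi ⊢
      linear_combination (comp w g 0 j) * hγi 0 + (comp w g 1 j) * hγi 1
    rw [← mul_le_mul_iff_right₀ hδw, ← norm_mul, hid, mul_inv_cancel_left₀ hδw.ne']
    refine (norm_sum_le _ _).trans ?_
    have hB0 : 0 ≤ B := (norm_nonneg _).trans (hB 0 w)
    calc ∑ k, ‖emb w (A₀.adjugate i k) * vec (A k) g w j‖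
        ≤ ∑ k, ‖emb w (A₀.adjugate i k)‖ * B := Finset.sum_le_sum fun k _ => by
          rw [norm_mul]
          exact mul_le_mul_of_nonneg_left ((norm_le_pi_norm _ j).trans (hB k w)) (norm_nonneg _)
      _ = (∑ k, ‖emb w (A₀.adjugate i k)‖) * B := by rw [Finset.sum_mul]
      _ ≤ _ := mul_le_mul_of_nonneg_right (Finset.single_le_sum
          (f := fun i => ∑ k, ‖emb w (A₀.adjugate i k)‖)
          (fun _ _ => Finset.sum_nonneg fun _ _ => norm_nonneg _) (Finset.mem_univ i)) hB0
  choose C hC using step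
  obtain ⟨C', hC'⟩ := (Set.finite_range C).bddAbove
  refine ⟨C', fun A g hA hB => ?_⟩
  obtain ⟨γ, hγ⟩ := hC _ A g rfl hA hB
  exact ⟨γ, fun w i j => (hγ w i j).trans (hC' ⟨_, rfl⟩)⟩

/-- Northcott finiteness. It leaves only finitely many determinants for a pair of short vectors. -/
lemma finite_emb_le (B : ℝ) : {x : 𝓞 F | ∀ w, ‖emb w x‖ ≤ B}.Finite := by
  refine ((Embeddings.finite_of_norm_le F ℂ B).preimage
    (f := fun x : 𝓞 F => (x : F)) (FaithfulSMul.algebraMap_injective (𝓞 F) F).injOn).subset ?_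
  intro x hx
  refine ⟨x.2, fun φ => ?_⟩
  have := hx (InfinitePlace.mk φ)
  rw [emb, RingHom.comp_apply, InfinitePlace.norm_embedding_eq, InfinitePlace.apply] at this
  exact this

/-- The elements of `G` whose entries are bounded by `C`. -/
def boundedSet (F : Type*) [Field F] (C : ℝ) : Set (G F) := {g | ∀ w i j, ‖comp w g i j‖ ≤ C}

/-- Two independent short vectors form an integral matrix A with A g bounded. Its determinant is
bounded at every place, so it takes finitely many values and the bounds for each fixed determinant
can be made uniform. -/
theorem exists_reduction (F : Type*) [Field F] [NumberField F] {c : ℝ} (hc : 0 < c) :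
    ∃ C : ℝ, ∀ g : G F, c ≤ sys g → ∃ γ : SL(2, 𝓞 F), Δ F γ * g ∈ boundedSet F C := by
  obtain ⟨B, hB, h⟩ := exists_two_short_vectors F hc
  have hfin := finite_emb_le (F := F) (2 * (B * B))
  have step : ∀ δ : 𝓞 F, ∃ C : ℝ, δ ≠ 0 → ∀ (A : Matrix (Fin 2) (Fin 2) (𝓞 F)) (g : G F),
      A.det = δ → (∀ i w, ‖vec (A i) g w‖ ≤ B) →
        ∃ γ : SL(2, 𝓞 F), ∀ w i j, ‖comp w (Δ F γ * g) i j‖ ≤ C := by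
    intro δ
    by_cases hδ : δ = 0
    · exact ⟨0, fun h => absurd hδ h⟩
    · obtain ⟨C, hC⟩ := exists_reduction_of_det hδ B
      exact ⟨C, fun _ => hC⟩
  choose C hC using step
  obtain ⟨C', hC'⟩ := (hfin.image C).bddAbove
  refine ⟨C', fun g hg => ?_⟩
  obtain ⟨v, v', hdet, hv, hv'⟩ := h g hg
  obtain ⟨γ, hγ⟩ := hC _ hdet (Matrix.of ![v, v']) g (by simp [Matrix.det_fin_two]) (by
    intro i w
    fin_cases i
    · exact hv w
    · exact hv' w)
  refine ⟨γ, fun w i j => (hγ w i j).trans (hC' ⟨_, fun w => ?_, rfl⟩)⟩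
  rw [emb_det v v' g]
  exact (norm_det_le _ _).trans (by
    have := mul_le_mul (hv w) (hv' w) (norm_nonneg _) hB.le
    linarith)

lemma isCompact_SL_bounded (𝕜 : Type*) [RCLike 𝕜] (C : ℝ) :
    IsCompact {m : SL(2, 𝕜) | ∀ i j, ‖m i j‖ ≤ C} := by
  have hcl : Topology.IsClosedEmbedding (Subtype.val : SL(2, 𝕜) → Matrix (Fin 2) (Fin 2) 𝕜) :=
    IsClosed.isClosedEmbedding_subtypeVal (isClosed_eq (by fun_prop) continuous_const)
  have hc : IsCompact {m : Fin 2 → Fin 2 → 𝕜 | ∀ i j, ‖m i j‖ ≤ C} := by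
    have := isCompact_univ_pi fun _ : Fin 2 => isCompact_univ_pi fun _ : Fin 2 =>
      isCompact_closedBall (0 : 𝕜) C
    convert this using 1
    ext m
    simp [Set.mem_pi]
  exact hcl.isCompact_preimage (K := {m | ∀ i j, ‖m i j‖ ≤ C}) hc

lemma isCompact_boundedSet (C : ℝ) : IsCompact (boundedSet F C) := by
  have := (isCompact_univ_pi fun _ : RealPlace F => isCompact_SL_bounded ℝ C).prod
    (isCompact_univ_pi fun _ : ComplexPlace F => isCompact_SL_bounded ℂ C)
  refine this.of_isClosed_subset ?_ ?_
  · have : boundedSet F C = ⋂ (w : InfinitePlace F) (i : Fin 2) (j : Fin 2),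
      {g : G F | ‖comp w g i j‖ ≤ C} := by
      ext; simp [boundedSet]
    rw [this]
    exact isClosed_iInter fun w => isClosed_iInter fun i => isClosed_iInter fun j =>
      isClosed_le (continuous_comp_apply w i j).norm continuous_const
  · intro g hg
    refine ⟨fun w _ i j => ?_, fun w _ i j => ?_⟩
    · simpa [comp_real_apply] using hg w.1 i j
    · simpa [comp_complex] using hg w.1 i j

/-! ### The systole on the quotient -/

/-- The projection `G → Γ \ G`. -/
def mk (g : G F) : X F := Quotient.mk (QuotientGroup.rightRel (Γ F)) g

lemma mk_surjective : Function.Surjective (mk : G F → X F) := Quotient.mk_surjective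

lemma continuous_mk : Continuous (mk : G F → X F) := continuous_quotient_mk'

lemma act_mk (g h : G F) : act (mk g) h = mk (g * h) := rfl

lemma mk_eq_mk {g h : G F} : mk g = mk h ↔ ∃ γ : SL(2, 𝓞 F), h = Δ F γ * g := by
  refine (Quotient.eq (r := QuotientGroup.rightRel (Γ F))).trans ?_
  rw [QuotientGroup.rightRel_apply, Γ, MonoidHom.mem_range]
  refine exists_congr fun γ => ?_
  rw [eq_mul_inv_iff_mul_eq, eq_comm]

lemma isOpenMap_mk : IsOpenMap (mk : G F → X F) := by
  intro U hU
  change IsOpen (mk ⁻¹' (mk '' U))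
  have : (mk ⁻¹' (mk '' U) : Set (G F)) = ⋃ γ : SL(2, 𝓞 F), (fun g => Δ F γ * g) ⁻¹' U := by
    ext g
    simp only [Set.mem_preimage, Set.mem_image, Set.mem_iUnion]
    constructor
    · rintro ⟨h, hh, e⟩
      obtain ⟨γ, rfl⟩ := mk_eq_mk.1 e.symm
      exact ⟨γ, hh⟩
    · rintro ⟨γ, hγ⟩
      exact ⟨_, hγ, (mk_eq_mk.2 ⟨γ, rfl⟩).symm⟩
  rw [this]
  exact isOpen_iUnion fun γ => hU.preimage (continuous_const.mul continuous_id)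

/-- The systole as a function on `Γ \ G`. -/
def sysX : X F → ℝ := Quotient.lift sys fun g h hgh => by
  obtain ⟨γ, rfl⟩ := mk_eq_mk.1 (Quotient.sound hgh)
  exact (sys_Δ_mul γ g).symm

lemma continuous_sysX : Continuous (sysX : X F → ℝ) := continuous_sys.quotient_lift _

lemma sysX_pos (x : X F) : 0 < sysX x := by
  obtain ⟨g, rfl⟩ := mk_surjective x
  exact sys_pos g

/-- Mahler's criterion. -/
theorem isCompact_le_sysX {c : ℝ} (hc : 0 < c) : IsCompact {x : X F | c ≤ sysX x} := by
  obtain ⟨C, hC⟩ := exists_reduction F hc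
  refine ((isCompact_boundedSet (F := F) C).image continuous_mk).of_isClosed_subset
    (isClosed_le continuous_const continuous_sysX) ?_
  intro x hx
  obtain ⟨g, rfl⟩ := mk_surjective x
  obtain ⟨γ, hγ⟩ := hC g hx
  exact ⟨_, hγ, (mk_eq_mk.2 ⟨γ, rfl⟩).symm⟩

lemma continuous_act (g : G F) : Continuous fun x : X F => act x g :=
  Continuous.quotient_map' (continuous_id.mul continuous_const) _

lemma act_act (x : X F) (g h : G F) : act (act x g) h = act x (g * h) := by
  obtain ⟨k, rfl⟩ := mk_surjective x
  simp only [act_mk, mul_assoc]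

lemma T_iterate (a : G F) (n : ℕ) (x : X F) : (T a)^[n] x = act x (a ^ n) := by
  induction n with
  | zero =>
    obtain ⟨k, rfl⟩ := mk_surjective x
    simp [act_mk]
  | succ n ih => rw [Function.iterate_succ_apply', ih, T, act_act, pow_succ]

end HilbertModular

end

noncomputable section

namespace HilbertModular

/-! ### Integrals of negative powers of norms -/

section Integrals

open scoped ENNReal

variable {𝕜 : Type*} [RCLike 𝕜] [MeasurableSpace 𝕜] [BorelSpace 𝕜]

/-- In polar coordinates the radial exponent is dim - 1 - s > -1. -/
lemma lintegral_ball_norm_rpow_lt_top (μ : Measure 𝕜) [μ.IsAddHaarMeasure] {s : ℝ}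
    (hs : s < Module.finrank ℝ 𝕜) (r : ℝ) :
    ∫⁻ z in Metric.ball (0 : 𝕜) r, ENNReal.ofReal ‖z‖ ^ (-s) ∂μ < ⊤ := by
  have hint : IntegrableOn (fun z : 𝕜 => ‖z‖ ^ (-s)) (Metric.ball 0 r) μ := by
    have hd : 1 ≤ Module.finrank ℝ 𝕜 := Module.finrank_pos
    rw [integrableOn_fun_norm_addHaar μ (f := fun x : ℝ => x ^ (-s))]
    have h : IntegrableOn (fun y : ℝ => y ^ ((Module.finrank ℝ 𝕜 - 1 : ℕ) - s : ℝ))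
        (Set.Ioo 0 r) := by
      rcases le_or_gt r 0 with hr | hr
      · simp [Set.Ioo_eq_empty_of_le hr]
      rw [← intervalIntegrable_iff_integrableOn_Ioo_of_le hr.le]
      refine intervalIntegral.intervalIntegrable_rpow' ?_
      rw [Nat.cast_sub hd]
      push_cast
      linarith
    refine h.congr_fun (fun y hy => ?_) measurableSet_Ioo
    simp only [smul_eq_mul]
    rw [sub_eq_add_neg, Real.rpow_add hy.1, Real.rpow_natCast]
  have := hint.2
  rw [HasFiniteIntegral] at this
  have hne : ∀ᵐ z ∂μ.restrict (Metric.ball (0 : 𝕜) r), z ≠ 0 :=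
    ae_restrict_of_ae (compl_mem_ae_iff.2 (measure_singleton 0))
  refine lt_of_le_of_lt (lintegral_mono_ae (hne.mono fun z hz => ?_)) this
  rw [← ofReal_norm, ENNReal.ofReal_rpow_of_pos (norm_pos_iff.2 hz)]
  exact ENNReal.ofReal_le_ofReal (le_abs_self _)

/-- Uniform bound for the integral of a negative power of the norm of an affine function. -/
lemma exists_lintegral_affine_le (μ : Measure 𝕜) [μ.IsAddHaarMeasure] {s : ℝ} (hs0 : 0 < s)
    (hs : s < Module.finrank ℝ 𝕜) :
    ∃ C : ℝ≥0∞, C ≠ ⊤ ∧ ∀ p q : 𝕜, (p ≠ 0 ∨ q ≠ 0) →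
      ∫⁻ z in Metric.ball (0 : 𝕜) 2, ENNReal.ofReal ‖p + z * q‖ ^ (-s) ∂μ ≤
        C * ENNReal.ofReal (max ‖p‖ ‖q‖) ^ (-s) := by
  set I := ∫⁻ z in Metric.ball (0 : 𝕜) 6, ENNReal.ofReal ‖z‖ ^ (-s) ∂μ with hI
  have hIt : I < ⊤ := lintegral_ball_norm_rpow_lt_top μ hs 6
  have hBt : μ (Metric.ball (0 : 𝕜) 2) < ⊤ := measure_ball_lt_top
  refine ⟨ENNReal.ofReal (4 ^ s) * (μ (Metric.ball (0 : 𝕜) 2) + I),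
    ENNReal.mul_ne_top ENNReal.ofReal_ne_top (ENNReal.add_lt_top.2 ⟨hBt, hIt⟩).ne, fun p q hpq => ?_⟩
  set M := max ‖p‖ ‖q‖ with hM
  have hM0 : 0 < M := by
    rcases hpq with h | h
    · exact lt_max_of_lt_left (norm_pos_iff.2 h)
    · exact lt_max_of_lt_right (norm_pos_iff.2 h)
  have hquarter : ∀ x : ℝ, M / 4 ≤ x → x ^ (-s) ≤ 4 ^ s * M ^ (-s) := by
    intro x hx
    calc x ^ (-s) ≤ (M / 4) ^ (-s) :=
          Real.rpow_le_rpow_of_nonpos (by positivity) hx (by linarith)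
      _ = 4 ^ s * M ^ (-s) := by
          rw [Real.div_rpow hM0.le (by norm_num), Real.rpow_neg (by norm_num : (0:ℝ) ≤ 4)]
          field_simp
  have hquarter' : ∀ x : ℝ, M / 4 ≤ x → ENNReal.ofReal x ^ (-s) ≤
      ENNReal.ofReal (4 ^ s * M ^ (-s)) := by
    intro x hx
    rw [ENNReal.ofReal_rpow_of_pos (by linarith)]
    exact ENNReal.ofReal_le_ofReal (hquarter x hx)
  have hC : ENNReal.ofReal (4 ^ s) * (μ (Metric.ball (0 : 𝕜) 2) + I) * ENNReal.ofReal M ^ (-s) =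
      ENNReal.ofReal (4 ^ s * M ^ (-s)) * μ (Metric.ball (0 : 𝕜) 2) +
        ENNReal.ofReal (4 ^ s * M ^ (-s)) * I := by
    rw [ENNReal.ofReal_mul (by positivity), ENNReal.ofReal_rpow_of_pos hM0]
    ring
  rw [hC]
  -- If q is small compared with p, the affine function stays above M/4 on the ball of radius 2.
  -- Otherwise its zero -p/q has modulus at most 4; translating by p/q moves the ball of radius 2
  -- into the ball of radius 6, and the integral of |z|^(-s) over that ball is finite.
  rcases le_or_gt ‖q‖ (‖p‖ / 4) with h | h
  · have hMp : M = ‖p‖ := max_eq_left (by linarith [norm_nonneg p])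
    refine le_trans ?_ le_self_add
    refine (setLIntegral_mono' (g := fun _ => ENNReal.ofReal (4 ^ s * M ^ (-s)))
      Metric.isOpen_ball.measurableSet
      (fun z hz => ?_)).trans (by rw [setLIntegral_const])
    refine hquarter' _ ?_
    have h1 : ‖z * q‖ ≤ 2 * ‖q‖ := by
      rw [norm_mul]
      exact mul_le_mul_of_nonneg_right (mem_ball_zero_iff.1 hz).le (norm_nonneg _)
    have h2 := norm_sub_le (p + z * q) (z * q)
    rw [add_sub_cancel_right] at h2
    linarith
  · have hq0 : 0 < ‖q‖ := lt_of_le_of_lt (by positivity) h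
    have hq : q ≠ 0 := norm_pos_iff.1 hq0
    have hMq : M / 4 ≤ ‖q‖ := by
      rcases max_choice ‖p‖ ‖q‖ with h' | h' <;> rw [hM, h'] <;> linarith
    refine le_trans ?_ le_add_self
    have hfac : ∀ z, ENNReal.ofReal ‖p + z * q‖ ^ (-s) =
        ENNReal.ofReal ‖q‖ ^ (-s) * ENNReal.ofReal ‖p / q + z‖ ^ (-s) := by
      intro z
      rw [← ENNReal.mul_rpow_of_ne_top ENNReal.ofReal_ne_top ENNReal.ofReal_ne_top,
        ← ENNReal.ofReal_mul (norm_nonneg _), ← norm_mul]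
      congr 3
      field_simp
    simp_rw [hfac]
    rw [lintegral_const_mul' _ _ (by
      rw [ENNReal.ofReal_rpow_of_pos hq0]
      exact ENNReal.ofReal_ne_top)]
    refine mul_le_mul' (hquarter' _ hMq) ?_
    rw [hI, ← lintegral_indicator Metric.isOpen_ball.measurableSet,
      ← lintegral_indicator Metric.isOpen_ball.measurableSet,
      ← lintegral_add_left_eq_self ((Metric.ball (0 : 𝕜) 6).indicator _) (p / q)]
    refine lintegral_mono fun z => ?_
    by_cases hz : z ∈ Metric.ball (0 : 𝕜) 2
    · have hz' : p / q + z ∈ Metric.ball (0 : 𝕜) 6 := by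
        rw [mem_ball_zero_iff] at hz ⊢
        have : ‖p / q‖ ≤ 4 := by
          rw [norm_div, div_le_iff₀ hq0]
          linarith
        exact (norm_add_le _ _).trans_lt (by linarith)
      rw [Set.indicator_of_mem hz, Set.indicator_of_mem hz']
    · rw [Set.indicator_of_notMem hz]
      exact zero_le

lemma lintegral_fin_prod {n : ℕ} {α : Type*} [MeasurableSpace α] (μ : Measure α) [SigmaFinite μ]
    (f : Fin n → α → ℝ≥0∞) (hf : ∀ i, Measurable (f i)) :
    ∫⁻ x, ∏ i, f i (x i) ∂(Measure.pi fun _ => μ) = ∏ i, ∫⁻ y, f i y ∂μ := by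
  induction n with
  | zero => simp
  | succ n ih =>
    have e := (measurePreserving_piFinSuccAbove (fun _ : Fin (n + 1) => μ) 0).symm
    rw [← e.lintegral_comp_emb (MeasurableEquiv.measurableEmbedding _), Fin.prod_univ_succ (n := n),
      ← ih _ fun i => hf i.succ, ← lintegral_prod_mul (hf 0).aemeasurable
        (Finset.measurable_prod _ fun i _ => (hf i.succ).comp (measurable_pi_apply i)).aemeasurable]
    simp [Fin.prod_univ_succ, MeasurableEquiv.piFinSuccAbove]

lemma lintegral_fintype_prod {ι α : Type*} [Fintype ι] [MeasurableSpace α] (μ : Measure α)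
    [SigmaFinite μ] (f : ι → α → ℝ≥0∞) (hf : ∀ i, Measurable (f i)) :
    ∫⁻ x, ∏ i, f i (x i) ∂(Measure.pi fun _ => μ) = ∏ i, ∫⁻ y, f i y ∂μ := by
  let e := (Fintype.equivFin ι).symm
  rw [← (measurePreserving_piCongrLeft (fun _ => μ) e).lintegral_comp_emb
    (MeasurableEquiv.measurableEmbedding _), ← e.prod_comp, ← lintegral_fin_prod μ _ fun i => hf _]
  refine lintegral_congr fun x => ?_
  rw [← e.prod_comp]
  refine Finset.prod_congr rfl fun i _ => congrArg _ ?_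
  exact Equiv.piCongrLeft_apply_apply (fun _ => α) e x i

end Integrals

end HilbertModular

end

/-! ### Coordinates on the unstable group and conjugation by the diagonal element. -/

noncomputable section

namespace HilbertModular

variable {F : Type*} [Field F] [NumberField F]

/-! ### The unstable unipotent subgroup -/

/-- The unipotent matrix with parameter `c`, lower triangular if `p` holds, upper triangular
otherwise. -/
def unip {R : Type*} [CommRing R] (p : Prop) [Decidable p] (c : R) : SL(2, R) :=
  ⟨if p then !![1, 0; c, 1] else !![1, c; 0, 1], by split_ifs <;> simp⟩

lemma unip_zero {R : Type*} [CommRing R] (p : Prop) [Decidable p] : unip p (0 : R) = 1 := by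
  ext i j
  unfold unip
  split_ifs <;> fin_cases i <;> fin_cases j <;> rfl

lemma unip_add {R : Type*} [CommRing R] (p : Prop) [Decidable p] (c d : R) :
    unip p (c + d) = unip p c * unip p d := by
  ext i j
  rw [Matrix.SpecialLinearGroup.coe_mul]
  unfold unip
  split_ifs <;> fin_cases i <;> fin_cases j <;> simp [Matrix.mul_apply, add_comm]

lemma map_unip {R S : Type*} [CommRing R] [CommRing S] (f : R →+* S) (p : Prop) [Decidable p]
    (c : R) : Matrix.SpecialLinearGroup.map f (unip p c) = unip p (f c) := by
  ext i j
  rw [Matrix.SpecialLinearGroup.map_apply_coe]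
  unfold unip
  split_ifs <;> fin_cases i <;> fin_cases j <;> simp

variable (a : G F)

/-- The real places at which `a` is not neutral. -/
abbrev RU : Type _ := {w : RealPlace F // expo a w.1 ≠ 0}

/-- The complex places at which `a` is not neutral. -/
abbrev CU : Type _ := {w : ComplexPlace F // expo a w.1 ≠ 0}

instance : Fintype (RU a) := Fintype.ofFinite _

instance : Fintype (CU a) := Fintype.ofFinite _

/-- The parameter space of the unstable subgroup. -/
abbrev V : Type _ := (RU a → ℝ) × (CU a → ℂ)

variable {a}

open Classical in
/-- The parameter at a real place. -/
def realCoord (z : V a) (w : RealPlace F) : ℝ := if h : expo a w.1 ≠ 0 then z.1 ⟨w, h⟩ else 0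

open Classical in
/-- The parameter at a complex place. -/
def complexCoord (z : V a) (w : ComplexPlace F) : ℂ :=
  if h : expo a w.1 ≠ 0 then z.2 ⟨w, h⟩ else 0

open Classical in
/-- The parameter at an infinite place. -/
def coord (z : V a) (w : InfinitePlace F) : ℂ :=
  if h : w.IsReal then realCoord z ⟨w, h⟩
  else complexCoord z ⟨w, InfinitePlace.not_isReal_iff_isComplex.1 h⟩

lemma coord_real (z : V a) (w : RealPlace F) : coord z w.1 = realCoord z w := by
  simp [coord, w.2]

lemma coord_complex (z : V a) (w : ComplexPlace F) : coord z w.1 = complexCoord z w := by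
  simp [coord, InfinitePlace.not_isReal_iff_isComplex.2 w.2]

lemma coord_RU (z : V a) (w : RU a) : coord z w.1.1 = z.1 w := by
  rw [coord_real, realCoord, dif_pos w.2]

lemma coord_CU (z : V a) (w : CU a) : coord z w.1.1 = z.2 w := by
  rw [coord_complex, complexCoord, dif_pos w.2]

lemma coord_neutral (z : V a) {w : InfinitePlace F} (h : expo a w = 0) : coord z w = 0 := by
  revert h
  refine place_cases (P := fun w => expo a w = 0 → coord z w = 0) (fun w h => ?_)
    (fun w h => ?_) w
  · rw [coord_real, realCoord, dif_neg (not_not.2 h), Complex.ofReal_zero]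
  · rw [coord_complex, complexCoord, dif_neg (not_not.2 h)]

lemma noneutral_cases {P : InfinitePlace F → Prop} (h0 : ∀ w, expo a w = 0 → P w)
    (hr : ∀ w : RU a, P w.1.1) (hc : ∀ w : CU a, P w.1.1) (w : InfinitePlace F) : P w := by
  by_cases h : expo a w = 0
  · exact h0 w h
  · exact place_cases (P := fun w => expo a w ≠ 0 → P w) (fun w hw => hr ⟨w, hw⟩)
      (fun w hw => hc ⟨w, hw⟩) w h

lemma coord_add (z z' : V a) (w : InfinitePlace F) : coord (z + z') w = coord z w + coord z' w := by
  refine noneutral_cases (a := a) (P := fun w => coord (z + z') w = coord z w + coord z' w)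
    (fun w h => ?_) (fun w => ?_) (fun w => ?_) w
  · simp [coord_neutral _ h]
  · simp [coord_RU]
  · simp [coord_CU]

lemma norm_coord_le (z : V a) (w : InfinitePlace F) : ‖coord z w‖ ≤ ‖z‖ := by
  refine noneutral_cases (a := a) (P := fun w => ‖coord z w‖ ≤ ‖z‖)
    (fun w h => ?_) (fun w => ?_) (fun w => ?_) w
  · simp [coord_neutral _ h]
  · rw [coord_RU, Complex.norm_real]
    exact (norm_le_pi_norm z.1 w).trans (norm_fst_le z)
  · rw [coord_CU]
    exact (norm_le_pi_norm z.2 w).trans (norm_snd_le z)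

lemma norm_le_of_coord {z : V a} {r : ℝ} (hr : 0 ≤ r) (h : ∀ w, ‖coord z w‖ ≤ r) : ‖z‖ ≤ r := by
  refine max_le ((pi_norm_le_iff_of_nonneg hr).2 fun w => ?_)
    ((pi_norm_le_iff_of_nonneg hr).2 fun w => ?_)
  · simpa [coord_RU] using h w.1.1
  · simpa [coord_CU] using h w.1.1

lemma continuous_realCoord (w : RealPlace F) : Continuous fun z : V a => realCoord z w := by
  unfold realCoord
  split_ifs <;> fun_prop

lemma continuous_complexCoord (w : ComplexPlace F) :
    Continuous fun z : V a => complexCoord z w := by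
  unfold complexCoord
  split_ifs <;> fun_prop

lemma continuous_unip {𝕜 : Type*} [RCLike 𝕜] (p : Prop) [Decidable p] :
    Continuous (unip p : 𝕜 → SL(2, 𝕜)) := by
  refine Continuous.subtype_mk (continuous_matrix fun i j => ?_) _
  split_ifs <;> fin_cases i <;> fin_cases j <;> simp <;> fun_prop

/-- The parametrization of the unstable subgroup. -/
def uni (z : V a) : G F :=
  -- Conjugation g ↦ a⁻¹ g a multiplies the lower left entry by t² and the upper right one by t⁻².
  -- The expanded entry is therefore the lower left one exactly when |t| > 1.
  (fun w => unip (0 < expo a w.1) (realCoord z w), fun w => unip (0 < expo a w.1) (complexCoord z w))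

lemma continuous_uni : Continuous (uni : V a → G F) :=
  (continuous_pi fun w => (continuous_unip _).comp (continuous_realCoord w)).prodMk
    (continuous_pi fun w => (continuous_unip _).comp (continuous_complexCoord w))

lemma comp_uni (z : V a) (w : InfinitePlace F) :
    comp w (uni z) = unip (0 < expo a w) (coord z w) := by
  refine place_cases (P := fun w => comp w (uni z) = unip (0 < expo a w) (coord z w))
    (fun w => ?_) (fun w => ?_) w
  · rw [comp_real, coord_real]
    exact map_unip Complex.ofRealHom _ _
  · rw [comp_complex, coord_complex]
    rfl

lemma uni_add (z z' : V a) : uni (z + z') = uni z * uni z' :=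
  ext_comp fun w => by rw [map_mul, comp_uni, comp_uni, comp_uni, coord_add, unip_add]

lemma uni_zero : uni (0 : V a) = 1 := by
  have := uni_add (0 : V a) 0
  rwa [add_zero, left_eq_mul] at this

lemma uni_neg (z : V a) : uni (-z) = (uni z)⁻¹ := by
  rw [eq_inv_iff_mul_eq_one, ← uni_add, neg_add_cancel, uni_zero]

/-! ### The diagonal element -/

variable (a) in
/-- The upper left entry of `a`. -/
def tt (w : InfinitePlace F) : ℂ := comp w a 0 0

lemma offdiag_zero (ha : IsDiagonal a) (w : InfinitePlace F) :
    comp w a 0 1 = 0 ∧ comp w a 1 0 = 0 := by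
  refine place_cases (P := fun w => comp w a 0 1 = 0 ∧ comp w a 1 0 = 0)
    (fun w => ?_) (fun w => ?_) w
  · rw [comp_real_apply, comp_real_apply, ha.1 w (by decide : (0 : Fin 2) ≠ 1),
      ha.1 w (by decide : (1 : Fin 2) ≠ 0)]
    simp
  · rw [comp_complex, ha.2 w (by decide : (0 : Fin 2) ≠ 1), ha.2 w (by decide : (1 : Fin 2) ≠ 0)]
    simp

lemma tt_mul (ha : IsDiagonal a) (w : InfinitePlace F) : tt a w * comp w a 1 1 = 1 := by
  have := (comp w a).2
  rw [Matrix.det_fin_two, (offdiag_zero ha w).1, zero_mul, sub_zero] at this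
  exact this

lemma tt_ne_zero (ha : IsDiagonal a) (w : InfinitePlace F) : tt a w ≠ 0 :=
  left_ne_zero_of_mul_eq_one (tt_mul ha w)

lemma norm_tt (ha : IsDiagonal a) (w : InfinitePlace F) : ‖tt a w‖ = Real.exp (expo a w / 2) := by
  have h : expo a w = 2 * Real.log ‖tt a w‖ := by
    refine place_cases (P := fun w => expo a w = 2 * Real.log ‖tt a w‖)
      (fun w => ?_) (fun w => ?_) w
    · rw [tt, comp_real_apply, Complex.norm_real, expo, dif_pos w.2]
    · rw [tt, comp_complex, expo, dif_neg (InfinitePlace.not_isReal_iff_isComplex.2 w.2)]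
  rw [h, mul_div_cancel_left₀ _ two_ne_zero, Real.exp_log (norm_pos_iff.2 (tt_ne_zero ha w))]

/-- Diagonal matrices in `SL₂`. -/
def diagHom (K : Type*) [Field K] : Kˣ →* SL(2, K) where
  toFun t := ⟨!![(t : K), 0; 0, (t : K)⁻¹], by simp⟩
  map_one' := by ext i j; fin_cases i <;> fin_cases j <;> simp
  map_mul' s t := Subtype.ext <| by
    change !![((s * t : Kˣ) : K), 0; 0, ((s * t : Kˣ) : K)⁻¹] =
      !![(s : K), 0; 0, (s : K)⁻¹] * !![(t : K), 0; 0, (t : K)⁻¹]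
    ext i j
    fin_cases i <;> fin_cases j <;> simp [Matrix.mul_apply, mul_comm]

lemma comp_eq_diagHom (ha : IsDiagonal a) (w : InfinitePlace F) :
    comp w a = diagHom ℂ (Units.mk0 (tt a w) (tt_ne_zero ha w)) := by
  ext i j
  have h := offdiag_zero ha w
  have h1 : comp w a 1 1 = (tt a w)⁻¹ := (inv_eq_of_mul_eq_one_right (tt_mul ha w)).symm
  fin_cases i <;> fin_cases j
  · rfl
  · exact h.1
  · exact h.2
  · exact h1

lemma comp_zpow (ha : IsDiagonal a) (n : ℤ) (w : InfinitePlace F) :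
    (comp w (a ^ n)).1 = !![tt a w ^ n, 0; 0, (tt a w ^ n)⁻¹] := by
  rw [map_zpow, comp_eq_diagHom ha, ← map_zpow]
  change !![((Units.mk0 _ _ ^ n : ℂˣ) : ℂ), 0; 0, ((Units.mk0 _ _ ^ n : ℂˣ) : ℂ)⁻¹] = _
  rw [Units.val_zpow_eq_zpow_val, Units.val_mk0]

variable (a) in
/-- The factor by which conjugation by `a` expands the parameter at `w`. -/
def lam (w : InfinitePlace F) : ℂ := if 0 < expo a w then tt a w ^ 2 else (tt a w ^ 2)⁻¹

lemma norm_lam (ha : IsDiagonal a) (w : InfinitePlace F) : ‖lam a w‖ = Real.exp |expo a w| := by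
  have h : ‖tt a w ^ 2‖ = Real.exp (expo a w) := by
    rw [norm_pow, norm_tt ha, ← Real.exp_nat_mul]
    congr 1
    push_cast
    ring
  unfold lam
  split_ifs with h0
  · rw [h, abs_of_pos h0]
  · rw [norm_inv, h, abs_of_nonpos (not_lt.1 h0), Real.exp_neg]

lemma lam_ne_zero (ha : IsDiagonal a) (w : InfinitePlace F) : lam a w ≠ 0 :=
  norm_pos_iff.1 (by rw [norm_lam ha]; exact Real.exp_pos _)

/-- The action of conjugation by powers of `a` on the parameter space. -/
def expand (n : ℤ) (z : V a) : V a :=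
  (fun w => ((lam a w.1.1) ^ n).re * z.1 w, fun w => (lam a w.1.1) ^ n * z.2 w)

lemma continuous_expand (n : ℤ) : Continuous (expand n : V a → V a) := by
  unfold expand
  fun_prop

/-- This ensures that the real part taken in `expand` at a real place loses nothing. -/
lemma lam_real (w : RealPlace F) : ∃ r : ℝ, lam a w.1 = r := by
  have h : tt a w.1 = ((a.1 w 0 0 : ℝ) : ℂ) := comp_real_apply w a 0 0
  unfold lam
  rw [h]
  split_ifs
  · exact ⟨(a.1 w 0 0) ^ 2, by push_cast; rfl⟩
  · exact ⟨((a.1 w 0 0) ^ 2)⁻¹, by push_cast; rfl⟩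

lemma coord_expand (n : ℤ) (z : V a) (w : InfinitePlace F) :
    coord (expand n z) w = lam a w ^ n * coord z w := by
  refine noneutral_cases (a := a) (P := fun w => coord (expand n z) w = lam a w ^ n * coord z w)
    (fun w h => ?_) (fun w => ?_) (fun w => ?_) w
  · simp [coord_neutral _ h]
  · rw [coord_RU, coord_RU]
    obtain ⟨r, hr⟩ := lam_real (a := a) w.1
    simp only [expand, hr]
    rw [← Complex.ofReal_zpow, Complex.ofReal_re]
    push_cast
    rfl
  · rw [coord_CU, coord_CU]
    rfl

lemma ext_coord {z z' : V a} (h : ∀ w, coord z w = coord z' w) : z = z' := by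
  refine Prod.ext (funext fun w => ?_) (funext fun w => ?_)
  · simpa [coord_RU] using h w.1.1
  · simpa [coord_CU] using h w.1.1

lemma expand_neg_expand (ha : IsDiagonal a) (n : ℤ) (z : V a) : expand n (expand (-n) z) = z :=
  ext_coord fun w => by
    rw [coord_expand, coord_expand, ← mul_assoc, ← zpow_add₀ (lam_ne_zero ha w)]
    simp

lemma uni_mul_zpow (ha : IsDiagonal a) (n : ℤ) (z : V a) :
    uni z * a ^ n = a ^ n * uni (expand n z) := by
  refine ext_comp fun w => ?_
  ext i j
  simp only [map_mul, Matrix.SpecialLinearGroup.coe_mul, comp_zpow ha, comp_uni, coord_expand]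
  have h0 := zpow_ne_zero n (tt_ne_zero ha w)
  have h2 : (tt a w ^ 2) ^ n = (tt a w ^ n) ^ 2 := by
    rw [← zpow_natCast, ← zpow_natCast, ← zpow_mul, ← zpow_mul, mul_comm]
  unfold unip lam
  split_ifs <;> fin_cases i <;> fin_cases j <;>
    simp [Matrix.mul_apply, Fin.sum_univ_two, h2] <;> field_simp

lemma norm_expand_neg_le (ha : IsDiagonal a) (n : ℕ) (z : V a) : ‖expand (-(n : ℤ)) z‖ ≤ ‖z‖ := by
  refine norm_le_of_coord (norm_nonneg z) fun w => ?_
  rw [coord_expand, norm_mul, zpow_neg, norm_inv, zpow_natCast, norm_pow, norm_lam ha]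
  refine (mul_le_of_le_one_left (norm_nonneg _) ?_).trans (norm_coord_le z w)
  exact inv_le_one_of_one_le₀ (one_le_pow₀ (Real.one_le_exp (abs_nonneg _)))

lemma norm_expand_le (ha : IsDiagonal a) (n : ℕ) (z : V a) :
    ‖expand (n : ℤ) z‖ ≤ Real.exp (n * aStar a) * ‖z‖ := by
  refine norm_le_of_coord (by positivity) fun w => ?_
  rw [coord_expand, norm_mul, zpow_natCast, norm_pow, norm_lam ha, ← Real.exp_nat_mul]
  have : |expo a w| ≤ aStar a :=
    Finset.le_sup' (fun w => |expo a w|) (Finset.mem_univ w)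
  gcongr
  exact norm_coord_le z w

/-! ### Products over places -/

lemma prod_places {M : Type*} [CommMonoid M] [Fintype (RealPlace F)] [Fintype (ComplexPlace F)]
    (f : InfinitePlace F → M) :
    ∏ w, f w = (∏ w : RealPlace F, f w.1) * ∏ w : ComplexPlace F, f w.1 := by
  refine Eq.trans ?_ (Fintype.prod_sum_type (fun w : RealPlace F ⊕ ComplexPlace F =>
    f (Sum.elim Subtype.val Subtype.val w)))
  refine (Fintype.prod_bijective (Sum.elim Subtype.val Subtype.val) ⟨?_, ?_⟩ _ f
    fun _ => rfl).symm
  · rintro (w | w) (w' | w') (h : w.1 = w'.1)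
    · exact congrArg _ (Subtype.ext h)
    · exact absurd (h ▸ w.2 : w'.1.IsReal) (InfinitePlace.not_isReal_iff_isComplex.2 w'.2)
    · exact absurd (h ▸ w'.2 : w.1.IsReal) (InfinitePlace.not_isReal_iff_isComplex.2 w.2)
    · exact congrArg _ (Subtype.ext h)
  · exact place_cases (P := fun w => ∃ x : RealPlace F ⊕ ComplexPlace F,
      Sum.elim Subtype.val Subtype.val x = w) (fun w => ⟨Sum.inl w, rfl⟩) fun w => ⟨Sum.inr w, rfl⟩

lemma prod_split {M : Type*} [CommMonoid M] (a : G F) (f : InfinitePlace F → M) :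
    ∏ w, f w = (∏ w : RU a, f w.1.1) * (∏ w : CU a, f w.1.1) *
      ∏ w : {w : InfinitePlace F // expo a w = 0}, f w.1 := by
  rw [← Fintype.prod_subtype_mul_prod_subtype (fun w => expo a w = 0) f, mul_comm]
  congr 1
  refine Eq.trans ?_ (Fintype.prod_sum_type (fun w : RU a ⊕ CU a =>
    f (Sum.elim (fun w => w.1.1) (fun w => w.1.1) w)))
  refine (Fintype.prod_bijective (fun w : RU a ⊕ CU a =>
    (⟨Sum.elim (fun w => w.1.1) (fun w => w.1.1) w, by rcases w with w | w <;> exact w.2⟩ :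
      {w : InfinitePlace F // ¬ expo a w = 0})) ⟨?_, ?_⟩ _ (fun w => f w.1)
      fun _ => rfl).symm
  · rintro (w | w) (w' | w') h <;> replace h := congrArg Subtype.val h <;>
      simp only [Sum.elim_inl, Sum.elim_inr] at h
    · exact congrArg _ (Subtype.ext (Subtype.ext h))
    · exact absurd (h ▸ w.1.2 : w'.1.1.IsReal) (InfinitePlace.not_isReal_iff_isComplex.2 w'.1.2)
    · exact absurd (h ▸ w'.1.2 : w.1.1.IsReal) (InfinitePlace.not_isReal_iff_isComplex.2 w.1.2)
    · exact congrArg _ (Subtype.ext (Subtype.ext h))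
  · rintro ⟨w, hw⟩
    by_cases h : w.IsReal
    · exact ⟨Sum.inl ⟨⟨w, h⟩, hw⟩, rfl⟩
    · exact ⟨Sum.inr ⟨⟨w, InfinitePlace.not_isReal_iff_isComplex.1 h⟩, hw⟩, rfl⟩

lemma sum_mult_expo (a : G F) : ∑ w : InfinitePlace F, w.mult * |expo a w| = hMax a := by
  classical
  -- The multiplicative splitting over places is read additively through `Multiplicative ℝ`.
  have := prod_places (M := Multiplicative ℝ)
    (fun w : InfinitePlace F => Multiplicative.ofAdd ((w.mult : ℝ) * |expo a w|))
  rw [← ofAdd_sum, ← ofAdd_sum, ← ofAdd_sum, ← ofAdd_add] at this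
  rw [Multiplicative.ofAdd.injective this, hMax, Finset.mul_sum]
  congr 1
  · refine Finset.sum_congr (by congr) fun w _ => ?_
    simp [InfinitePlace.mult_isReal]
  · refine Finset.sum_congr (by congr) fun w _ => ?_
    simp [InfinitePlace.mult_isComplex]

lemma prod_exp_mult (a : G F) (c : ℝ) :
    ∏ w : InfinitePlace F, Real.exp (c * |expo a w|) ^ w.mult = Real.exp (c * hMax a) := by
  simp_rw [← Real.exp_nat_mul]
  rw [← Real.exp_sum, ← sum_mult_expo, Finset.mul_sum]
  congr 1
  exact Finset.sum_congr rfl fun w _ => by ring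

end HilbertModular

end

/-! ### Growth of integral vectors under the flow, pointwise and on average. -/

noncomputable section

namespace HilbertModular

open scoped ENNReal

variable {F : Type*} [Field F] [NumberField F] {a : G F}

/-! ### Distortion estimates -/

lemma norm_tt_zpow (ha : IsDiagonal a) (n : ℤ) (w : InfinitePlace F) :
    ‖tt a w ^ n‖ = Real.exp (n * (expo a w / 2)) := by
  rw [norm_zpow, norm_tt ha, ← Real.rpow_intCast, ← Real.exp_mul, mul_comm]

/-- The entries of a^n at w have modulus exp(± n a_w / 2), and the local multiplicities turn the sum
of the |a_w| into `hMax`. -/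
lemma distort_zpow_le (ha : IsDiagonal a) (n : ℤ) :
    distort (a ^ n) ≤ Real.exp (|(n : ℝ)| * hMax a / 2) := by
  rw [mul_div_right_comm, ← prod_exp_mult]
  refine Finset.prod_le_prod (fun _ _ => pow_nonneg (colNorm_nonneg _) _) fun w _ =>
    pow_le_pow_left₀ (colNorm_nonneg _) ?_ _
  rw [comp_zpow ha]
  have h : |(n : ℝ) * (expo a w / 2)| = |(n : ℝ)| / 2 * |expo a w| := by
    rw [abs_mul, abs_div, abs_two]
    ring
  refine max_le ?_ ?_
  · simp only [Matrix.of_apply, Matrix.cons_val', Matrix.cons_val_zero, Matrix.cons_val_one,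
      Matrix.cons_val_fin_one, norm_zero, add_zero]
    rw [norm_tt_zpow ha, ← h]
    exact Real.exp_le_exp.2 (le_abs_self _)
  · simp only [Matrix.of_apply, Matrix.cons_val', Matrix.cons_val_zero, Matrix.cons_val_one,
      Matrix.cons_val_fin_one, norm_zero, zero_add]
    rw [norm_inv, norm_tt_zpow ha, ← Real.exp_neg, ← h]
    exact Real.exp_le_exp.2 (neg_le_abs _)

/-- A bound for the distortion of elements all of whose components have `colNorm` at most `3`. -/
def distortBound (F : Type*) [Field F] [NumberField F] : ℝ := ∏ w : InfinitePlace F, 3 ^ w.mult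

lemma one_le_distortBound : 1 ≤ distortBound F := by
  have := Finset.prod_le_prod (s := Finset.univ) (f := fun _ : InfinitePlace F => (1 : ℝ))
    (g := fun w => 3 ^ w.mult) (fun _ _ => zero_le_one) fun _ _ => one_le_pow₀ (by norm_num)
  simpa [distortBound] using this

lemma distort_le_of_colNorm {h : G F} (H : ∀ w, colNorm (comp w h).1 ≤ 3) :
    distort h ≤ distortBound F :=
  Finset.prod_le_prod (fun _ _ => pow_nonneg (colNorm_nonneg _) _) fun w _ =>
    pow_le_pow_left₀ (colNorm_nonneg _) (H w) _

lemma colNorm_unip_le (p : Prop) [Decidable p] (c : ℂ) : colNorm (unip p c).1 ≤ 1 + ‖c‖ := by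
  unfold unip colNorm
  split_ifs <;> simp [add_comm]

lemma distort_uni_le {z : V a} (hz : ‖z‖ ≤ 2) : distort (uni z) ≤ distortBound F := by
  refine distort_le_of_colNorm fun w => ?_
  rw [comp_uni]
  have := colNorm_unip_le (0 < expo a w) (coord z w)
  have := norm_coord_le z w
  linarith

/-! ### Expansion of vectors along the unstable direction -/

variable (a) in
/-- The coordinate of a row vector which is expanded by `a`. -/
def hi (w : InfinitePlace F) (x : Fin 2 → ℂ) : ℂ := if 0 < expo a w then x 0 else x 1

variable (a) in
/-- The coordinate of a row vector which is contracted by `a`. -/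
def lo (w : InfinitePlace F) (x : Fin 2 → ℂ) : ℂ := if 0 < expo a w then x 1 else x 0

lemma norm_eq_max_fin_two (x : Fin 2 → ℂ) : ‖x‖ = max ‖x 0‖ ‖x 1‖ := by
  refine le_antisymm ((pi_norm_le_iff_of_nonneg (by positivity)).2 fun i => ?_)
    (max_le (norm_le_pi_norm _ _) (norm_le_pi_norm _ _))
  fin_cases i
  · exact le_max_left _ _
  · exact le_max_right _ _

lemma max_hi_lo (w : InfinitePlace F) (x : Fin 2 → ℂ) : max ‖hi a w x‖ ‖lo a w x‖ = ‖x‖ := by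
  rw [norm_eq_max_fin_two]
  unfold hi lo
  split_ifs
  · rfl
  · exact max_comm _ _

lemma vec_uni_zpow (ha : IsDiagonal a) (v : Fin 2 → 𝓞 F) (g : G F) (z : V a) (n : ℤ)
    (w : InfinitePlace F) : vec v (g * uni z * a ^ n) w =
      Matrix.vecMul (Matrix.vecMul (vec v g w) (unip (0 < expo a w) (coord z w)).1)
        !![tt a w ^ n, 0; 0, (tt a w ^ n)⁻¹] := by
  rw [vec_mul, vec_mul, comp_uni, comp_zpow ha]

/-- The unipotent adds a multiple of the contracted coordinate to the expanded one, and a^m then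
stretches the result. Only this coordinate is kept in the lower bound. -/
lemma norm_vec_uni_pow_ge (ha : IsDiagonal a) (v : Fin 2 → 𝓞 F) (g : G F) (z : V a) (m : ℕ)
    (w : InfinitePlace F) :
    Real.exp (m / 2 * |expo a w|) * ‖hi a w (vec v g w) + coord z w * lo a w (vec v g w)‖ ≤
      ‖vec v (g * uni z * a ^ m) w‖ := by
  rw [← zpow_natCast a m, vec_uni_zpow ha]
  have hexp := norm_tt_zpow ha (m : ℤ) w
  simp only [Int.cast_natCast] at hexp
  by_cases h : 0 < expo a w
  · refine le_trans (le_of_eq ?_) (norm_le_pi_norm _ 0)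
    simp only [hi, lo, unip, h, if_true, Matrix.vecMul, dotProduct, Fin.sum_univ_two, Matrix.of_apply,
      Matrix.cons_val', Matrix.cons_val_zero, Matrix.cons_val_one, Matrix.cons_val_fin_one,
      mul_zero, add_zero, mul_one, norm_mul, hexp]
    rw [abs_of_pos h, mul_comm, mul_comm (coord z w)]
    congr 2
    ring
  · refine le_trans (le_of_eq ?_) (norm_le_pi_norm _ 1)
    simp only [hi, lo, unip, h, if_false, Matrix.vecMul, dotProduct, Fin.sum_univ_two, Matrix.of_apply,
      Matrix.cons_val', Matrix.cons_val_zero, Matrix.cons_val_one, Matrix.cons_val_fin_one,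
      mul_zero, zero_add, mul_one, norm_mul, norm_inv, hexp]
    rw [abs_of_nonpos (not_lt.1 h), mul_comm, mul_comm (coord z w), ← Real.exp_neg, add_comm]
    congr 2
    ring

/-- Neutral places carry no unstable parameter and no expansion. They contribute equally to both
sides of the averaged inequality. -/
lemma norm_vec_uni_pow_neutral (ha : IsDiagonal a) (v : Fin 2 → 𝓞 F) (g : G F) (z : V a) (m : ℕ)
    {w : InfinitePlace F} (hw : expo a w = 0) :
    ‖vec v (g * uni z * a ^ m) w‖ = ‖vec v g w‖ := by
  rw [← zpow_natCast a m, vec_uni_zpow ha, coord_neutral z hw, unip_zero,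
    Matrix.SpecialLinearGroup.coe_one, Matrix.vecMul_one]
  have hexp := norm_tt_zpow ha (m : ℤ) w
  rw [hw, zero_div, mul_zero, Real.exp_zero] at hexp
  rw [norm_eq_max_fin_two, norm_eq_max_fin_two]
  simp only [Matrix.vecMul, dotProduct,
    Fin.sum_univ_two, Matrix.of_apply, Matrix.cons_val', Matrix.cons_val_zero, Matrix.cons_val_one,
    Matrix.cons_val_fin_one, mul_zero, zero_add, add_zero, norm_mul, norm_inv, hexp, mul_one,
    inv_one]

lemma vec_real (v : Fin 2 → 𝓞 F) (g : G F) (w : RealPlace F) :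
    ∃ r : Fin 2 → ℝ, ∀ i, vec v g w.1 i = r i := by
  refine ⟨Matrix.vecMul (fun i => InfinitePlace.embedding_of_isReal w.2 (v i : F)) (g.1 w).1,
    fun i => ?_⟩
  simp [vec, Matrix.vecMul, dotProduct, comp_real_apply, emb, Fin.sum_univ_two,
    InfinitePlace.embedding_of_isReal_apply]

lemma hi_ne_zero_or {x : Fin 2 → ℂ} (hx : x ≠ 0) (w : InfinitePlace F) :
    hi a w x ≠ 0 ∨ lo a w x ≠ 0 := by
  by_contra! h
  have := max_hi_lo (a := a) w x
  rw [h.1, h.2, norm_zero, max_self, eq_comm, norm_eq_zero] at this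
  exact hx this

lemma rpow_anti {x y : ℝ≥0∞} {s : ℝ} (hs : s ≤ 0) (h : x ≤ y) : y ^ s ≤ x ^ s := by
  have := ENNReal.inv_le_inv.2 (ENNReal.rpow_le_rpow h (neg_nonneg.2 hs))
  simpa only [← ENNReal.rpow_neg, neg_neg] using this

lemma ofReal_Nm_rpow (v : Fin 2 → 𝓞 F) (g : G F) (β : ℝ) :
    ENNReal.ofReal (Nm v g) ^ (-β) =
      ∏ w, ENNReal.ofReal ‖vec v g w‖ ^ (-(β * w.mult)) := by
  rw [Nm, ENNReal.ofReal_prod_of_nonneg fun _ _ => by positivity,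
    ← ENNReal.prod_rpow_of_ne_top fun _ _ => ENNReal.ofReal_ne_top]
  refine Finset.prod_congr rfl fun w _ => ?_
  rw [ENNReal.ofReal_pow (norm_nonneg _), ← ENNReal.rpow_natCast, ← ENNReal.rpow_mul]
  congr 1
  ring

lemma ofReal_exp_hMax_rpow (a : G F) (m : ℕ) (β : ℝ) :
    ENNReal.ofReal (Real.exp (m / 2 * hMax a)) ^ (-β) =
      ∏ w : InfinitePlace F,
        ENNReal.ofReal (Real.exp (m / 2 * |expo a w|)) ^ (-(β * w.mult)) := by
  rw [← prod_exp_mult, ENNReal.ofReal_prod_of_nonneg fun _ _ => by positivity,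
    ← ENNReal.prod_rpow_of_ne_top fun _ _ => ENNReal.ofReal_ne_top]
  refine Finset.prod_congr rfl fun w _ => ?_
  rw [ENNReal.ofReal_pow (Real.exp_pos _).le, ← ENNReal.rpow_natCast, ← ENNReal.rpow_mul]
  congr 1
  ring

lemma restrict_ball_V (r : ℝ) (hr : 0 < r) :
    (volume : Measure (V a)).restrict (Metric.ball 0 r) =
      (Measure.pi fun _ : RU a => (volume : Measure ℝ).restrict (Metric.ball 0 r)).prod
        (Measure.pi fun _ : CU a => (volume : Measure ℂ).restrict (Metric.ball 0 r)) := by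
  rw [← Measure.restrict_pi_pi, ← Measure.restrict_pi_pi, Measure.prod_restrict]
  have h : (Metric.ball (0 : V a) r) =
      (Set.univ.pi fun _ : RU a => Metric.ball (0 : ℝ) r) ×ˢ
        (Set.univ.pi fun _ : CU a => Metric.ball (0 : ℂ) r) := by
    rw [← ball_pi _ hr, ← ball_pi _ hr]
    exact (ball_prod_same _ _ _).symm
  rw [h]
  rfl

/-- The average of `Nm ^ (-β)` over a ball in the unstable direction decays under the flow. -/
theorem exists_lintegral_Nm_le (ha : IsDiagonal a) {β : ℝ} (hβ0 : 0 < β) (hβ1 : β < 1) :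
    ∃ C : ℝ≥0∞, C ≠ ⊤ ∧ ∀ (v : Fin 2 → 𝓞 F), v ≠ 0 → ∀ (g : G F) (m : ℕ),
      ∫⁻ z in Metric.ball (0 : V a) 2, ENNReal.ofReal (Nm v (g * uni z * a ^ m)) ^ (-β) ≤
        C * (ENNReal.ofReal (Real.exp (m / 2 * hMax a)) ^ (-β) *
          ENNReal.ofReal (Nm v g) ^ (-β)) := by
  -- The condition β < 1 is exactly integrability at both kinds of place: exponent β < 1 on ℝ and,
  -- because of the multiplicity 2, exponent 2β < 2 on ℂ.
  obtain ⟨Cr, hCr, hr⟩ := exists_lintegral_affine_le (𝕜 := ℝ) volume (s := β) hβ0 (by simpa)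
  obtain ⟨Cc, hCc, hc⟩ := exists_lintegral_affine_le (𝕜 := ℂ) volume (s := β * 2) (by linarith)
    (by rw [Complex.finrank_real_complex]; push_cast; linarith)
  refine ⟨Cr ^ Fintype.card (RU a) * Cc ^ Fintype.card (CU a),
    ENNReal.mul_ne_top (ENNReal.pow_ne_top hCr) (ENNReal.pow_ne_top hCc), fun v hv g m => ?_⟩
  set A : InfinitePlace F → ℝ≥0∞ := fun w =>
    ENNReal.ofReal (Real.exp (m / 2 * |expo a w|)) ^ (-(β * w.mult)) with hA
  set N : InfinitePlace F → ℝ≥0∞ := fun w => ENNReal.ofReal ‖vec v g w‖ ^ (-(β * w.mult)) with hN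
  set φ : InfinitePlace F → ℂ → ℝ≥0∞ := fun w c =>
    ENNReal.ofReal ‖hi a w (vec v g w) + c * lo a w (vec v g w)‖ ^ (-(β * w.mult)) with hφ
  have hφm : ∀ w, Measurable (φ w) := fun w => by
    simp only [hφ]
    fun_prop
  -- The bound factors as a constant times a product of functions of single parameters, so Fubini
  -- reduces the integral to the affine estimate at each place.
  have hpt : ∀ z : V a, ENNReal.ofReal (Nm v (g * uni z * a ^ m)) ^ (-β) ≤
      ((∏ w, A w) * ∏ w : {w : InfinitePlace F // expo a w = 0}, N w.1) *
        ((∏ w : RU a, φ w.1.1 (z.1 w)) * ∏ w : CU a, φ w.1.1 (z.2 w)) := by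
    intro z
    have h1 : ENNReal.ofReal (Nm v (g * uni z * a ^ m)) ^ (-β) ≤
        ∏ w, (A w * if expo a w = 0 then N w else φ w (coord z w)) := by
      rw [ofReal_Nm_rpow]
      refine Finset.prod_le_prod' fun w _ => ?_
      have hneg : -(β * (w.mult : ℝ)) ≤ 0 := neg_nonpos.2 (by positivity)
      split_ifs with h
      · rw [norm_vec_uni_pow_neutral ha v g z m h]
        simp [hA, hN, h]
      · rw [← ENNReal.mul_rpow_of_ne_top ENNReal.ofReal_ne_top ENNReal.ofReal_ne_top,
          ← ENNReal.ofReal_mul (Real.exp_pos _).le]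
        exact rpow_anti hneg (ENNReal.ofReal_le_ofReal (norm_vec_uni_pow_ge ha v g z m w))
    refine h1.trans (le_of_eq ?_)
    rw [Finset.prod_mul_distrib, prod_split a (fun w => if expo a w = 0 then N w else _),
      Finset.prod_congr rfl fun (w : RU a) _ => if_neg w.2,
      Finset.prod_congr rfl fun (w : CU a) _ => if_neg w.2,
      Finset.prod_congr rfl fun (w : {w : InfinitePlace F // expo a w = 0}) _ => if_pos w.2]
    simp only [coord_RU, coord_CU]
    ring
  refine (lintegral_mono hpt).trans ?_
  have hm1 : Measurable fun x : RU a → ℝ => ∏ w : RU a, φ w.1.1 (x w) :=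
    Finset.measurable_prod _ fun w _ => (hφm _).comp
      (Complex.measurable_ofReal.comp (measurable_pi_apply w))
  have hm2 : Measurable fun x : CU a → ℂ => ∏ w : CU a, φ w.1.1 (x w) :=
    Finset.measurable_prod _ fun w _ => (hφm _).comp (measurable_pi_apply w)
  have hm : Measurable fun x : V a => (∏ w : RU a, φ w.1.1 (x.1 w)) * ∏ w : CU a, φ w.1.1 (x.2 w) :=
    (hm1.comp measurable_fst).mul (hm2.comp measurable_snd)
  rw [lintegral_const_mul _ hm,
    restrict_ball_V 2 two_pos, lintegral_prod_mul hm1.aemeasurable hm2.aemeasurable,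
    lintegral_fintype_prod _ (fun (w : RU a) (x : ℝ) => φ w.1.1 x)
      (fun w => (hφm _).comp Complex.measurable_ofReal),
    lintegral_fintype_prod _ (fun (w : CU a) x => φ w.1.1 x) (fun w => hφm _)]
  have hR : ∏ w : RU a, ∫⁻ x in Metric.ball (0 : ℝ) 2, φ w.1.1 x ≤
      Cr ^ Fintype.card (RU a) * ∏ w : RU a, N w.1.1 := by
    rw [← Finset.card_univ, ← Finset.prod_const, ← Finset.prod_mul_distrib]
    refine Finset.prod_le_prod' fun w _ => ?_
    obtain ⟨r, hr'⟩ := vec_real v g w.1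
    have hne := hi_ne_zero_or (a := a) (vec_ne_zero hv g w.1.1) w.1.1
    have hmx := max_hi_lo (a := a) w.1.1 (vec v g w.1.1)
    have h1 : hi a w.1.1 (vec v g w.1.1) = ((if 0 < expo a w.1.1 then r 0 else r 1 : ℝ) : ℂ) := by
      unfold hi; split_ifs <;> exact hr' _
    have h2 : lo a w.1.1 (vec v g w.1.1) = ((if 0 < expo a w.1.1 then r 1 else r 0 : ℝ) : ℂ) := by
      unfold lo; split_ifs <;> exact hr' _
    have := hr (if 0 < expo a w.1.1 then r 0 else r 1) (if 0 < expo a w.1.1 then r 1 else r 0) (by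
      rw [h1, h2] at hne
      exact_mod_cast hne)
    rw [h1, h2, Complex.norm_real, Complex.norm_real] at hmx
    rw [hmx] at this
    simp only [hφ, hN, h1, h2, InfinitePlace.mult_isReal, Nat.cast_one, mul_one]
    refine le_trans (le_of_eq ?_) this
    refine lintegral_congr fun x => ?_
    rw [← Complex.norm_real]
    push_cast
    rfl
  have hC : ∏ w : CU a, ∫⁻ x in Metric.ball (0 : ℂ) 2, φ w.1.1 x ≤
      Cc ^ Fintype.card (CU a) * ∏ w : CU a, N w.1.1 := by
    rw [← Finset.card_univ, ← Finset.prod_const, ← Finset.prod_mul_distrib]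
    refine Finset.prod_le_prod' fun w _ => ?_
    have := hc _ _ (hi_ne_zero_or (a := a) (vec_ne_zero hv g w.1.1) w.1.1)
    rw [max_hi_lo] at this
    simpa only [hφ, hN, InfinitePlace.mult_isComplex, Nat.cast_ofNat] using this
  refine (mul_le_mul' le_rfl (mul_le_mul' hR hC)).trans (le_of_eq ?_)
  rw [ofReal_exp_hMax_rpow, ofReal_Nm_rpow, prod_split a (fun w => _ ^ (-(β * (w.mult : ℝ))) : _ → ℝ≥0∞)]
  simp only [hN]
  rw [prod_split a (fun w => ENNReal.ofReal ‖vec v g w‖ ^ (-(β * (w.mult : ℝ))))]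
  ring

end HilbertModular

end

/-! ### The Margulis function and the volume of orbits visiting the cusp. -/

noncomputable section

namespace HilbertModular

open scoped ENNReal

variable {F : Type*} [Field F] [NumberField F] {a : G F}

instance : (volume : Measure (V a)).IsAddHaarMeasure :=
  MeasureTheory.Measure.prod.instIsAddHaarMeasure _ _

/-! ### The contraction inequality -/

/-- If some integral vector is short at `g`, then the short vectors at `g` lie on a line, and one of
them is shortest at every point of `G`. -/
lemma exists_shortest {g : G F} {σ : ℝ} (hσ : (∏ w : InfinitePlace F, (2 : ℝ) ^ w.mult) * (σ * σ) < 1)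
    (hex : ∃ v : Fin 2 → 𝓞 F, v ≠ 0 ∧ Nm v g < σ) :
    ∃ v₀ : Fin 2 → 𝓞 F, v₀ ≠ 0 ∧ ∀ v : Fin 2 → 𝓞 F, v ≠ 0 → Nm v g < σ → ∀ h, Nm v₀ h ≤ Nm v h := by
  -- Minimizing `vnrm`, which does not involve g, makes v₀ shortest at every h simultaneously.
  obtain ⟨v₀, ⟨hv₀, hv₀σ⟩, hmin⟩ := WellFounded.has_min (InvImage.wf vnrm Nat.lt_wfRel.wf)
    {v : Fin 2 → 𝓞 F | v ≠ 0 ∧ Nm v g < σ} hex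
  refine ⟨v₀, hv₀, fun v hv hvσ h => ?_⟩
  have hdep : v₀ 0 * v 1 - v₀ 1 * v 0 = 0 := by
    by_contra hne
    have h1 := one_le_Nm_mul_Nm hne g
    have h2 : Nm v₀ g * Nm v g ≤ σ * σ :=
      mul_le_mul hv₀σ.le hvσ.le (Nm_nonneg _ _) ((Nm_nonneg _ _).trans hv₀σ.le)
    have h3 : 0 ≤ ∏ w : InfinitePlace F, (2 : ℝ) ^ w.mult := by positivity
    have := mul_le_mul_of_nonneg_left h2 h3
    linarith
  have h1 := vnrm_mul_Nm hdep h
  have h2 : vnrm v₀ ≤ vnrm v := not_lt.1 (hmin v ⟨hv, hvσ⟩)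
  have h3 : (0 : ℝ) < vnrm v₀ := by exact_mod_cast vnrm_pos hv₀
  have h4 : (vnrm v₀ : ℝ) ≤ vnrm v := by exact_mod_cast h2
  have h5 := mul_le_mul_of_nonneg_right h4 (Nm_nonneg v₀ h)
  rw [← h1] at h5
  exact le_of_mul_le_mul_left h5 h3

lemma sys_le_mul_uni (g : G F) {z : V a} (hz : ‖z‖ ≤ 2) :
    sys g ≤ distortBound F * sys (g * uni z) := by
  have h := sys_mul_le (g * uni z) (uni (-z))
  rw [uni_neg, mul_inv_cancel_right] at h
  refine h.trans (mul_le_mul_of_nonneg_right ?_ (sys_pos _).le)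
  rw [← uni_neg]
  exact distort_uni_le (by rwa [norm_neg])

lemma Nm_le_mul_uni (v : Fin 2 → 𝓞 F) (g : G F) {z : V a} (hz : ‖z‖ ≤ 2) :
    Nm v g ≤ distortBound F * Nm v (g * uni z) := by
  refine (Nm_le_mul v g (uni z)).trans (mul_le_mul_of_nonneg_right ?_ (Nm_nonneg _ _))
  rw [← uni_neg]
  exact distort_uni_le (by rwa [norm_neg])

lemma distort_pow_inv_le (ha : IsDiagonal a) (m : ℕ) :
    distort (a ^ m)⁻¹ ≤ Real.exp (m / 2 * hMax a) := by
  have := distort_zpow_le ha (-(m : ℤ))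
  rw [zpow_neg, zpow_natCast] at this
  refine this.trans (le_of_eq ?_)
  push_cast
  rw [abs_neg, Nat.abs_cast]
  congr 1
  ring

lemma Nm_le_mul_uni_pow (ha : IsDiagonal a) (v : Fin 2 → 𝓞 F) (g : G F) {z : V a} (hz : ‖z‖ ≤ 2)
    (m : ℕ) :
    Nm v g ≤ distortBound F * Real.exp (m / 2 * hMax a) * Nm v (g * uni z * a ^ m) := by
  refine (Nm_le_mul_uni v g hz).trans ?_
  rw [mul_assoc]
  refine mul_le_mul_of_nonneg_left ?_ (zero_le_one.trans one_le_distortBound)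
  exact (Nm_le_mul v _ (a ^ m)).trans
    (mul_le_mul_of_nonneg_right (distort_pow_inv_le ha m) (Nm_nonneg _ _))

/-- The Margulis function: a power of the height, truncated below at `1`. -/
def alpha (τ β : ℝ) (g : G F) : ℝ≥0∞ :=
  max 1 (ENNReal.ofReal τ ^ β * ENNReal.ofReal (sys g) ^ (-β))

lemma alpha_eq_one {τ β : ℝ} (hβ : 0 < β) {g : G F} (h : τ ≤ sys g) : alpha τ β g = 1 := by
  refine max_eq_left ?_
  have h0 : ENNReal.ofReal (sys g) ≠ 0 := by simpa using sys_pos g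
  rw [ENNReal.rpow_neg, ← div_eq_mul_inv, ← ENNReal.div_rpow_of_nonneg _ _ hβ.le]
  exact ENNReal.rpow_le_one (ENNReal.div_le_of_le_mul (by simpa using ENNReal.ofReal_le_ofReal h)) hβ.le

lemma alpha_ne_top {τ β : ℝ} (hβ : 0 < β) (g : G F) : alpha τ β g ≠ ⊤ := by
  have h0 : ENNReal.ofReal (sys g) ≠ 0 := by simpa using sys_pos g
  refine (max_lt ENNReal.one_lt_top (ENNReal.mul_lt_top ?_ ?_)).ne
  · exact ENNReal.rpow_lt_top_of_nonneg hβ.le ENNReal.ofReal_ne_top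
  · rw [lt_top_iff_ne_top]
    simp [ENNReal.rpow_eq_top_iff, h0]

lemma alpha_le_of_Nm_le {τ β : ℝ} (hβ : 0 < β) {h : G F} (hs : sys h < τ) {v : Fin 2 → 𝓞 F}
    (hle : Nm v h ≤ sys h) :
    alpha τ β h ≤ ENNReal.ofReal τ ^ β * ENNReal.ofReal (Nm v h) ^ (-β) := by
  refine (max_le ?_ le_rfl).trans (mul_le_mul' le_rfl
    (rpow_anti (neg_nonpos.2 hβ.le) (ENNReal.ofReal_le_ofReal hle)))
  have h0 : ENNReal.ofReal (sys h) ≠ 0 := by simpa using sys_pos h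
  rw [ENNReal.rpow_neg, ← div_eq_mul_inv, ← ENNReal.div_rpow_of_nonneg _ _ hβ.le]
  refine ENNReal.one_le_rpow ?_ hβ
  rw [ENNReal.le_div_iff_mul_le (Or.inl h0) (Or.inl ENNReal.ofReal_ne_top), one_mul]
  exact ENNReal.ofReal_le_ofReal hs.le

/-- Outside the cusp the weighted height is 1; inside, it is controlled by one vector realizing the
systole. The sum of the two bounds covers both cases. -/
lemma ite_mul_alpha_le {τ β : ℝ} (hβ : 0 < β) (E : ℝ≥0∞) {h : G F} {v : Fin 2 → 𝓞 F}
    (hle : sys h < τ → Nm v h ≤ sys h) :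
    (if sys h < τ then E else 1) * alpha τ β h ≤
      1 + E * ENNReal.ofReal τ ^ β * ENNReal.ofReal (Nm v h) ^ (-β) := by
  split_ifs with hs
  · rw [mul_assoc]
    exact le_add_left (mul_le_mul' le_rfl (alpha_le_of_Nm_le hβ hs (hle hs)))
  · rw [one_mul, alpha_eq_one hβ (not_lt.1 hs)]
    exact le_self_add

/-- The weight exp(β m h_max / 2) on entering the cusp is exactly what the averaged expansion gains,
so the constant on the right is independent of m. The condition on τ forces all vectors that can
become shorter than τ after time m, from any z in the ball, onto one line; a single v₀ then computes
the height wherever it matters. -/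
lemma lintegral_alpha_step (ha : IsDiagonal a) {β τ : ℝ} (hβ : 0 < β) {C : ℝ≥0∞}
    (hC : ∀ (v : Fin 2 → 𝓞 F), v ≠ 0 → ∀ (g : G F) (m : ℕ),
      ∫⁻ z in Metric.ball (0 : V a) 2, ENNReal.ofReal (Nm v (g * uni z * a ^ m)) ^ (-β) ≤
        C * (ENNReal.ofReal (Real.exp (m / 2 * hMax a)) ^ (-β) * ENNReal.ofReal (Nm v g) ^ (-β)))
    (m : ℕ) (hτ : (∏ w : InfinitePlace F, (2 : ℝ) ^ w.mult) *
      ((distortBound F * Real.exp (m / 2 * hMax a) * τ) *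
        (distortBound F * Real.exp (m / 2 * hMax a) * τ)) < 1) (g : G F) :
    ∫⁻ z in Metric.ball (0 : V a) 2,
        (if sys (g * uni z * a ^ m) < τ then
          ENNReal.ofReal (Real.exp (m / 2 * hMax a)) ^ β else 1) * alpha τ β (g * uni z * a ^ m) ≤
      (volume (Metric.ball (0 : V a) 2) + C) * alpha τ β g := by
  set E := ENNReal.ofReal (Real.exp (m / 2 * hMax a)) ^ β with hE
  have hcpos : 0 < distortBound F * Real.exp (m / 2 * hMax a) :=
    mul_pos (zero_lt_one.trans_le one_le_distortBound) (Real.exp_pos _)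
  have hball : ∀ z ∈ Metric.ball (0 : V a) 2, ‖z‖ ≤ 2 := fun z hz => (mem_ball_zero_iff.1 hz).le
  have hbase : volume (Metric.ball (0 : V a) 2) ≤ volume (Metric.ball (0 : V a) 2) * alpha τ β g :=
    le_mul_of_one_le_right zero_le (le_max_left _ _)
  by_cases hex : ∃ z ∈ Metric.ball (0 : V a) 2, sys (g * uni z * a ^ m) < τ
  swap
  · push Not at hex
    refine (setLIntegral_mono' (g := fun _ => 1) Metric.isOpen_ball.measurableSet fun z hz => ?_).trans ?_
    · rw [if_neg (not_lt.2 (hex z hz)), alpha_eq_one hβ (hex z hz), one_mul]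
    · rw [setLIntegral_const, one_mul, add_mul]
      exact hbase.trans le_self_add
  obtain ⟨z₀, hz₀, hlt⟩ := hex
  obtain ⟨v₁, hv₁, hv₁τ⟩ := sys_lt_iff.1 hlt
  have hshort : ∀ z ∈ Metric.ball (0 : V a) 2, ∀ v : Fin 2 → 𝓞 F, Nm v (g * uni z * a ^ m) < τ →
      Nm v g < distortBound F * Real.exp (m / 2 * hMax a) * τ := fun z hz v hv =>
    (Nm_le_mul_uni_pow ha v g (hball z hz) m).trans_lt (mul_lt_mul_of_pos_left hv hcpos)
  obtain ⟨v₀, hv₀, hmin⟩ := exists_shortest hτ ⟨v₁, hv₁, hshort z₀ hz₀ v₁ hv₁τ⟩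
  have hpt : ∀ z ∈ Metric.ball (0 : V a) 2,
      (if sys (g * uni z * a ^ m) < τ then E else 1) * alpha τ β (g * uni z * a ^ m) ≤
        1 + E * ENNReal.ofReal τ ^ β * ENNReal.ofReal (Nm v₀ (g * uni z * a ^ m)) ^ (-β) := by
    intro z hz
    refine ite_mul_alpha_le hβ E fun h => ?_
    obtain ⟨v₂, hv₂, hv₂τ⟩ := sys_lt_iff.1 h
    -- A vector shorter than τ is on the line of v₀ and is no shorter than v₀. Any other vector has
    -- `Nm` at least τ, and v₀ is below τ because some vector v₂ is.
    refine le_ciInf fun v => ?_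
    rcases lt_or_ge (Nm v.1 (g * uni z * a ^ m)) τ with h' | h'
    · exact hmin v.1 v.2 (hshort z hz v.1 h') _
    · exact ((hmin v₂ hv₂ (hshort z hz v₂ hv₂τ) _).trans hv₂τ.le).trans h'
  refine (setLIntegral_mono' Metric.isOpen_ball.measurableSet hpt).trans ?_
  have hEt : E ≠ ⊤ := ENNReal.rpow_ne_top_of_nonneg hβ.le ENNReal.ofReal_ne_top
  have hτt : ENNReal.ofReal τ ^ β ≠ ⊤ := ENNReal.rpow_ne_top_of_nonneg hβ.le ENNReal.ofReal_ne_top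
  have hE0 : E ≠ 0 := by
    rw [hE, ENNReal.ofReal_rpow_of_pos (Real.exp_pos _)]
    simpa using Real.rpow_pos_of_pos (Real.exp_pos _) _
  rw [lintegral_add_left measurable_const, setLIntegral_const, one_mul,
    lintegral_const_mul' _ _ (ENNReal.mul_ne_top hEt hτt), add_mul]
  refine add_le_add hbase ((mul_le_mul' le_rfl (hC v₀ hv₀ g m)).trans ?_)
  calc E * ENNReal.ofReal τ ^ β * (C * (ENNReal.ofReal (Real.exp (m / 2 * hMax a)) ^ (-β) *
        ENNReal.ofReal (Nm v₀ g) ^ (-β)))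
      = C * (E * E⁻¹) * (ENNReal.ofReal τ ^ β * ENNReal.ofReal (Nm v₀ g) ^ (-β)) := by
        rw [ENNReal.rpow_neg (ENNReal.ofReal (Real.exp _)), ← hE]
        ring
    _ ≤ C * alpha τ β g := by
        rw [ENNReal.mul_inv_cancel hE0 hEt, mul_one]
        refine mul_le_mul' le_rfl ((mul_le_mul' le_rfl ?_).trans (le_max_right _ _))
        exact rpow_anti (neg_nonpos.2 hβ.le) (ENNReal.ofReal_le_ofReal (sys_le hv₀ g))

/-! ### Counting visits to the cusp -/

/-- The number of `1 ≤ j ≤ k` for which `h bʲ` lies in the cusp neighbourhood `{sys < τ}`. -/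
def visits (τ : ℝ) (b : G F) (k : ℕ) (h : G F) : ℕ :=
  ((Finset.range k).filter fun j => sys (h * b ^ (j + 1)) < τ).card

/-- The weight `E ^ visits`. -/
def weight (E : ℝ≥0∞) (τ : ℝ) (b : G F) (k : ℕ) (h : G F) : ℝ≥0∞ :=
  ∏ j ∈ Finset.range k, if sys (h * b ^ (j + 1)) < τ then E else 1

lemma weight_eq_pow (E : ℝ≥0∞) (τ : ℝ) (b : G F) (k : ℕ) (h : G F) :
    weight E τ b k h = E ^ visits τ b k h := by
  rw [weight, Finset.prod_ite, Finset.prod_const, Finset.prod_const_one, mul_one, visits]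

/-- The first step is peeled off, not the last, so that the remaining weight is evaluated at the
moved point h b. -/
lemma weight_succ (E : ℝ≥0∞) (τ : ℝ) (b : G F) (k : ℕ) (h : G F) :
    weight E τ b (k + 1) h = (if sys (h * b) < τ then E else 1) * weight E τ b k (h * b) := by
  rw [weight, Finset.prod_range_succ', mul_comm, zero_add, pow_one, weight]
  simp only [mul_assoc, ← pow_succ']

lemma measurable_weight {Y : Type*} [TopologicalSpace Y] [MeasurableSpace Y]
    [OpensMeasurableSpace Y] {f : Y → G F} (hf : Continuous f) (E : ℝ≥0∞) (τ : ℝ) (b : G F) (k : ℕ) :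
    Measurable fun y => weight E τ b k (f y) := by
  refine Finset.measurable_prod _ fun j _ => Measurable.ite ?_ measurable_const measurable_const
  exact (isOpen_lt (continuous_sys.comp (hf.mul continuous_const)) continuous_const).measurableSet

/-- Averaging over a ball is dominated by averaging in two steps at different scales. -/
lemma lintegral_ball_le_double {W : Type*} [NormedAddCommGroup W] [MeasurableSpace W] [BorelSpace W]
    [SecondCountableTopology W] (μ : Measure W) [μ.IsAddHaarMeasure] [SFinite μ]
    {s : W → W} (hs : Measurable s) (hsn : ∀ z, ‖s z‖ ≤ ‖z‖) {f : W → ℝ≥0∞} (hf : Measurable f) :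
    μ (Metric.ball 0 1) * ∫⁻ z in Metric.ball (0 : W) 1, f z ∂μ ≤
      ∫⁻ x in Metric.ball (0 : W) 2, ∫⁻ y in Metric.ball (0 : W) 1, f (x + s y) ∂μ ∂μ := by
  have hmeas : Measurable fun p : W × W => f (p.1 + s p.2) :=
    hf.comp (measurable_fst.add (hs.comp measurable_snd))
  -- After the interchange y is fixed. If x + s y is in the unit ball then x has norm below 2, so
  -- the translated integral over the larger ball dominates.
  rw [lintegral_lintegral_swap hmeas.aemeasurable, mul_comm, ← setLIntegral_const]
  refine setLIntegral_mono' Metric.isOpen_ball.measurableSet fun y hy => ?_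
  rw [← lintegral_indicator Metric.isOpen_ball.measurableSet,
    ← lintegral_indicator Metric.isOpen_ball.measurableSet, ← lintegral_add_right_eq_self _ (s y)]
  refine lintegral_mono fun x => ?_
  by_cases hx : x + s y ∈ Metric.ball (0 : W) 1
  · have hx2 : x ∈ Metric.ball (0 : W) 2 := by
      rw [mem_ball_zero_iff] at hx hy ⊢
      have h1 := norm_sub_le (x + s y) (s y)
      rw [add_sub_cancel_right] at h1
      linarith [hsn y]
    rw [Set.indicator_of_mem hx, Set.indicator_of_mem hx2]
  · rw [Set.indicator_of_notMem hx]
    exact zero_le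

/-- Induction on the number of steps. The parameter is split into a coarse part x, which sees the
first step, and a fine part that a^m expands to unit scale, where the inductive hypothesis applies
at the base point g u_x a^m. Each step costs a fixed factor, by the contraction inequality. -/
theorem lintegral_weight_le (ha : IsDiagonal a) {β τ : ℝ} (hβ : 0 < β) {C : ℝ≥0∞}
    (hC : ∀ (v : Fin 2 → 𝓞 F), v ≠ 0 → ∀ (g : G F) (m : ℕ),
      ∫⁻ z in Metric.ball (0 : V a) 2, ENNReal.ofReal (Nm v (g * uni z * a ^ m)) ^ (-β) ≤
        C * (ENNReal.ofReal (Real.exp (m / 2 * hMax a)) ^ (-β) * ENNReal.ofReal (Nm v g) ^ (-β)))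
    (hh : 0 ≤ hMax a)
    (m : ℕ) (hτ : (∏ w : InfinitePlace F, (2 : ℝ) ^ w.mult) *
      ((distortBound F * Real.exp (m / 2 * hMax a) * (distortBound F * τ)) *
        (distortBound F * Real.exp (m / 2 * hMax a) * (distortBound F * τ))) < 1) (k : ℕ) (g : G F) :
    ∫⁻ z in Metric.ball (0 : V a) 1,
        weight (ENNReal.ofReal (Real.exp (m / 2 * hMax a)) ^ β) τ (a ^ m) k (g * uni z) ≤
      volume (Metric.ball (0 : V a) 1) *
        ((volume (Metric.ball (0 : V a) 2) + C) / volume (Metric.ball (0 : V a) 1)) ^ k *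
          alpha (distortBound F * τ) β g := by
  set E := ENNReal.ofReal (Real.exp (m / 2 * hMax a)) ^ β with hE
  set B := volume (Metric.ball (0 : V a) 1) with hB
  set K := (volume (Metric.ball (0 : V a) 2) + C) / B with hK
  have hB0 : B ≠ 0 := (Metric.measure_ball_pos _ _ one_pos).ne'
  have hBt : B ≠ ⊤ := measure_ball_lt_top.ne
  have hE1 : 1 ≤ E := by
    refine ENNReal.one_le_rpow ?_ hβ
    rw [ENNReal.one_le_ofReal]
    exact Real.one_le_exp (by positivity)
  induction k generalizing g with
  | zero =>
    simp only [weight, Finset.range_zero, Finset.prod_empty, setLIntegral_const, one_mul, pow_zero,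
      mul_one]
    exact le_mul_of_one_le_right zero_le (le_max_left _ _)
  | succ k ih =>
    have hmeas : Measurable fun z : V a => weight E τ (a ^ m) (k + 1) (g * uni z) :=
      measurable_weight (continuous_const.mul continuous_uni) _ _ _ _
    have key := lintegral_ball_le_double (volume : Measure (V a))
      (s := expand (-(m : ℤ))) (continuous_expand _).measurable (norm_expand_neg_le ha m) hmeas
    -- The first visit is tested at g u_x a^m instead of g u_x a^m u_y, which enlarges the threshold
    -- by `distortBound F`. This loss does not accumulate: the weights keep the threshold τ and only
    -- the height on the right uses the larger one.
    have hstep : ∀ x y : V a, ‖y‖ ≤ 2 →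
        weight E τ (a ^ m) (k + 1) (g * uni (x + expand (-(m : ℤ)) y)) ≤
          (if sys (g * uni x * a ^ m) < distortBound F * τ then E else 1) *
            weight E τ (a ^ m) k (g * uni x * a ^ m * uni y) := by
      intro x y hy
      have h1 : g * uni (x + expand (-(m : ℤ)) y) * a ^ m = g * uni x * a ^ m * uni y := by
        rw [uni_add, ← zpow_natCast, mul_assoc, mul_assoc (uni x), uni_mul_zpow ha,
          expand_neg_expand ha]
        simp only [mul_assoc]
      rw [weight_succ, h1]
      refine mul_le_mul' ?_ le_rfl
      split_ifs with h2 h3 h3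
      · exact le_rfl
      · refine absurd ?_ h3
        exact (sys_le_mul_uni _ hy).trans_lt
          (mul_lt_mul_of_pos_left h2 (zero_lt_one.trans_le one_le_distortBound))
      · exact hE1
      · exact le_rfl
    have h1 : B * ∫⁻ z in Metric.ball (0 : V a) 1, weight E τ (a ^ m) (k + 1) (g * uni z) ≤
        B * (K ^ k * (volume (Metric.ball (0 : V a) 2) + C) * alpha (distortBound F * τ) β g) := by
      refine key.trans ?_
      calc _ ≤ ∫⁻ x in Metric.ball (0 : V a) 2, (B * K ^ k) *
            ((if sys (g * uni x * a ^ m) < distortBound F * τ then E else 1) *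
              alpha (distortBound F * τ) β (g * uni x * a ^ m)) := by
            refine lintegral_mono fun x => ?_
            refine (setLIntegral_mono' Metric.isOpen_ball.measurableSet fun y hy =>
              hstep x y (by linarith [mem_ball_zero_iff.1 hy])).trans ?_
            have hmx : Measurable fun y : V a => weight E τ (a ^ m) k (g * uni x * a ^ m * uni y) :=
              measurable_weight (continuous_const.mul continuous_uni) _ _ _ _
            rw [lintegral_const_mul _ hmx]
            refine (mul_le_mul' le_rfl (ih (g * uni x * a ^ m))).trans (le_of_eq ?_)
            ring
        _ ≤ (B * K ^ k) * ((volume (Metric.ball (0 : V a) 2) + C) *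
              alpha (distortBound F * τ) β g) := by
            -- Finiteness of C is not assumed here. When the constant is infinite the right side is
            -- infinite, since the remaining factor is nonzero.
            by_cases hKt : B * K ^ k = ⊤
            · rw [hKt, ENNReal.top_mul]
              · exact le_top
              · refine mul_ne_zero ?_ (one_pos.trans_le (le_max_left _ _)).ne'
                exact (add_pos_of_pos_of_nonneg (Metric.measure_ball_pos _ _ two_pos) zero_le).ne'
            rw [lintegral_const_mul' _ _ hKt]
            exact mul_le_mul' le_rfl (lintegral_alpha_step ha hβ hC m hτ g)
        _ = _ := by ring
    refine ((ENNReal.mul_le_mul_iff_right hB0 hBt).1 h1).trans (le_of_eq ?_)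
    rw [pow_succ, hK]
    rw [show B * (K ^ k * K) = K ^ k * (B * K) by ring, hK, ENNReal.mul_div_cancel hB0 hBt]

/-- Markov's inequality for the weight, which is at least E^n on this set. -/
theorem volume_visits_le (ha : IsDiagonal a) {β τ : ℝ} (hβ : 0 < β) {C : ℝ≥0∞}
    (hC : ∀ (v : Fin 2 → 𝓞 F), v ≠ 0 → ∀ (g : G F) (m : ℕ),
      ∫⁻ z in Metric.ball (0 : V a) 2, ENNReal.ofReal (Nm v (g * uni z * a ^ m)) ^ (-β) ≤
        C * (ENNReal.ofReal (Real.exp (m / 2 * hMax a)) ^ (-β) * ENNReal.ofReal (Nm v g) ^ (-β)))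
    (hh : 0 ≤ hMax a)
    (m : ℕ) (hτ : (∏ w : InfinitePlace F, (2 : ℝ) ^ w.mult) *
      ((distortBound F * Real.exp (m / 2 * hMax a) * (distortBound F * τ)) *
        (distortBound F * Real.exp (m / 2 * hMax a) * (distortBound F * τ))) < 1) (k : ℕ) (g : G F)
    (n : ℕ) :
    (ENNReal.ofReal (Real.exp (m / 2 * hMax a)) ^ β) ^ n *
        volume ({z : V a | n ≤ visits τ (a ^ m) k (g * uni z)} ∩ Metric.ball 0 1) ≤
      volume (Metric.ball (0 : V a) 1) *
        ((volume (Metric.ball (0 : V a) 2) + C) / volume (Metric.ball (0 : V a) 1)) ^ k *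
          alpha (distortBound F * τ) β g := by
  refine le_trans ?_ (lintegral_weight_le ha hβ hC hh m hτ k g)
  have hE1 : 1 ≤ ENNReal.ofReal (Real.exp (m / 2 * hMax a)) ^ β := by
    refine ENNReal.one_le_rpow ?_ hβ
    rw [ENNReal.one_le_ofReal]
    exact Real.one_le_exp (by positivity)
  have hmeas : Measurable fun z : V a => weight (ENNReal.ofReal (Real.exp (m / 2 * hMax a)) ^ β) τ
      (a ^ m) k (g * uni z) := measurable_weight (continuous_const.mul continuous_uni) _ _ _ _
  refine le_trans (mul_le_mul' le_rfl ?_) (mul_meas_ge_le_lintegral hmeas _)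
  rw [Measure.restrict_apply' Metric.isOpen_ball.measurableSet]
  refine measure_mono (Set.inter_subset_inter_left _ fun z hz => ?_)
  simp only [Set.mem_ofPred_eq, weight_eq_pow] at hz ⊢
  exact pow_le_pow_right₀ hE1 hz

end HilbertModular

end

/-! ### Local product structure: the unstable group against the stable and central directions. -/

noncomputable section

namespace HilbertModular

variable {F : Type*} [Field F] [NumberField F] {a : G F}

/-! ### The unstable subgroup -/

lemma tendsto_expand_atBot (ha : IsDiagonal a) (z : V a) :
    Tendsto (fun n : ℤ => expand n z) atBot (𝓝 0) := by
  have hlam : ∀ w, expo a w ≠ 0 → Tendsto (fun n : ℤ => lam a w ^ n) atBot (𝓝 0) := by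
    intro w hw
    rw [tendsto_zero_iff_norm_tendsto_zero]
    have h : ∀ n : ℤ, ‖lam a w ^ n‖ = Real.exp (n * |expo a w|) := fun n => by
      rw [norm_zpow, norm_lam ha, ← Real.rpow_intCast, ← Real.exp_mul, mul_comm]
    simp_rw [h]
    exact Real.tendsto_exp_atBot.comp
      ((tendsto_intCast_atBot_iff.2 tendsto_id).atBot_mul_const (abs_pos.2 hw))
  refine Tendsto.prodMk_nhds (tendsto_pi_nhds.2 fun w => ?_) (tendsto_pi_nhds.2 fun w => ?_)
  · have := ((Complex.continuous_re.tendsto 0).comp (hlam _ w.2)).mul_const (z.1 w)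
    simpa using this
  · have := (hlam _ w.2).mul_const (z.2 w)
    simpa using this

lemma zpow_neg_mul_uni_mul (ha : IsDiagonal a) (n : ℤ) (z : V a) :
    a ^ (-n) * uni z * a ^ n = uni (expand n z) := by
  rw [mul_assoc, uni_mul_zpow ha, zpow_neg, inv_mul_cancel_left]

lemma uni_mem_UPlus (ha : IsDiagonal a) (z : V a) : uni z ∈ UPlus a := by
  change Tendsto (fun n : ℤ => a ^ (-n) * uni z * a ^ n) atBot (𝓝 1)
  simp_rw [zpow_neg_mul_uni_mul ha]
  have := (continuous_uni.tendsto (0 : V a)).comp (tendsto_expand_atBot ha z)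
  rwa [uni_zero] at this

lemma norm_unip_sub_one_le {𝕜 : Type*} [RCLike 𝕜] (p : Prop) [Decidable p] (c : 𝕜) (i j : Fin 2) :
    ‖unip p c i j - (1 : Matrix (Fin 2) (Fin 2) 𝕜) i j‖ ≤ ‖c‖ := by
  unfold unip
  split_ifs <;> fin_cases i <;> fin_cases j <;> simp

lemma uni_mem_ball (ha : IsDiagonal a) {z : V a} {ε : ℝ} (hz : ‖z‖ < ε) :
    uni z ∈ ball (UPlus a : Set (G F)) ε := by
  refine ⟨uni_mem_UPlus ha z, fun w i j => ?_, fun w i j => ?_⟩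
  · refine (norm_unip_sub_one_le _ _ i j).trans_lt (lt_of_le_of_lt ?_ hz)
    rw [← Complex.norm_real, ← coord_real]
    exact norm_coord_le z w.1
  · refine (norm_unip_sub_one_le _ _ i j).trans_lt (lt_of_le_of_lt ?_ hz)
    rw [← coord_complex]
    exact norm_coord_le z w.1

/-- The nilpotent matrix `unip p c - 1`. -/
def nilp {R : Type*} [CommRing R] (p : Prop) [Decidable p] (c : R) : Matrix (Fin 2) (Fin 2) R :=
  if p then !![0, 0; c, 0] else !![0, c; 0, 0]

lemma nilp_mul_self {R : Type*} [CommRing R] (p : Prop) [Decidable p] (c : R) :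
    nilp p c * nilp p c = 0 := by
  unfold nilp
  split_ifs <;> ext i j <;> fin_cases i <;> fin_cases j <;> simp [Matrix.mul_apply]

lemma unip_eq_one_add_nilp {R : Type*} [CommRing R] (p : Prop) [Decidable p] (c : R) :
    (unip p c).1 = 1 + nilp p c := by
  unfold nilp unip
  split_ifs <;> ext i j <;> fin_cases i <;> fin_cases j <;> simp

/-- The differential at `0` of the parametrization of the unstable subgroup. -/
def nilMat : V a →ₗ[ℝ] Mat F where
  toFun z := (fun w => nilp (0 < expo a w.1) (realCoord z w),
    fun w => nilp (0 < expo a w.1) (complexCoord z w))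
  map_add' z z' := by
    refine Prod.ext (funext fun w => ?_) (funext fun w => ?_)
    · have : realCoord (z + z') w = realCoord z w + realCoord z' w := by
        unfold realCoord; split_ifs <;> simp
      change nilp _ (realCoord (z + z') w) = nilp _ _ + nilp _ _
      rw [this]
      unfold nilp
      split_ifs <;> ext i j <;> fin_cases i <;> fin_cases j <;> simp
    · have : complexCoord (z + z') w = complexCoord z w + complexCoord z' w := by
        unfold complexCoord; split_ifs <;> simp
      change nilp _ (complexCoord (z + z') w) = nilp _ _ + nilp _ _
      rw [this]
      unfold nilp
      split_ifs <;> ext i j <;> fin_cases i <;> fin_cases j <;> simp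
  map_smul' t z := by
    refine Prod.ext (funext fun w => ?_) (funext fun w => ?_)
    · have : realCoord (t • z) w = t * realCoord z w := by
        unfold realCoord; split_ifs <;> simp
      change nilp _ (realCoord (t • z) w) = t • nilp _ _
      rw [this]
      unfold nilp
      split_ifs <;> ext i j <;> fin_cases i <;> fin_cases j <;> simp
    · have : complexCoord (t • z) w = t * complexCoord z w := by
        unfold complexCoord; split_ifs <;> simp
      change nilp _ (complexCoord (t • z) w) = t • nilp _ _
      rw [this]
      unfold nilp
      split_ifs <;> ext i j <;> fin_cases i <;> fin_cases j <;> simp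

lemma nilMat_injective : Function.Injective (nilMat : V a →ₗ[ℝ] Mat F) := by
  intro z z' h
  have hn : ∀ {R : Type} [CommRing R] (p : Prop) [Decidable p] (c d : R),
      nilp p c = nilp p d → c = d := by
    intro R _ p _ c d h
    unfold nilp at h
    split_ifs at h
    · simpa using congrFun (congrFun h 1) 0
    · simpa using congrFun (congrFun h 0) 1
  refine ext_coord fun w => ?_
  refine place_cases (P := fun w => coord z w = coord z' w) (fun w => ?_) (fun w => ?_) w
  · rw [coord_real, coord_real, hn _ _ _ (congrFun (congrArg Prod.fst h) w)]
  · rw [coord_complex, coord_complex, hn _ _ _ (congrFun (congrArg Prod.snd h) w)]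

lemma toMat_uni (z : V a) : toMat (uni z) = 1 + nilMat z :=
  Prod.ext (funext fun _ => unip_eq_one_add_nilp _ _) (funext fun _ => unip_eq_one_add_nilp _ _)

lemma exp_nilMat (z : V a) : NormedSpace.exp (nilMat z) = 1 + nilMat z := by
  have hsq : nilMat z ^ 2 = 0 := by
    rw [sq]
    exact Prod.ext (funext fun _ => nilp_mul_self _ _) (funext fun _ => nilp_mul_self _ _)
  rw [NormedSpace.exp_eq_tsum ℝ]
  simp only
  rw [tsum_eq_sum (s := Finset.range 2)]
  · simp [Finset.sum_range_succ]
  · intro n hn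
    have : 2 ≤ n := by simpa [Nat.succ_le_iff] using hn
    rw [pow_eq_zero_of_le this hsq, smul_zero]

/-- The nilpotent matrices 1 + X exponentiate into U⁺ because X² = 0. This inequality is enough: the
escape bound is proved with the dimension of `V a` and weakens as the dimension grows. -/
lemma finrank_V_le_lieDim (ha : IsDiagonal a) : Module.finrank ℝ (V a) ≤ lieDim (UPlus a) := by
  rw [← LinearMap.finrank_range_of_inj (nilMat_injective (a := a)), lieDim]
  refine Submodule.finrank_mono ?_
  rintro _ ⟨z, rfl⟩
  refine Submodule.subset_span fun t => ⟨uni (t • z), uni_mem_UPlus ha _, ?_⟩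
  rw [toMat_uni, ← map_smul, exp_nilMat]

/-! ### The stable directions -/

lemma expo_eq_log (w : InfinitePlace F) : expo a w = 2 * Real.log ‖tt a w‖ := by
  refine place_cases (P := fun w => expo a w = 2 * Real.log ‖tt a w‖) (fun w => ?_) (fun w => ?_) w
  · rw [tt, comp_real_apply, Complex.norm_real, expo, dif_pos w.2]
  · rw [tt, comp_complex, expo, dif_neg (InfinitePlace.not_isReal_iff_isComplex.2 w.2)]

lemma IsDiagonal.inv (ha : IsDiagonal a) : IsDiagonal a⁻¹ := by
  have key : ∀ {R : Type} [CommRing R] (m : SL(2, R)), m.1.IsDiag → (m⁻¹).1.IsDiag := by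
    intro R _ m hm i j hij
    rw [Matrix.SpecialLinearGroup.coe_inv, Matrix.adjugate_fin_two]
    have h01 := hm (by decide : (0 : Fin 2) ≠ 1)
    have h10 := hm (by decide : (1 : Fin 2) ≠ 0)
    fin_cases i <;> fin_cases j <;> simp_all
  exact ⟨fun w => key _ (ha.1 w), fun w => key _ (ha.2 w)⟩

lemma expo_inv (ha : IsDiagonal a) (w : InfinitePlace F) : expo a⁻¹ w = -expo a w := by
  have h : tt a⁻¹ w = (tt a w)⁻¹ := by
    have := comp_zpow ha (-1) w
    rw [zpow_neg_one] at this
    rw [tt, this]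
    simp
  rw [expo_eq_log, expo_eq_log, h, norm_inv, Real.log_inv]
  ring

lemma mem_UMinus_of_mem_UPlus_inv {g : G F} (hg : g ∈ UPlus a⁻¹) : g ∈ UMinus a := by
  change Tendsto (fun n : ℤ => a ^ (-n) * g * a ^ n) atTop (𝓝 1)
  have h : Tendsto (fun n : ℤ => a⁻¹ ^ (-n) * g * a⁻¹ ^ n) atBot (𝓝 1) := hg
  refine (h.comp tendsto_neg_atTop_atBot).congr fun n => ?_
  simp

/-- At a non-neutral place, the component lies in the Borel subgroup normalized by the stable
direction. -/
def IsStableTriangular (a : G F) (b : G F) : Prop :=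
  ∀ w, (0 < expo a w → comp w b 1 0 = 0) ∧ (expo a w < 0 → comp w b 0 1 = 0)

/-- At a neutral real place |t| = 1 forces t = ±1; at a neutral complex place centrality is assumed.
So L contains the full factor at every neutral place. -/
lemma comp_comm_of_neutral (ha : IsDiagonal a)
    (hneutral : ∀ w : ComplexPlace F, expo a w.1 = 0 → a.2 w ∈ Subgroup.center SL(2, ℂ))
    {w : InfinitePlace F} (hw : expo a w = 0) (m : SL(2, ℂ)) : comp w a * m = m * comp w a := by
  revert hw
  refine place_cases (P := fun w => expo a w = 0 → comp w a * m = m * comp w a)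
    (fun w hw => ?_) (fun w hw => ?_) w
  · have hn := norm_tt ha w.1
    rw [hw, zero_div, Real.exp_zero] at hn
    have hr : tt a w.1 = ((a.1 w 0 0 : ℝ) : ℂ) := comp_real_apply w a 0 0
    have hinv : (tt a w.1)⁻¹ = tt a w.1 := by
      rw [hr, Complex.norm_real, Real.norm_eq_abs] at hn
      rw [hr]
      rcases eq_or_eq_neg_of_abs_eq hn with h | h <;> rw [h] <;> norm_num
    have hc := comp_zpow ha 1 w.1
    rw [zpow_one, zpow_one, hinv] at hc
    ext i j
    rw [Matrix.SpecialLinearGroup.coe_mul, Matrix.SpecialLinearGroup.coe_mul, hc]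
    fin_cases i <;> fin_cases j <;> simp [Matrix.mul_apply, Fin.sum_univ_two, mul_comm]
  · rw [comp_complex]
    exact (Subgroup.mem_center_iff.1 (hneutral w hw) m).symm

lemma mem_L_of_diag (ha : IsDiagonal a)
    (hneutral : ∀ w : ComplexPlace F, expo a w.1 = 0 → a.2 w ∈ Subgroup.center SL(2, ℂ))
    {l : G F} (hl : ∀ w, expo a w ≠ 0 → comp w l 0 1 = 0 ∧ comp w l 1 0 = 0) : l ∈ L a := by
  rw [L, Subgroup.mem_centralizer_singleton_iff]
  refine ext_comp fun w => ?_
  rw [map_mul, map_mul]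
  by_cases hw : expo a w = 0
  · exact (comp_comm_of_neutral ha hneutral hw _).symm
  · have h1 := offdiag_zero ha w
    have h2 := hl w hw
    ext i j
    rw [Matrix.SpecialLinearGroup.coe_mul, Matrix.SpecialLinearGroup.coe_mul]
    fin_cases i <;> fin_cases j <;>
      simp [Matrix.mul_apply, Fin.sum_univ_two, h1.1, h1.2, h2.1, h2.2, mul_comm]

/-- At each non-neutral place a triangular matrix is a unipotent times a diagonal one. The unipotent
parts assemble to an element of the unstable group of a⁻¹, which is stable for a; what remains is
diagonal where a is not neutral and hence commutes with a. -/
lemma mem_UMinus_mul_L (ha : IsDiagonal a)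
    (hneutral : ∀ w : ComplexPlace F, expo a w.1 = 0 → a.2 w ∈ Subgroup.center SL(2, ℂ))
    {b : G F} (hb : IsStableTriangular a b) : b ∈ (UMinus a : Set (G F)) * (L a : Set (G F)) := by
  let z : V a⁻¹ :=
    (fun w => if 0 < expo a⁻¹ w.1.1 then b.1 w.1 1 0 / b.1 w.1 0 0 else b.1 w.1 0 1 / b.1 w.1 1 1,
      fun w => if 0 < expo a⁻¹ w.1.1 then b.2 w.1 1 0 / b.2 w.1 0 0 else b.2 w.1 0 1 / b.2 w.1 1 1)
  have hz : ∀ w, expo a w ≠ 0 → coord z w = if 0 < expo a⁻¹ w then comp w b 1 0 / comp w b 0 0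
      else comp w b 0 1 / comp w b 1 1 := by
    intro w
    refine place_cases (P := fun w => expo a w ≠ 0 → coord z w = if 0 < expo a⁻¹ w then
      comp w b 1 0 / comp w b 0 0 else comp w b 0 1 / comp w b 1 1) (fun w hw => ?_)
      (fun w hw => ?_) w
    · have hw' : expo a⁻¹ w.1 ≠ 0 := by rw [expo_inv ha]; exact neg_ne_zero.2 hw
      rw [coord_RU z ⟨w, hw'⟩]
      simp only [comp_real_apply, z]
      split_ifs <;> push_cast <;> rfl
    · have hw' : expo a⁻¹ w.1 ≠ 0 := by rw [expo_inv ha]; exact neg_ne_zero.2 hw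
      rw [coord_CU z ⟨w, hw'⟩]
      simp only [comp_complex, z]
  refine Set.mem_mul.2 ⟨uni z, mem_UMinus_of_mem_UPlus_inv (uni_mem_UPlus ha.inv z),
    (uni z)⁻¹ * b, mem_L_of_diag ha hneutral fun w hw => ?_, mul_inv_cancel_left _ _⟩
  have hdet := (comp w b).2
  rw [Matrix.det_fin_two] at hdet
  rw [← uni_neg, map_mul, comp_uni, Matrix.SpecialLinearGroup.coe_mul]
  have hc : coord (-z) w = -coord z w := by
    have := coord_add z (-z) w
    rw [add_neg_cancel] at this
    have h0 : coord (0 : V a⁻¹) w = 0 := norm_le_zero_iff.1 ((norm_coord_le _ w).trans (by simp))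
    rw [h0] at this
    exact (neg_eq_of_add_eq_zero_right this.symm).symm
  rw [hc, hz w hw]
  rcases lt_or_gt_of_ne hw with h | h
  · have h1 : 0 < expo a⁻¹ w := by rw [expo_inv ha]; linarith
    have h2 := (hb w).2 h
    rw [h2, zero_mul, sub_zero] at hdet
    have h3 : comp w b 0 0 ≠ 0 := left_ne_zero_of_mul_eq_one hdet
    simp [unip, h1, Matrix.mul_apply, Fin.sum_univ_two, h2, h3]
  · have h1 : ¬ 0 < expo a⁻¹ w := by rw [expo_inv ha]; linarith
    have h2 := (hb w).1 h
    rw [h2, mul_zero, sub_zero] at hdet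
    have h3 : comp w b 1 1 ≠ 0 := right_ne_zero_of_mul_eq_one hdet
    simp [unip, h1, Matrix.mul_apply, Fin.sum_univ_two, h2, h3]

/-- The parameter of the unstable factor of an element of `G` near `1`. -/
def unstableParam (a g : G F) : V a :=
  (fun w => if 0 < expo a w.1.1 then g.1 w.1 1 0 / g.1 w.1 0 0 else g.1 w.1 0 1 / g.1 w.1 1 1,
    fun w => if 0 < expo a w.1.1 then g.2 w.1 1 0 / g.2 w.1 0 0 else g.2 w.1 0 1 / g.2 w.1 1 1)

lemma coord_unstableParam (g : G F) {w : InfinitePlace F} (hw : expo a w ≠ 0) :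
    coord (unstableParam a g) w = if 0 < expo a w then comp w g 1 0 / comp w g 0 0
      else comp w g 0 1 / comp w g 1 1 := by
  revert hw
  refine place_cases (P := fun w => expo a w ≠ 0 → coord (unstableParam a g) w =
    if 0 < expo a w then comp w g 1 0 / comp w g 0 0 else comp w g 0 1 / comp w g 1 1)
    (fun w hw => ?_) (fun w hw => ?_) w
  · rw [coord_RU _ ⟨w, hw⟩]
    simp only [comp_real_apply, unstableParam]
    split_ifs <;> push_cast <;> rfl
  · rw [coord_CU _ ⟨w, hw⟩]
    simp only [comp_complex, unstableParam]

lemma continuous_fst_apply (w : RealPlace F) (i j : Fin 2) : Continuous fun g : G F => g.1 w i j :=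
  Continuous.matrix_elem (continuous_subtype_val.comp (by fun_prop)) i j

lemma continuous_snd_apply (w : ComplexPlace F) (i j : Fin 2) :
    Continuous fun g : G F => g.2 w i j :=
  Continuous.matrix_elem (continuous_subtype_val.comp (by fun_prop)) i j

lemma tendsto_unstableParam : Tendsto (unstableParam a) (𝓝 1) (𝓝 0) := by
  refine Tendsto.prodMk_nhds (tendsto_pi_nhds.2 fun w => ?_) (tendsto_pi_nhds.2 fun w => ?_)
  · split_ifs
    · have h : Tendsto (fun g : G F => g.1 w.1 1 0 / g.1 w.1 0 0) _ _ :=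
        ((continuous_fst_apply (F := F) w.1 1 0).tendsto 1).div
          ((continuous_fst_apply (F := F) w.1 0 0).tendsto 1) (by simp)
      simpa using h
    · have h : Tendsto (fun g : G F => g.1 w.1 0 1 / g.1 w.1 1 1) _ _ :=
        ((continuous_fst_apply (F := F) w.1 0 1).tendsto 1).div
          ((continuous_fst_apply (F := F) w.1 1 1).tendsto 1) (by simp)
      simpa using h
  · split_ifs
    · have h : Tendsto (fun g : G F => g.2 w.1 1 0 / g.2 w.1 0 0) _ _ :=
        ((continuous_snd_apply (F := F) w.1 1 0).tendsto 1).div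
          ((continuous_snd_apply (F := F) w.1 0 0).tendsto 1) (by simp)
      simpa using h
    · have h : Tendsto (fun g : G F => g.2 w.1 0 1 / g.2 w.1 1 1) _ _ :=
        ((continuous_snd_apply (F := F) w.1 0 1).tendsto 1).div
          ((continuous_snd_apply (F := F) w.1 1 1).tendsto 1) (by simp)
      simpa using h

/-- The elements of the ball in `U⁻ L` which are triangular at the non-neutral places. -/
def stableBall (a : G F) (η : ℝ) : Set (G F) :=
  {b | b ∈ ball ((UMinus a : Set (G F)) * (L a : Set (G F))) η ∧ IsStableTriangular a b}

/-- Products of small unstable elements and small elements of `U⁻ L` form a neighbourhood of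
`1`. -/
theorem eventually_eq_uni_mul (ha : IsDiagonal a)
    (hneutral : ∀ w : ComplexPlace F, expo a w.1 = 0 → a.2 w ∈ Subgroup.center SL(2, ℂ))
    {r η : ℝ} (hr : 0 < r) (hη : 0 < η) :
    ∀ᶠ g in 𝓝 (1 : G F), ∃ z : V a, ‖z‖ < r ∧ ∃ b ∈ stableBall a η, g = uni z * b := by
  have hz : ∀ᶠ g in 𝓝 (1 : G F), ‖unstableParam a g‖ < r := by
    have := tendsto_unstableParam (a := a).norm
    rw [norm_zero] at this
    exact this.eventually (gt_mem_nhds hr)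
  have hb : Tendsto (fun g : G F => (uni (unstableParam a g))⁻¹ * g) (𝓝 1) (𝓝 1) := by
    have := (((continuous_uni (a := a)).tendsto 0).comp
      (tendsto_unstableParam (a := a))).inv.mul (tendsto_id (x := 𝓝 (1 : G F)))
    simpa [uni_zero] using this
  have hsmall : ∀ᶠ b in 𝓝 (1 : G F),
      (∀ w i j, ‖(b.1 w) i j - (1 : Matrix (Fin 2) (Fin 2) ℝ) i j‖ < η) ∧
      (∀ w i j, ‖(b.2 w) i j - (1 : Matrix (Fin 2) (Fin 2) ℂ) i j‖ < η) := by
    refine Eventually.and ?_ ?_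
    · refine eventually_all.2 fun w => eventually_all.2 fun i => eventually_all.2 fun j => ?_
      have h := (((continuous_fst_apply (F := F) w i j).sub continuous_const).norm.tendsto (1 : G F) :
        Tendsto (fun g : G F => ‖g.1 w i j - (1 : Matrix (Fin 2) (Fin 2) ℝ) i j‖) _ _)
      refine h.eventually (gt_mem_nhds ?_)
      simpa using hη
    · refine eventually_all.2 fun w => eventually_all.2 fun i => eventually_all.2 fun j => ?_
      have h := (((continuous_snd_apply (F := F) w i j).sub continuous_const).norm.tendsto (1 : G F) :
        Tendsto (fun g : G F => ‖g.2 w i j - (1 : Matrix (Fin 2) (Fin 2) ℂ) i j‖) _ _)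
      refine h.eventually (gt_mem_nhds ?_)
      simpa using hη
  have hne : ∀ᶠ g in 𝓝 (1 : G F), ∀ w i, comp w g i i ≠ 0 := by
    refine eventually_all.2 fun w => eventually_all.2 fun i => ?_
    refine ((continuous_comp_apply w i i).tendsto (1 : G F)).eventually_ne ?_
    simp
  filter_upwards [hz, hb.eventually hsmall, hne] with g hg1 hg2 hg3
  -- The quotient of two entries in `unstableParam` is the one that a single row operation needs in
  -- order to clear the unstable entry of g.
  have htri : IsStableTriangular a ((uni (unstableParam a g))⁻¹ * g) := by
    intro w
    have hc : coord (-unstableParam a g) w = -coord (unstableParam a g) w := by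
      have := coord_add (unstableParam a g) (-unstableParam a g) w
      rw [add_neg_cancel] at this
      have h0 : coord (0 : V a) w = 0 := norm_le_zero_iff.1 ((norm_coord_le _ w).trans (by simp))
      rw [h0] at this
      exact (neg_eq_of_add_eq_zero_right this.symm).symm
    rw [← uni_neg, map_mul, comp_uni, Matrix.SpecialLinearGroup.coe_mul, hc]
    refine ⟨fun h => ?_, fun h => ?_⟩
    · rw [coord_unstableParam g h.ne']
      simp [unip, h, Matrix.mul_apply, Fin.sum_univ_two, hg3 w 0]
    · rw [coord_unstableParam g h.ne]
      simp [unip, h.not_gt, Matrix.mul_apply, Fin.sum_univ_two, hg3 w 1]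
  exact ⟨unstableParam a g, hg1, _, ⟨⟨mem_UMinus_mul_L ha hneutral htri, hg2⟩, htri⟩,
    (mul_inv_cancel_left _ _).symm⟩

lemma colNorm_inv_le_three {m : SL(2, ℂ)} (h0 : ‖m 0 0‖ ≤ 2) (h1 : ‖m 1 1‖ ≤ 2)
    (h2 : ‖m 0 1‖ ≤ 1) (h3 : ‖m 1 0‖ ≤ 1) : colNorm (m⁻¹ : SL(2, ℂ)).1 ≤ 3 := by
  rw [Matrix.SpecialLinearGroup.coe_inv, Matrix.adjugate_fin_two]
  refine max_le ?_ ?_ <;> simp <;> linarith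

lemma norm_comp_sub_one_lt {b : G F} {S : Set (G F)} {η : ℝ} (hb : b ∈ ball S η)
    (w : InfinitePlace F) (i j : Fin 2) :
    ‖comp w b i j - (1 : Matrix (Fin 2) (Fin 2) ℂ) i j‖ < η := by
  refine place_cases (P := fun w => ‖comp w b i j - (1 : Matrix (Fin 2) (Fin 2) ℂ) i j‖ < η)
    (fun w => ?_) (fun w => ?_) w
  · have := hb.2.1 w i j
    rw [← Complex.norm_real] at this
    rw [comp_real_apply]
    convert this using 2
    push_cast
    congr 1
    simp [Matrix.one_apply, apply_ite]
  · rw [comp_complex]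
    exact hb.2.2 w i j

/-- Forward conjugates of inverses of elements of `stableBall a 1` have bounded distortion. -/
lemma distort_conj_stable_le (ha : IsDiagonal a) {b : G F} (hb : b ∈ stableBall a 1) (n : ℕ) :
    distort (a ^ (-(n : ℤ)) * b * a ^ (n : ℤ))⁻¹ ≤ distortBound F := by
  refine distort_le_of_colNorm fun w => ?_
  rw [map_inv]
  have he : ∀ i j, comp w (a ^ (-(n : ℤ)) * b * a ^ (n : ℤ)) i j =
      (!![(tt a w ^ n)⁻¹, 0; 0, tt a w ^ n] * (comp w b).1 *
        !![tt a w ^ n, 0; 0, (tt a w ^ n)⁻¹]) i j := by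
    intro i j
    rw [map_mul, map_mul, Matrix.SpecialLinearGroup.coe_mul, Matrix.SpecialLinearGroup.coe_mul,
      comp_zpow ha, comp_zpow ha]
    simp
  have ht : tt a w ^ n ≠ 0 := pow_ne_zero _ (tt_ne_zero ha w)
  have hn : ‖tt a w ^ n‖ = Real.exp (n * (expo a w / 2)) := by
    simpa using norm_tt_zpow ha (n : ℤ) w
  have hs := norm_comp_sub_one_lt hb.1 w
  have h00 := hs 0 0
  have h11 := hs 1 1
  have h01 := hs 0 1
  have h10 := hs 1 0
  simp only [Matrix.one_apply_eq, Matrix.one_apply_ne (by decide : (0 : Fin 2) ≠ 1),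
    Matrix.one_apply_ne (by decide : (1 : Fin 2) ≠ 0), sub_zero] at h00 h11 h01 h10
  have hdiag : ∀ x : ℂ, ‖x - 1‖ < 1 → ‖x‖ ≤ 2 := fun x hx => by
    have := norm_add_le (x - 1) 1
    rw [sub_add_cancel, norm_one] at this
    linarith
  have htri := hb.2 w
  refine colNorm_inv_le_three ?_ ?_ ?_ ?_ <;> rw [he] <;>
    simp only [Matrix.mul_apply, Fin.sum_univ_two, Matrix.of_apply, Matrix.cons_val',
      Matrix.cons_val_zero, Matrix.cons_val_one, Matrix.cons_val_fin_one, mul_zero, zero_mul,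
      add_zero, zero_add]
  · rw [mul_right_comm, inv_mul_cancel₀ ht, one_mul]
    exact hdiag _ h00
  · rw [mul_right_comm, mul_inv_cancel₀ ht, one_mul]
    exact hdiag _ h11
  -- Conjugation multiplies an off-diagonal entry by t^(±2n). Either that entry vanishes by
  -- triangularity, or the factor has modulus at most 1; this includes neutral places, where it
  -- equals 1.
  · rcases lt_or_ge (expo a w) 0 with h | h
    · rw [htri.2 h]
      simp
    · have : 1 ≤ ‖tt a w ^ n‖ := by
        rw [hn]
        exact Real.one_le_exp (by positivity)
      rw [norm_mul, norm_mul, norm_inv]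
      have h1 := inv_le_one_of_one_le₀ this
      have h2 : 0 ≤ ‖tt a w ^ n‖⁻¹ := by positivity
      exact mul_le_one₀ (mul_le_one₀ h1 (norm_nonneg _) h01.le) h2 h1
  · rcases lt_or_ge 0 (expo a w) with h | h
    · rw [htri.1 h]
      simp
    · have : ‖tt a w ^ n‖ ≤ 1 := by
        rw [hn]
        exact Real.exp_le_one_iff.2 (mul_nonpos_of_nonneg_of_nonpos (by positivity) (by linarith))
      rw [norm_mul, norm_mul]
      exact mul_le_one₀ (mul_le_one₀ this (norm_nonneg _) h10.le) (norm_nonneg _) this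

end HilbertModular

end

/-! ### Comparing nearby orbits and covering at the scale exp(-N a_*). -/

noncomputable section

namespace HilbertModular

open scoped ENNReal

variable {F : Type*} [Field F] [NumberField F] {a : G F}

/-! ### Time spent in the cusp -/

/-- The number of `0 ≤ j < N` for which `x aʲ` lies in the cusp neighbourhood `{sys < τ}`. -/
def cuspTime (a : G F) (τ : ℝ) (N : ℕ) (x : X F) : ℕ :=
  ((Finset.range N).filter fun j => sysX (act x (a ^ j)) < τ).card

lemma distortBound_pos : 0 < distortBound F := zero_lt_one.trans_le one_le_distortBound

/-- Points which differ by a stable element and a sufficiently small unstable element have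
comparable heights for a long time. -/
lemma sys_transfer (ha : IsDiagonal a) (g : G F) {z z' : V a} {b : G F} (hb : b ∈ stableBall a 1)
    {N j : ℕ} (hj : j ≤ N) (hz : ‖z' - z‖ ≤ Real.exp (-(N * aStar a))) :
    sys (g * uni z' * a ^ j) ≤
      distortBound F * distortBound F * sys (g * uni z * b * a ^ j) := by
  have hA : 0 ≤ aStar a := by
    obtain ⟨w⟩ := (inferInstance : Nonempty (InfinitePlace F))
    exact (abs_nonneg _).trans (Finset.le_sup' (fun w => |expo a w|) (Finset.mem_univ w))
  -- The two orbit points differ by a conjugate of b that the flow does not expand and by an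
  -- unstable displacement that is still bounded at time j ≤ N.
  have hdec : g * uni z' * a ^ j = g * uni z * b * a ^ j *
      (a ^ (-(j : ℤ)) * b * a ^ (j : ℤ))⁻¹ * uni (expand (j : ℤ) (z' - z)) := by
    have h1 := uni_mul_zpow ha (j : ℤ) (z' - z)
    have h2 : uni z' = uni z * uni (z' - z) := by rw [← uni_add, add_sub_cancel]
    rw [zpow_natCast] at h1
    rw [h2, zpow_neg, zpow_natCast, ← mul_assoc g, mul_assoc (g * uni z), h1]
    group
  have hexp : ‖expand (j : ℤ) (z' - z)‖ ≤ 2 := by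
    refine (norm_expand_le ha j _).trans ?_
    calc Real.exp (j * aStar a) * ‖z' - z‖
        ≤ Real.exp (N * aStar a) * Real.exp (-(N * aStar a)) := by gcongr
      _ = 1 := by rw [← Real.exp_add, add_neg_cancel, Real.exp_zero]
      _ ≤ 2 := one_le_two
  rw [hdec, mul_assoc (distortBound F)]
  refine (sys_mul_le _ _).trans (mul_le_mul (distort_uni_le hexp) ?_ (sys_pos _).le
    distortBound_pos.le)
  exact (sys_mul_le _ _).trans
    (mul_le_mul_of_nonneg_right (distort_conj_stable_le ha hb j) (sys_pos _).le)

/-- Comparison of visits to the cusp with visits along multiples of `m`. -/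
lemma card_le_visits (ha : IsDiagonal a) (hh : 0 ≤ hMax a) {m : ℕ} (hm : 0 < m) (τ : ℝ) (N : ℕ)
    (h : G F) :
    ((Finset.range N).filter fun j => sys (h * a ^ j) < τ).card ≤
      m * (1 + visits (Real.exp (m / 2 * hMax a) * τ) (a ^ m) (N / m) h) := by
  classical
  set s := (Finset.range N).filter fun j => sys (h * a ^ j) < τ with hs
  -- Times are grouped in blocks of length m. A visit inside a block makes the start of the block a
  -- visit for a threshold larger by exp(m h_max / 2). Block 0 is added separately because `visits`
  -- starts at the first multiple of m.
  have himg : (s.image fun j => j / m) ⊆ insert 0 (((Finset.range (N / m)).filter fun i =>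
      sys (h * (a ^ m) ^ (i + 1)) < Real.exp (m / 2 * hMax a) * τ).image fun i => i + 1) := by
    intro i hi
    obtain ⟨j, hj, rfl⟩ := Finset.mem_image.1 hi
    rw [hs, Finset.mem_filter, Finset.mem_range] at hj
    rcases Nat.eq_zero_or_pos (j / m) with h0 | h0
    · exact Finset.mem_insert.2 (Or.inl h0)
    · refine Finset.mem_insert_of_mem (Finset.mem_image.2 ⟨j / m - 1, ?_, by omega⟩)
      have hjN : j / m ≤ N / m := Nat.div_le_div_right hj.1.le
      rw [Finset.mem_filter, Finset.mem_range]
      refine ⟨by omega, ?_⟩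
      rw [Nat.sub_add_cancel h0, ← pow_mul]
      have hdec : h * a ^ (m * (j / m)) = h * a ^ j * (a ^ (j % m))⁻¹ := by
        conv_rhs => rw [← Nat.div_add_mod j m, pow_add]
        rw [Nat.mul_add_mod, Nat.mod_mod, mul_assoc, mul_assoc, mul_inv_cancel, mul_one]
      rw [hdec]
      refine (sys_mul_le _ _).trans_lt ?_
      have hmod : ((j % m : ℕ) : ℝ) ≤ m := by exact_mod_cast (Nat.mod_lt j hm).le
      have h1 : distort (a ^ (j % m))⁻¹ ≤ Real.exp (m / 2 * hMax a) :=
        (distort_pow_inv_le ha _).trans (Real.exp_le_exp.2 (by gcongr))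
      exact mul_lt_mul_of_le_of_lt_of_nonneg_of_pos h1 hj.2 (sys_pos _).le (Real.exp_pos _)
  refine (Finset.card_le_mul_card_image (f := fun j => j / m) s m fun i _ => ?_).trans
    (Nat.mul_le_mul_left m ((Finset.card_le_card himg).trans
      ((Finset.card_insert_le _ _).trans ?_)))
  · have hsub : (s.filter fun x => x / m = i) ⊆ Finset.Ico (i * m) (i * m + m) := by
      intro x hx
      have := (Finset.mem_filter.1 hx).2
      rw [Nat.div_eq_iff hm] at this
      rw [Finset.mem_Ico]
      omega
    refine (Finset.card_le_card hsub).trans ?_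
    simp
  · rw [add_comm]
    exact Nat.add_le_add_left Finset.card_image_le 1

/-! ### Covering by unstable balls -/

/-- The part of `Γ \ G` around `Γ g` parametrized by the unstable and stable directions. -/
def chart (a : G F) (g : G F) : Set (X F) :=
  {x | ∃ z : V a, ‖z‖ < 1 / 2 ∧ ∃ b ∈ stableBall a (1 / 2), x = mk (g * uni z * b)}

/-- The local product decomposition near 1 is translated by g and pushed down by the open projection
to X. -/
lemma chart_mem_nhds (ha : IsDiagonal a)
    (hneutral : ∀ w : ComplexPlace F, expo a w.1 = 0 → a.2 w ∈ Subgroup.center SL(2, ℂ))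
    (g : G F) : chart a g ∈ 𝓝 (mk g) := by
  have h := eventually_eq_uni_mul ha hneutral (r := 1 / 2) (η := 1 / 2) (by norm_num) (by norm_num)
  have hmap : Tendsto (fun k : G F => g⁻¹ * k) (𝓝 g) (𝓝 1) := by
    have : Continuous fun k : G F => g⁻¹ * k := by fun_prop
    simpa using this.tendsto g
  have h2 := isOpenMap_mk.image_mem_nhds (hmap.eventually h)
  refine Filter.mem_of_superset h2 ?_
  rintro _ ⟨k, ⟨z, hz, b, hb, hk⟩, rfl⟩
  refine ⟨z, hz, b, hb, ?_⟩
  rw [mul_assoc, ← hk, mul_inv_cancel_left]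

/-- A covering estimate: the measure of a set is controlled by the volume of its thickened trace on
the unstable direction. -/
lemma measure_inter_chart_le (ha : IsDiagonal a) (ν : Measure (X F)) {r : ℝ} (hr : 0 < r)
    {c : ℝ≥0∞} (hν : ∀ x : X F, ν (act x '' (ball (UPlus a : Set (G F)) (6 * r) *
      ball ((UMinus a : Set (G F)) * (L a : Set (G F))) (1 / 2))) ≤ c)
    (g : G F) (Z : Set (X F)) (S : Set (V a))
    (hS : ∀ z : V a, ‖z‖ < 1 / 2 → (∃ b ∈ stableBall a (1 / 2), mk (g * uni z * b) ∈ Z) →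
      Metric.closedBall z r ⊆ S) :
    ν (Z ∩ chart a g) ≤ c / volume (Metric.closedBall (0 : V a) r) * volume S := by
  set E : Set (V a) := {z | ‖z‖ < 1 / 2 ∧ ∃ b ∈ stableBall a (1 / 2), mk (g * uni z * b) ∈ Z}
  -- Disjointness of the r-balls bounds their number by volume, while the enlarged balls of radius
  -- 5r cover the trace. The radius 6r in the hypothesis leaves room for the strict inequality in
  -- `ball`.
  obtain ⟨u, huE, hdisj, hcov⟩ := Vitali.exists_disjoint_subfamily_covering_enlargement_closedBall
    E id (fun _ => r) r (fun _ _ => le_rfl) 5 (by norm_num)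
  simp only [id] at hdisj hcov
  have hcount : u.Countable := hdisj.countable_of_nonempty_interior fun x _ =>
    ⟨x, Metric.ball_subset_interior_closedBall (Metric.mem_ball_self hr)⟩
  have hsub : Z ∩ chart a g ⊆ ⋃ p ∈ u, act (mk (g * uni p)) '' (ball (UPlus a : Set (G F)) (6 * r) *
      ball ((UMinus a : Set (G F)) * (L a : Set (G F))) (1 / 2)) := by
    rintro _ ⟨hxZ, z, hz, b, hb, rfl⟩
    obtain ⟨p, hp, hzp⟩ := hcov z ⟨hz, b, hb, hxZ⟩
    have h1 := hzp (Metric.mem_closedBall_self hr.le)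
    rw [mem_closedBall_iff_norm] at h1
    refine Set.mem_biUnion hp ⟨uni (z - p) * b, Set.mul_mem_mul (uni_mem_ball ha (by linarith)) hb.1, ?_⟩
    rw [act_mk, mul_assoc, ← mul_assoc (uni p), ← uni_add, add_sub_cancel, mul_assoc]
  set q := volume (Metric.closedBall (0 : V a) r) with hq
  have hq0 : q ≠ 0 := (Metric.measure_closedBall_pos _ _ hr).ne'
  have hqt : q ≠ ⊤ := measure_closedBall_lt_top.ne
  have hvol : ∑' _ : u, q ≤ volume S := by
    have h1 := measure_biUnion (μ := (volume : Measure (V a))) hcount hdisj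
      fun p _ => Metric.isClosed_closedBall.measurableSet
    have h2 : volume (⋃ p ∈ u, Metric.closedBall p r) ≤ volume S :=
      measure_mono (Set.iUnion₂_subset fun p hp => hS p (huE hp).1 (huE hp).2)
    rw [h1] at h2
    refine le_trans (le_of_eq (tsum_congr fun p => ?_)) h2
    exact (Measure.addHaar_closedBall_center _ p.1 r).symm
  calc ν (Z ∩ chart a g) ≤ ∑' p : u, ν (act (mk (g * uni p.1)) '' (ball (UPlus a : Set (G F)) (6 * r) *
        ball ((UMinus a : Set (G F)) * (L a : Set (G F))) (1 / 2))) :=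
        (measure_mono hsub).trans (measure_biUnion_le ν hcount _)
    _ ≤ ∑' _ : u, c / q * q := by
        refine ENNReal.tsum_le_tsum fun p => ?_
        rw [ENNReal.div_mul_cancel hq0 hqt]
        exact hν _
    _ = c / q * ∑' _ : u, q := ENNReal.tsum_mul_left
    _ ≤ c / q * volume S := mul_le_mul' le_rfl hvol

/-- The thickened trace of the set of points which spend much time in the cusp. -/
lemma closedBall_subset_visits (ha : IsDiagonal a) (hh : 0 ≤ hMax a) {m : ℕ} (hm : 0 < m) {τ κ : ℝ}
    {N n : ℕ} (hn : (n : ℝ) < κ * N / m) (g : G F) {z : V a} (hz : ‖z‖ < 1 / 2)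
    (hb : ∃ b ∈ stableBall a (1 / 2), mk (g * uni z * b) ∈ {x : X F | κ * N ≤ cuspTime a τ N x}) :
    Metric.closedBall z (Real.exp (-(N * aStar a)) / 2) ⊆
      {z' : V a | n ≤ visits (Real.exp (m / 2 * hMax a) * (distortBound F * distortBound F * τ))
        (a ^ m) (N / m) (g * uni z')} ∩ Metric.ball 0 1 := by
  obtain ⟨b, hb, hcount⟩ := hb
  have hb1 : b ∈ stableBall a 1 := by
    refine ⟨⟨hb.1.1, fun w i j => (hb.1.2.1 w i j).trans (by norm_num),
      fun w i j => (hb.1.2.2 w i j).trans (by norm_num)⟩, hb.2⟩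
  have hA : 0 ≤ aStar a := by
    obtain ⟨w⟩ := (inferInstance : Nonempty (InfinitePlace F))
    exact (abs_nonneg _).trans (Finset.le_sup' (fun w => |expo a w|) (Finset.mem_univ w))
  intro z' hz'
  rw [mem_closedBall_iff_norm] at hz'
  have hr1 : Real.exp (-(N * aStar a)) ≤ 1 := Real.exp_le_one_iff.2 (by
    have : 0 ≤ N * aStar a := by positivity
    linarith)
  have hz1 : ‖z' - z‖ ≤ Real.exp (-(N * aStar a)) := by
    have := Real.exp_pos (-(N * aStar a))
    linarith
  refine ⟨?_, ?_⟩
  swap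
  · rw [mem_ball_zero_iff]
    have h1 := norm_add_le (z' - z) z
    rw [sub_add_cancel] at h1
    linarith
  have hle : cuspTime a τ N (mk (g * uni z * b)) ≤ ((Finset.range N).filter fun j =>
      sys (g * uni z' * a ^ j) < distortBound F * distortBound F * τ).card := by
    refine Finset.card_le_card fun j hj => ?_
    rw [Finset.mem_filter, Finset.mem_range] at hj ⊢
    refine ⟨hj.1, (sys_transfer ha g hb1 hj.1.le hz1).trans_lt ?_⟩
    have := distortBound_pos (F := F)
    exact mul_lt_mul_of_pos_left hj.2 (by positivity)
  have h2 := hle.trans (card_le_visits ha hh hm _ N (g * uni z'))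
  set k := visits (Real.exp (m / 2 * hMax a) * (distortBound F * distortBound F * τ))
        (a ^ m) (N / m) (g * uni z') with hk
  have h3 : (cuspTime a τ N (mk (g * uni z * b)) : ℝ) ≤ m * (1 + k) := by exact_mod_cast h2
  have hm' : (0 : ℝ) < m := by exact_mod_cast hm
  have h4 : κ * N / m ≤ 1 + k := by
    rw [div_le_iff₀ hm']
    have h5 : κ * N ≤ cuspTime a τ N (mk (g * uni z * b)) := hcount
    linarith
  have h5 : (n : ℝ) < 1 + k := hn.trans_le h4
  have h6 : n < 1 + k := by exact_mod_cast h5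
  exact Nat.lt_one_add_iff.1 h6

end HilbertModular

end

noncomputable section

namespace HilbertModular

open scoped ENNReal

variable {F : Type*} [Field F] [NumberField F] {a : G F}

/-! ### Exponential decay of the measure of orbits staying in the cusp -/

lemma aStar_pos (h : 0 < hMax a) : 0 < aStar a := by
  by_contra hA
  have h0 : ∀ w : InfinitePlace F, |expo a w| = 0 := fun w => le_antisymm
    ((Finset.le_sup' (fun w => |expo a w|) (Finset.mem_univ w)).trans (not_lt.1 hA)) (abs_nonneg _)
  simp [hMax, h0] at h

/-- The order of quantifiers matters: K depends on β but not on m, τ or g, so that K^(N/m) becomes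
negligible for large m. Only M depends on the base point, through its height. -/
lemma exists_volume_visits_le_exp (ha : IsDiagonal a) (hh : 0 ≤ hMax a) {β : ℝ} (hβ : 0 < β)
    (hβ1 : β < 1) : ∃ K : ℝ, 1 ≤ K ∧ ∀ (m : ℕ) (τ : ℝ), (∏ w : InfinitePlace F, (2 : ℝ) ^ w.mult) *
      (distortBound F * Real.exp (m / 2 * hMax a) * (distortBound F * τ) *
        (distortBound F * Real.exp (m / 2 * hMax a) * (distortBound F * τ))) < 1 →
      ∀ g : G F, ∃ M : ℝ, 0 ≤ M ∧ ∀ k n : ℕ,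
        volume ({z : V a | n ≤ visits τ (a ^ m) k (g * uni z)} ∩ Metric.ball 0 1) ≤
          ENNReal.ofReal (M * K ^ k * Real.exp (-(n * (m / 2 * hMax a * β)))) := by
  obtain ⟨C, hCt, hC⟩ := exists_lintegral_Nm_le ha hβ hβ1
  have hW0 : volume (Metric.ball (0 : V a) 1) ≠ 0 := (Metric.measure_ball_pos _ _ one_pos).ne'
  have hWt : volume (Metric.ball (0 : V a) 1) ≠ ⊤ := measure_ball_lt_top.ne
  set W := volume (Metric.ball (0 : V a) 1)
  set q := (volume (Metric.ball (0 : V a) 2) + C) / W with hq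
  have hqt : q ≠ ⊤ :=
    ENNReal.div_ne_top (ENNReal.add_ne_top.2 ⟨measure_ball_lt_top.ne, hCt⟩) hW0
  refine ⟨max 1 q.toReal, le_max_left _ _, fun m τ hτ g => ⟨W.toReal * (alpha (distortBound F * τ) β g).toReal,
    by positivity, fun k n => ?_⟩⟩
  have h1 := volume_visits_le ha hβ hC hh m hτ k g n
  set v := volume ({z : V a | n ≤ visits τ (a ^ m) k (g * uni z)} ∩ Metric.ball 0 1)
  have hα := alpha_ne_top (τ := distortBound F * τ) hβ g
  rw [ENNReal.ofReal_rpow_of_pos (Real.exp_pos _), ← Real.exp_mul,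
    ← ENNReal.ofReal_pow (Real.exp_pos _).le, ← Real.exp_nat_mul] at h1
  set t := (n : ℝ) * (m / 2 * hMax a * β)
  have hq' : q ≤ ENNReal.ofReal (max 1 q.toReal) :=
    (ENNReal.ofReal_toReal hqt).symm.le.trans (ENNReal.ofReal_le_ofReal (le_max_right _ _))
  have h2 : W * q ^ k * alpha (distortBound F * τ) β g ≤
      ENNReal.ofReal (W.toReal * (alpha (distortBound F * τ) β g).toReal * max 1 q.toReal ^ k) := by
    rw [ENNReal.ofReal_mul (by positivity), ENNReal.ofReal_mul (by positivity),
      ENNReal.ofReal_toReal hWt, ENNReal.ofReal_toReal hα, ENNReal.ofReal_pow (by positivity),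
      mul_right_comm]
    gcongr
  calc v = ENNReal.ofReal (Real.exp (-t)) * (ENNReal.ofReal (Real.exp t) * v) := by
        rw [← mul_assoc, ← ENNReal.ofReal_mul (Real.exp_pos _).le, ← Real.exp_add]
        simp
    _ ≤ ENNReal.ofReal (Real.exp (-t)) * ENNReal.ofReal
        (W.toReal * (alpha (distortBound F * τ) β g).toReal * max 1 q.toReal ^ k) := by
        gcongr
        exact h1.trans h2
    _ = _ := by
        rw [← ENNReal.ofReal_mul (Real.exp_pos _).le, mul_comm (Real.exp _)]

/-- The set of points spending a proportion `κ` of their time high in the cusp has measure tending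
to zero, provided that `κ` is large in terms of the unstable dimension of the measure. -/
lemma exists_tendsto_measure_cuspTime (ha : IsDiagonal a) (hpos : 0 < hMax a)
    (hneutral : ∀ w : ComplexPlace F, expo a w.1 = 0 → a.2 w ∈ Subgroup.center SL(2, ℂ))
    {d : ℝ} {ν : Measure (X F)} (hν : UnstableDimGE a ν d) {κ : ℝ} (hκ : 0 < κ)
    (hκd : aStar a * (Module.finrank ℝ (V a) - d) < κ * hMax a / 2) :
    ∃ τ : ℝ, 0 < τ ∧ ∀ K : Set (X F), IsCompact K →
      Tendsto (fun N : ℕ => ν (K ∩ {x | κ * N ≤ cuspTime a τ N x})) atTop (𝓝 0) := by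
  have hA := aStar_pos hpos
  set A := aStar a with hAdef
  set h := hMax a with hhdef
  set D := Module.finrank ℝ (V a) with hD
  have hκh : 0 < κ * h / 2 := by positivity
  -- The assumption on κ leaves room for some β < 1 with β κ h/2 > A(D - d). The difference is the
  -- exponential rate available to absorb errors.
  obtain ⟨β, hβl, hβ1⟩ := exists_between (max_lt one_pos ((div_lt_one hκh).2 hκd))
  have hβ : 0 < β := (le_max_left _ _).trans_lt hβl
  have hgap : 0 < β * (κ * h / 2) - A * (D - d) :=
    sub_pos.2 ((div_lt_iff₀ hκh).1 ((le_max_right _ _).trans_lt hβl))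
  set gap := β * (κ * h / 2) - A * (D - d) with hgapdef
  -- At scale exp(-NA), the loss δ in the dimension costs the rate A δ = gap/3.
  obtain ⟨ε', hε', c₀, hc₀, hball⟩ := hν (gap / (3 * A)) (by positivity)
  obtain ⟨K, hK1, hvol⟩ := exists_volume_visits_le_exp ha hpos.le hβ hβ1
  -- With this m, the factor K^(N/m) costs a rate below gap/3.
  obtain ⟨m, hmK⟩ := exists_nat_gt (max 0 (Real.log K / (gap / 3)))
  have hm0 : (0 : ℝ) < m := (le_max_left _ _).trans_lt hmK
  have hm : 0 < m := by exact_mod_cast hm0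
  have hlogK : Real.log K / m < gap / 3 := by
    have := (le_max_right _ _).trans_lt hmK
    rw [div_lt_iff₀ (by positivity)] at this
    rw [div_lt_iff₀ hm0]
    linarith
  obtain ⟨τ₀, hτ₀, hτ₀'⟩ : ∃ τ : ℝ, 0 < τ ∧ (∏ w : InfinitePlace F, (2 : ℝ) ^ w.mult) *
      (distortBound F * Real.exp (m / 2 * hMax a) * (distortBound F * τ) *
        (distortBound F * Real.exp (m / 2 * hMax a) * (distortBound F * τ))) < 1 := by
    have hcont : Continuous fun τ : ℝ => (∏ w : InfinitePlace F, (2 : ℝ) ^ w.mult) *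
      (distortBound F * Real.exp (m / 2 * hMax a) * (distortBound F * τ) *
        (distortBound F * Real.exp (m / 2 * hMax a) * (distortBound F * τ))) := by fun_prop
    have h0 := (hcont.tendsto 0).eventually (gt_mem_nhds (show _ < (1 : ℝ) by simp))
    exact ((eventually_mem_nhdsWithin (a := (0 : ℝ)) (s := Set.Ioi 0)).and
      (h0.filter_mono nhdsWithin_le_nhds)).exists
  have hdB := distortBound_pos (F := F)
  -- The divisor compensates the passage to multiples of m and the comparison of nearby orbits.
  set τ := τ₀ / (Real.exp (m / 2 * hMax a) * (distortBound F * distortBound F)) with hτ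
  have hττ : Real.exp (m / 2 * hMax a) * (distortBound F * distortBound F * τ) = τ₀ := by
    rw [hτ]; field_simp
  refine ⟨τ, by positivity, ?_⟩
  set ρ := gap - gap / 3 - Real.log K / m with hρdef
  have hρ : 0 < ρ := by linarith
  set W := volume (Metric.ball (0 : V a) 1) with hWdef
  have hW0 : W ≠ 0 := (Metric.measure_ball_pos _ _ one_pos).ne'
  have hWt : W ≠ ⊤ := measure_ball_lt_top.ne
  have hchart : ∀ g : G F, Tendsto
      (fun N : ℕ => ν ({x | κ * N ≤ cuspTime a τ N x} ∩ chart a g)) atTop (𝓝 0) := by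
    intro g
    obtain ⟨M, hM, hvolg⟩ := hvol m τ₀ hτ₀' g
    set e := d - gap / (3 * A) with he
    -- The factors 3^e and 2^D come from the radii 6r = 3 exp(-NA) and r = exp(-NA)/2; the last
    -- factor pays for rounding the number of visits.
    set Q := c₀ * 3 ^ e * (2 ^ D / W.toReal) * M * Real.exp (m / 2 * h * β) with hQ
    have hlim : Tendsto (fun N : ℕ => ENNReal.ofReal (Q * Real.exp (-(N * ρ)))) atTop (𝓝 0) := by
      have h1 : Tendsto (fun N : ℕ => (N : ℝ) * ρ) atTop atTop :=
        tendsto_natCast_atTop_atTop.atTop_mul_const hρ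
      have h2 := (Real.tendsto_exp_neg_atTop_nhds_zero.comp h1).const_mul Q
      rw [mul_zero] at h2
      simpa using ENNReal.tendsto_ofReal h2
    have hsmall : ∀ᶠ N : ℕ in atTop, 6 * (Real.exp (-(N * A)) / 2) < ε' := by
      have h1 : Tendsto (fun N : ℕ => (N : ℝ) * A) atTop atTop :=
        tendsto_natCast_atTop_atTop.atTop_mul_const hA
      have h2 := ((Real.tendsto_exp_neg_atTop_nhds_zero.comp h1).div_const 2).const_mul 6
      rw [zero_div, mul_zero] at h2
      exact h2.eventually (gt_mem_nhds hε')
    refine tendsto_of_tendsto_of_tendsto_of_le_of_le' tendsto_const_nhds hlim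
      (Eventually.of_forall fun _ => zero_le) ?_
    filter_upwards [hsmall, eventually_ge_atTop 1] with N hN hN1
    set r := Real.exp (-(N * A)) / 2 with hr
    have hr0 : 0 < r := by positivity
    have hN0 : (0 : ℝ) < N := by exact_mod_cast hN1
    have hkNm : 0 < κ * N / m := by positivity
    -- The largest integer strictly below κN/m: strictness is needed because block 0 may account for
    -- one block of cusp time that is not counted as a visit.
    set n := ⌈κ * N / m⌉₊ - 1 with hn
    have hn1 : (n : ℝ) + 1 = ⌈κ * N / m⌉₊ := by
      have : n + 1 = ⌈κ * N / m⌉₊ := Nat.sub_add_cancel (Nat.ceil_pos.2 hkNm)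
      exact_mod_cast this
    have hnlt : (n : ℝ) < κ * N / m := by
      have := Nat.ceil_lt_add_one hkNm.le
      linarith
    have hnge : κ * N / m ≤ n + 1 := hn1 ▸ Nat.le_ceil _
    have h1 := measure_inter_chart_le ha ν hr0
      (fun x => hball (6 * r) (by positivity) hN (1 / 2) (by norm_num) (by norm_num) x) g
      {x | κ * N ≤ cuspTime a τ N x} _
      (fun z hz hb => closedBall_subset_visits ha hpos.le hm hnlt g hz hb)
    rw [hττ] at h1
    refine h1.trans ?_
    rw [Measure.addHaar_closedBall _ _ hr0.le, ← hWdef, ← ENNReal.ofReal_toReal hWt,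
      ← ENNReal.ofReal_mul (by positivity), ← ENNReal.ofReal_div_of_pos
        (mul_pos (by positivity) (ENNReal.toReal_pos hW0 hWt))]
    refine (mul_le_mul_right (hvolg _ _) _).trans ?_
    rw [← ENNReal.ofReal_mul (by have := ENNReal.toReal_pos hW0 hWt; positivity)]
    refine ENNReal.ofReal_le_ofReal ?_
    have hpow : K ^ (N / m) ≤ Real.exp (N * (Real.log K / m)) := by
      have hK0 : 0 < K := one_pos.trans_le hK1
      calc K ^ (N / m) = Real.exp (((N / m : ℕ) : ℝ) * Real.log K) := by
            rw [Real.exp_nat_mul, Real.exp_log hK0]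
        _ ≤ Real.exp (N * (Real.log K / m)) := by
            rw [Real.exp_le_exp, mul_div_assoc', mul_div_right_comm]
            exact mul_le_mul_of_nonneg_right Nat.cast_div_le (Real.log_nonneg hK1)
    have hexp : Real.exp (-(n * (m / 2 * hMax a * β))) ≤
        Real.exp (m / 2 * h * β) * Real.exp (-(N * (β * (κ * h / 2)))) := by
      rw [← Real.exp_add, Real.exp_le_exp]
      have h2 : 0 ≤ m / 2 * h * β := by positivity
      have h3 := mul_le_mul_of_nonneg_right hnge h2
      have h4 : κ * N / m * (m / 2 * h * β) = N * (β * (κ * h / 2)) := by field_simp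
      rw [h4] at h3
      linarith
    have h6 : (6 * r) ^ e = 3 ^ e * Real.exp (-(N * A * e)) := by
      rw [hr, show 6 * (Real.exp (-(N * A)) / 2) = 3 * Real.exp (-(N * A)) by ring,
        Real.mul_rpow (by norm_num) (Real.exp_pos _).le, ← Real.exp_mul, neg_mul]
    have h7 : r ^ D = (2 ^ D)⁻¹ * Real.exp (-(N * A * D)) := by
      rw [hr, div_pow, ← Real.exp_nat_mul, div_eq_inv_mul]
      congr 2
      ring
    have hWpos := ENNReal.toReal_pos hW0 hWt
    have hfin : Real.exp (-(N * ρ)) = Real.exp (-(N * A * e)) * (Real.exp (-(N * A * D)))⁻¹ *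
        Real.exp (N * (Real.log K / m)) * Real.exp (-(N * (β * (κ * h / 2)))) := by
      rw [← Real.exp_neg, ← Real.exp_add, ← Real.exp_add, ← Real.exp_add]
      congr 1
      have hAe : A * e = A * d - gap / 3 := by
        rw [he]; field_simp
      have : N * A * e = N * (A * d - gap / 3) := by rw [mul_assoc, hAe]
      rw [this, hρdef, hgapdef]
      ring
    calc c₀ * (6 * r) ^ e / (r ^ D * W.toReal) *
          (M * K ^ (N / m) * Real.exp (-(n * (m / 2 * hMax a * β))))
        ≤ c₀ * (6 * r) ^ e / (r ^ D * W.toReal) * (M * Real.exp (N * (Real.log K / m)) *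
          (Real.exp (m / 2 * h * β) * Real.exp (-(N * (β * (κ * h / 2)))))) := by gcongr
      _ = Q * Real.exp (-(N * ρ)) := by
          rw [hfin, h6, h7, hQ]
          field_simp
  intro S hS
  -- The constants depend on the base point of the chart, so decay on a compact set is obtained from
  -- a finite subcover.
  obtain ⟨t, -, ht⟩ := hS.elim_nhds_subcover (fun x => chart a (Quotient.out x : G F)) fun x _ => by
    have hx : (mk (Quotient.out x : G F) : X F) = x := Quotient.out_eq x
    have := chart_mem_nhds ha hneutral (Quotient.out x : G F)
    rwa [hx] at this
  have hsum : Tendsto (fun N : ℕ => ∑ x ∈ t, ν ({y | κ * N ≤ cuspTime a τ N y} ∩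
      chart a (Quotient.out x : G F))) atTop (𝓝 0) := by
    simpa using tendsto_finsetSum t fun x _ => hchart (Quotient.out x : G F)
  refine tendsto_of_tendsto_of_tendsto_of_le_of_le tendsto_const_nhds hsum (fun _ => zero_le)
    fun N => ?_
  refine (measure_mono ?_).trans (measure_biUnion_finset_le t _)
  rintro y ⟨hyS, hy⟩
  obtain ⟨x, hx, hyx⟩ := Set.mem_iUnion₂.1 (ht hyS)
  exact Set.mem_biUnion hx ⟨hy, hyx⟩

end HilbertModular

end

/-! ### Tightness of the averages and the mass of their limits. -/

noncomputable section

namespace HilbertModular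

open scoped ENNReal

variable {F : Type*} [Field F] [NumberField F] {a : G F}

/-! ### Averages along orbits -/

lemma isProbabilityMeasure_average (a : G F) (ν : Measure (X F)) [IsProbabilityMeasure ν] {N : ℕ}
    (hN : 0 < N) : IsProbabilityMeasure (average a ν N) := by
  have hm : ∀ j, AEMeasurable ((T a)^[j]) ν := fun j => by
    have : (T a)^[j] = fun x => act x (a ^ j) := funext fun x => T_iterate a j x
    rw [this]
    exact (continuous_act _).measurable.aemeasurable
  refine ⟨?_⟩
  simp only [average, Measure.smul_apply, Measure.finsetSum_apply, smul_eq_mul,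
    Measure.map_apply_of_aemeasurable (hm _) MeasurableSet.univ, Set.preimage_univ, measure_univ,
    Finset.sum_const, Finset.card_range, nsmul_eq_mul, mul_one]
  exact ENNReal.inv_mul_cancel (by exact_mod_cast hN.ne') (ENNReal.natCast_ne_top N)

/-- The left side is the ν-average of the proportion of time spent in the cusp. That proportion is
below κ off the exceptional set and at most 1 on it. -/
lemma average_sysX_lt_le (a : G F) (ν : Measure (X F)) [IsProbabilityMeasure ν] {τ κ : ℝ}
    (hκ : 0 ≤ κ) {N : ℕ} (hN : 0 < N) (K : Set (X F)) :
    average a ν N {x | sysX x < τ} ≤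
      ENNReal.ofReal κ + (ν Kᶜ + ν (K ∩ {x | κ * N ≤ cuspTime a τ N x})) := by
  classical
  have hopen : IsOpen {x : X F | sysX x < τ} := isOpen_lt continuous_sysX continuous_const
  have hact : ∀ j : ℕ, Measurable fun x : X F => act x (a ^ j) := fun j =>
    (continuous_act _).measurable
  have hset : ∀ j : ℕ, MeasurableSet {x : X F | sysX (act x (a ^ j)) < τ} := fun j =>
    hact j hopen.measurableSet
  have hmeas : ∀ j : ℕ, Measurable
      ({x : X F | sysX (act x (a ^ j)) < τ}.indicator fun _ => (1 : ℝ≥0∞)) := fun j =>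
    measurable_const.indicator (hset j)
  have hcount : ∀ x : X F, (cuspTime a τ N x : ℝ≥0∞) = ∑ j ∈ Finset.range N,
      {x : X F | sysX (act x (a ^ j)) < τ}.indicator (fun _ => (1 : ℝ≥0∞)) x := fun x => by
    simp [cuspTime, Set.indicator_apply, Finset.sum_boole]
  set Z := {x : X F | κ * N ≤ cuspTime a τ N x} with hZ
  have hNt : (N : ℝ≥0∞) ≠ 0 := by exact_mod_cast hN.ne'
  have hle : ∀ x, (cuspTime a τ N x : ℝ≥0∞) ≤
      ENNReal.ofReal κ * N + Z.indicator (fun _ => (N : ℝ≥0∞)) x := by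
    intro x
    by_cases hx : x ∈ Z
    · rw [Set.indicator_of_mem hx]
      refine le_trans ?_ le_add_self
      have : cuspTime a τ N x ≤ N := (Finset.card_filter_le _ _).trans (Finset.card_range N).le
      exact_mod_cast this
    · refine le_trans ?_ le_self_add
      have h1 : (cuspTime a τ N x : ℝ) ≤ κ * N := (not_le.1 hx).le
      rw [← ENNReal.ofReal_natCast, ← ENNReal.ofReal_natCast N, ← ENNReal.ofReal_mul hκ]
      exact ENNReal.ofReal_le_ofReal h1
  have hZK : ν Z ≤ ν Kᶜ + ν (K ∩ Z) := by
    refine (measure_mono fun x hx => ?_).trans (measure_union_le _ _)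
    by_cases hxK : x ∈ K
    · exact Or.inr ⟨hxK, hx⟩
    · exact Or.inl hxK
  have havg : average a ν N {x | sysX x < τ} =
      (N : ℝ≥0∞)⁻¹ * ∫⁻ x, (cuspTime a τ N x : ℝ≥0∞) ∂ν := by
    simp_rw [hcount]
    rw [lintegral_finsetSum _ fun j _ => hmeas j, average, Measure.smul_apply,
      Measure.finsetSum_apply, smul_eq_mul]
    congr 1
    refine Finset.sum_congr rfl fun j _ => ?_
    have : (T a)^[j] = fun x => act x (a ^ j) := funext fun x => T_iterate a j x
    rw [this, Measure.map_apply (hact j) hopen.measurableSet]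
    exact (lintegral_indicator_one (hset j)).symm
  calc average a ν N {x | sysX x < τ} = (N : ℝ≥0∞)⁻¹ * ∫⁻ x, (cuspTime a τ N x : ℝ≥0∞) ∂ν := havg
    _ ≤ (N : ℝ≥0∞)⁻¹ * ∫⁻ x, (ENNReal.ofReal κ * N + Z.indicator (fun _ => (N : ℝ≥0∞)) x) ∂ν := by
        gcongr with x
        exact hle x
    _ ≤ (N : ℝ≥0∞)⁻¹ * (ENNReal.ofReal κ * N + N * ν Z) := by
        gcongr
        rw [lintegral_add_left measurable_const, lintegral_const, measure_univ, mul_one]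
        gcongr
        exact lintegral_indicator_const_le _ _
    _ = ENNReal.ofReal κ + ν Z := by
        rw [mul_comm (ENNReal.ofReal κ), ← mul_add, ← mul_assoc,
          ENNReal.inv_mul_cancel hNt (ENNReal.natCast_ne_top N), one_mul]
    _ ≤ _ := by gcongr

/-- The systole is positive everywhere, so the sets {sys < 1/(n+1)} decrease to the empty set. This
reduces ν to a compact set up to ε. -/
lemma exists_measure_sysX_lt_le (ν : Measure (X F)) [IsFiniteMeasure ν] {ε : ℝ≥0∞} (hε : 0 < ε) :
    ∃ s : ℝ, 0 < s ∧ ν {x | sysX x < s} ≤ ε := by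
  have hanti : Antitone fun n : ℕ => {x : X F | sysX x < 1 / ((n : ℝ) + 1)} :=
    fun m n hmn x (hx : sysX x < _) => hx.trans_le (by gcongr)
  have h := tendsto_measure_iInter_atTop (μ := ν) (s := fun n : ℕ => {x : X F | sysX x < 1 / (n + 1)})
    (fun n => (isOpen_lt continuous_sysX continuous_const).measurableSet.nullMeasurableSet)
    hanti ⟨0, measure_ne_top _ _⟩
  have hempty : (⋂ n : ℕ, {x : X F | sysX x < 1 / ((n : ℝ) + 1)}) = ∅ := by
    refine Set.eq_empty_iff_forall_notMem.2 fun x hx => ?_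
    obtain ⟨n, hn⟩ := exists_nat_one_div_lt (sysX_pos x)
    exact hn.not_gt (Set.mem_iInter.1 hx n)
  rw [hempty, measure_empty] at h
  obtain ⟨n, hn⟩ := (h.eventually (gt_mem_nhds hε)).exists
  exact ⟨1 / (n + 1), by positivity, hn.le⟩

/-- A compactly supported function which is `1` on `{sys ≥ τ}`. -/
lemma exists_cutoff {τ : ℝ} (hτ : 0 < τ) : ∃ f : C_c(X F, ℝ), (∀ x, 0 ≤ f x) ∧ (∀ x, f x ≤ 1) ∧
    ∀ x, τ ≤ sysX x → f x = 1 := by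
  -- Piecewise linear in the systole: 0 below τ/2 and 1 above τ. Its support is compact by Mahler's
  -- criterion.
  have hcont : Continuous fun x : X F => max 0 (min 1 (2 * sysX x / τ - 1)) := by
    have := continuous_sysX (F := F)
    fun_prop
  refine ⟨⟨⟨_, hcont⟩, HasCompactSupport.intro' (isCompact_le_sysX (half_pos hτ))
    (isClosed_le continuous_const continuous_sysX) fun x hx => ?_⟩, fun x => le_max_left _ _,
    fun x => max_le zero_le_one (min_le_left _ _), fun x hx => ?_⟩
  · have hx : sysX x < τ / 2 := not_le.1 hx
    refine max_eq_left ((min_le_right _ _).trans ?_)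
    rw [sub_nonpos, div_le_one hτ]
    linarith
  · change max 0 (min 1 (2 * sysX x / τ - 1)) = 1
    have : 1 ≤ 2 * sysX x / τ - 1 := by
      rw [le_sub_iff_add_le, le_div_iff₀ hτ]
      linarith
    rw [min_eq_left this, max_eq_right zero_le_one]

/-- Lower bound for the mass of a weak* limit from uniform tightness estimates. -/
lemma le_measure_univ_of_tendsto {μs : ℕ → Measure (X F)} {μ : Measure (X F)} {τ c : ℝ} (hτ : 0 < τ)
    (hc : 0 ≤ c)
    (hμ : IsWeakStarLimit μs μ) (hprob : ∀ᶠ N in atTop, IsProbabilityMeasure (μs N))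
    (hle : ∀ᶠ N in atTop, μs N {x | sysX x < τ} ≤ ENNReal.ofReal c) :
    ENNReal.ofReal (1 - c) ≤ μ Set.univ := by
  obtain ⟨φ, hφ, hlim⟩ := hμ
  obtain ⟨f, hf0, hf1, hfK⟩ := exists_cutoff (F := F) hτ
  by_cases htop : μ Set.univ = ⊤
  · rw [htop]; exact le_top
  have : IsFiniteMeasure μ := ⟨lt_top_iff_ne_top.2 htop⟩
  have hint : ∀ (ν : Measure (X F)) [IsFiniteMeasure ν], Integrable f ν := fun ν _ =>
    Integrable.of_bound f.continuous.aestronglyMeasurable (μ := ν) 1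
      (Eventually.of_forall fun x => by rw [Real.norm_of_nonneg (hf0 x)]; exact hf1 x)
  have hev : ∀ᶠ k in atTop, 1 - c ≤ ∫ x, f x ∂(μs (φ k)) := by
    filter_upwards [hφ.tendsto_atTop.eventually hprob, hφ.tendsto_atTop.eventually hle] with k hp hk
    have hm : MeasurableSet {x : X F | sysX x < τ} :=
      (isOpen_lt continuous_sysX continuous_const).measurableSet
    have h1 : (μs (φ k)).real {x | sysX x < τ} ≤ c := ENNReal.toReal_le_of_le_ofReal hc hk
    have h2 : (μs (φ k)).real {x | sysX x < τ}ᶜ = 1 - (μs (φ k)).real {x | sysX x < τ} :=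
      probReal_compl_eq_one_sub hm
    have h3 : (μs (φ k)).real {x | sysX x < τ}ᶜ ≤ ∫ x, f x ∂(μs (φ k)) := by
      rw [← integral_indicator_one hm.compl]
      refine integral_mono (integrable_const _ |>.indicator hm.compl) (hint _) fun x => ?_
      refine Set.indicator_le' (s := {x : X F | sysX x < τ}ᶜ) (fun y hy => ?_) (fun y _ => hf0 y) x
      exact (hfK y (not_lt.1 hy)).ge
    linarith
  have h4 : 1 - c ≤ ∫ x, f x ∂μ := ge_of_tendsto (hlim f) hev
  have h5 : ∫ x, f x ∂μ ≤ μ.real Set.univ := by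
    calc ∫ x, f x ∂μ ≤ ∫ _, (1 : ℝ) ∂μ := integral_mono (hint μ) (integrable_const _) hf1
      _ = μ.real Set.univ := by simp
  exact ENNReal.ofReal_le_of_le_toReal (h4.trans h5)

/-- A weak* limit of the averages of a measure of unstable dimension at least `d` loses at most the
proportion `2 a_* (D - d) / h_max` of its mass. -/
theorem ofReal_one_sub_le_measure_univ (ha : IsDiagonal a)
    (hpos : 0 < hMax a)
    (hneutral : ∀ w : ComplexPlace F,
      expo a w.1 = 0 → a.2 w ∈ Subgroup.center SL(2, ℂ))
    (d : ℝ) (hd : d ∈ Set.Icc (0 : ℝ) (lieDim (UPlus a)))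
    (ν : Measure (X F)) [IsProbabilityMeasure ν]
    (hν : UnstableDimGE a ν d)
    (μ : Measure (X F))
    (hμ : IsWeakStarLimit (average a ν) μ) :
    ENNReal.ofReal
        (1 - 2 * aStar a *
            ((lieDim (UPlus a) : ℝ) - d) / hMax a) ≤
      μ Set.univ := by
  have hA := aStar_pos hpos
  set D : ℝ := (lieDim (UPlus a) : ℝ)
  have hDd : 0 ≤ D - d := sub_nonneg.2 hd.2
  set κ₀ := 2 * aStar a * (D - d) / hMax a with hκ₀
  have hκ₀0 : 0 ≤ κ₀ := by positivity
  -- One ε raises κ strictly above the critical value, one bounds the ν-mass outside a compact set,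
  -- and one bounds the exceptional set for large N.
  have key : ∀ ε : ℝ, 0 < ε → ENNReal.ofReal (1 - (κ₀ + 3 * ε)) ≤ μ Set.univ := by
    intro ε hε
    have hκ : 0 < κ₀ + ε := by positivity
    have hκd : aStar a * (Module.finrank ℝ (V a) - d) < (κ₀ + ε) * hMax a / 2 := by
      have h1 : (Module.finrank ℝ (V a) : ℝ) ≤ D := Nat.cast_le.2 (finrank_V_le_lieDim ha)
      have h2 : κ₀ * hMax a / 2 = aStar a * (D - d) := by
        rw [hκ₀]; field_simp
      calc aStar a * (Module.finrank ℝ (V a) - d) ≤ aStar a * (D - d) := by gcongr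
        _ = κ₀ * hMax a / 2 := h2.symm
        _ < _ := by gcongr; linarith
    obtain ⟨τ, hτ, hτK⟩ := exists_tendsto_measure_cuspTime ha hpos hneutral hν hκ hκd
    have hε' : 0 < ENNReal.ofReal ε := ENNReal.ofReal_pos.2 hε
    obtain ⟨s, hs, hsν⟩ := exists_measure_sysX_lt_le ν hε'
    have hK := hτK _ (isCompact_le_sysX hs)
    refine le_measure_univ_of_tendsto hτ (by positivity) hμ ?_ ?_
    · filter_upwards [eventually_gt_atTop 0] with N hN using isProbabilityMeasure_average a ν hN
    · filter_upwards [eventually_gt_atTop 0, hK.eventually (gt_mem_nhds hε')] with N hN hNK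
      refine (average_sysX_lt_le a ν hκ.le hN {x | s ≤ sysX x}).trans ?_
      have hcompl : {x : X F | s ≤ sysX x}ᶜ = {x | sysX x < s} := by ext x; simp
      rw [hcompl, show κ₀ + 3 * ε = (κ₀ + ε) + (ε + ε) by ring,
        ENNReal.ofReal_add hκ.le (by positivity), ENNReal.ofReal_add hε.le hε.le]
      gcongr
  have hlim : Tendsto (fun ε : ℝ => ENNReal.ofReal (1 - (κ₀ + 3 * ε))) (𝓝[>] 0)
      (𝓝 (ENNReal.ofReal (1 - κ₀))) := by
    refine ENNReal.tendsto_ofReal (Tendsto.mono_left ?_ nhdsWithin_le_nhds)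
    have hcont : Continuous fun ε : ℝ => 1 - (κ₀ + 3 * ε) := by fun_prop
    simpa using hcont.tendsto 0
  exact le_of_tendsto hlim (eventually_mem_nhdsWithin.mono fun ε hε => key ε hε)

end HilbertModular

end

theorem theorem1p3 {F : Type*} [Field F] [NumberField F]
    (a : HilbertModular.G F) (ha : HilbertModular.IsDiagonal a)
    (hpos : 0 < HilbertModular.hMax a)
    (hneutral : ∀ w : HilbertModular.ComplexPlace F,
      HilbertModular.expo a w.1 = 0 → a.2 w ∈ Subgroup.center SL(2, ℂ))
    (d : ℝ) (hd : d ∈ Set.Icc (0 : ℝ) (HilbertModular.lieDim (HilbertModular.UPlus a)))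
    (ν : Measure (HilbertModular.X F)) [IsProbabilityMeasure ν]
    (hν : HilbertModular.UnstableDimGE a ν d)
    (μ : Measure (HilbertModular.X F)) [IsFiniteMeasureOnCompacts μ]
    (hμ : HilbertModular.IsWeakStarLimit (HilbertModular.average a ν) μ) :
    ENNReal.ofReal
        (1 - 2 * HilbertModular.aStar a *
            ((HilbertModular.lieDim (HilbertModular.UPlus a) : ℝ) - d) / HilbertModular.hMax a) ≤
      μ Set.univ :=
  HilbertModular.ofReal_one_sub_le_measure_univ ha hpos hneutral d hd ν hν μ hμ
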